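/- For $\tau$ in the upper half-plane $\mathbb H$ let $q=e^{2\pi i\tau}$, $e(x)=e^{2\pi i x}$, let $\eta$ be the Dedekind eta function and $\vartheta(\tau,z)=\sum_{n\in\mathbb Z}\left(\frac{-4}{n}\right)q^{n^2/8}e^{\pi i n z}$ the Jacobi theta function. Let $R$ be a (reduced, crystallographic) root system of one of the eight types $$A_4,\quad A_1\oplus B_3,\quad A_1\oplus C_3,\quad B_2\oplus G_2,\quad 3A_2,\quad 3A_1\oplus A_3,\quad 2A_1\oplus A_2\oplus B_2,\quad 8A_1,$$ with positive roots $R^+$ and simple roots $F$. Write $r=\sum_{f\in F}\gamma_{r,f}f$ for $r\in R^+$, and let $n=|F|$, $N=|R^+|$. Put $$\vartheta_R(\tau,\mathfrak z)=\eta(\tau)^{n-N}\prod_{r\in R^+}\vartheta\Big(\tau,\sum_{f\in F}\gamma_{r,f}z_f\Big),\qquad \mathfrak z=(z_f)\in\mathbb C^F .$$ Let $L=\mathbb Z^F$ with the bilinear form $(x,y)=\sum_{r\in R^+}\big(\sum_f\gamma_{r,f}x_f\big)\big(\sum_f\gamma_{r,f}y_f\big)$, extended bilinearly to $\mathbb Q^F$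 and $\mathbb C^F$. Let $L_{\mathrm{ev}}=\{x\in L:(x,x)\in 2\mathbb Z\}$ be its maximal even sublattice, $L_{\mathrm{ev}}^\vee\subset\mathbb Q^F$ the dual lattice of $L_{\mathrm{ev}}$, and $D=D(L_{\mathrm{ev}})=L_{\mathrm{ev}}^\vee/L_{\mathrm{ev}}$ the discriminant form, with $q(\gamma)=(\gamma,\gamma)/2\bmod\mathbb Z$, associated bilinear form $b(\gamma,\beta)=q(\gamma+\beta)-q(\gamma)-q(\beta)$ and signature defined by $\sum_{\gamma\in D}e(q(\gamma))=\sqrt{|D|}\,e(\operatorname{sign}(D)/8)$. Let $O(D)$ be the group of automorphisms of the group $D$ preserving $q$; it acts on $\mathbb C[D]=\bigoplus_{\gamma\in D}\mathbb C\mathbf e_\gamma$ by $\sigma(\mathbf e_\gamma)=\mathbf e_{\sigma(\gamma)}$. Then there is a (unique) representation $\rho_D$ of $\mathrm{SL}_2(\mathbb Z)$ on $\mathbb C[D]$, the Weil representation, with $$\rho_D(T)\mathbf e_\gamma=e(-q(\gamma))\mathbf e_\gamma,\qquad \rho_D(S)\mathbf e_\gamma=\frac{e(\operatorname{sign}(D)/8)}{\sqrt{|D|}}\sum_{\beta\in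 D}e(b(\gamma,\beta))\mathbf e_\beta ,$$ where $T=\begin{pmatrix}1&1\\0&1\end{pmatrix}$ and $S=\begin{pmatrix}0&-1\\1&0\end{pmatrix}$. There is a unique function $\theta_R=\sum_{\gamma\in D}(\theta_R)_\gamma\mathbf e_\gamma:\mathbb H\to\mathbb C[D]$ corresponding to $\vartheta_R$, that is, with $$\vartheta_R(\tau,\mathfrak z)=\sum_{\gamma\in D}(\theta_R)_\gamma(\tau)\sum_{\ell\in\gamma+L_{\mathrm{ev}}}q^{(\ell,\ell)/2}e\big((\ell,\mathfrak z)\big)\qquad(\tau\in\mathbb H,\ \mathfrak z\in\mathbb C^F),$$ and $\theta_R$ is a holomorphic modular form of weight $0$ for $\rho_D$: it is holomorphic, $\theta_R(A\tau)=\rho_D(A)\theta_R(\tau)$ for all $A\in\mathrm{SL}_2(\mathbb Z)$, and each component $(\theta_R)_\gamma$ has a Fourier expansion $\sum_m c_\gamma(m)e^{2\pi i m\tau}$ over exponents $m\in\mathbb Z-q(\gamma)$ with $m\ge 0$. The function $\theta_R$ is invariant under $O(D)$ up to a character of order $2$: there is a homomorphism $\chi:O(D)\to\mathbb C^*$ of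 order $2$ such that $\sigma(\theta_R)=\chi(\sigma)\,\theta_R$ for all $\sigma\in O(D)$. -/

import Mathlib

noncomputable section

namespace RootTheta

open UpperHalfPlane MatrixGroups Manifold

/-! ### Discriminant forms, the Weil representation and its modular forms -/

/-- `e(x) = exp(2πix)` for `x ∈ ℚ/ℤ`. -/
def e : AddCircle (1 : ℚ) → ℂ :=
  Function.Periodic.lift (f := fun x : ℚ => Complex.exp (2 * Real.pi * Complex.I * (x : ℂ)))
    (c := (1 : ℚ)) (by
      intro x
      have h := Complex.exp_periodic (2 * Real.pi * Complex.I * (x : ℂ))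
      push_cast
      rw [mul_add, mul_one]
      exact h)

section DiscriminantForm

variable {D : Type*} [AddCommGroup D]

/-- The eighth root of unity `e(sign(D)/8)`, where the signature of the (finite) discriminant form
`D` is defined by `∑_{γ ∈ D} e(q(γ)) = √|D| e(sign(D)/8)`. -/
def signPhase (q : D → AddCircle (1 : ℚ)) : ℂ :=
  (∑ᶠ γ : D, e (q γ)) / (Real.sqrt (Nat.card D) : ℂ)

/-- `ρ` is the Weil representation of `SL₂(ℤ)` on `ℂ[D]`; the basis vector `𝐞_γ` is
`Finsupp.single γ 1`, and `QuadraticMap.polar q` is the bilinear form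
`b(γ, β) = q(γ + β) - q(γ) - q(β)`. There is at most one such `ρ`, because `S` and `T` generate `SL₂(ℤ)`. -/
structure IsWeilRepresentation (q : D → AddCircle (1 : ℚ))
    (ρ : Representation ℂ SL(2, ℤ) (D →₀ ℂ)) : Prop where
  map_T : ∀ γ : D, ρ ModularGroup.T (Finsupp.single γ 1) = e (-q γ) • Finsupp.single γ 1
  map_S : ∀ γ β : D, ρ ModularGroup.S (Finsupp.single γ 1) β =
    signPhase q / (Real.sqrt (Nat.card D) : ℂ) * e (QuadraticMap.polar q γ β)

/-- `F` is a holomorphic modular form of weight `k` for the representation `ρ` on `ℂ[D]`: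
a holomorphic function with the transformation law of weight `k` whose components have Fourier
expansions `F_γ(τ) = ∑ c_γ(n) q^n` over the `n ∈ ℤ - q(γ)` with `n ≥ 0`. -/
structure IsHolomorphicModularForm (q : D → AddCircle (1 : ℚ))
    (ρ : Representation ℂ SL(2, ℤ) (D →₀ ℂ)) (k : ℤ) (F : ℍ → (D →₀ ℂ)) : Prop where
  holomorphic : ∀ γ : D, MDifferentiable 𝓘(ℂ) 𝓘(ℂ) (fun τ : ℍ => F τ γ)
  transform : ∀ (A : SL(2, ℤ)) (τ : ℍ),
    F (A • τ) = (((A 1 0 : ℤ) : ℂ) * (τ : ℂ) + ((A 1 1 : ℤ) : ℂ)) ^ k • ρ A (F τ)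
  fourier : ∃ c : D → ℚ → ℂ,
    (∀ γ n, c γ n ≠ 0 → 0 ≤ n ∧ (n : AddCircle (1 : ℚ)) = -q γ) ∧
    ∀ γ (τ : ℍ), HasSum
      (fun n : ℚ => c γ n * Complex.exp (2 * Real.pi * Complex.I * (n : ℂ) * (τ : ℂ))) (F τ γ)

/-- The orthogonal group `O(D)`: the automorphisms of the group `D` that preserve `q`. -/
def orthogonalGroup (q : D → AddCircle (1 : ℚ)) : Subgroup (Equiv.Perm D) where
  carrier := {σ | (∀ γ β, σ (γ + β) = σ γ + σ β) ∧ ∀ γ, q (σ γ) = q γ}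
  one_mem' := ⟨fun _ _ => rfl, fun _ => rfl⟩
  mul_mem' := by
    rintro σ σ' ⟨ha, hq⟩ ⟨ha', hq'⟩
    exact ⟨fun γ β => by simp [ha, ha'], fun γ => by simp [hq, hq']⟩
  inv_mem' := by
    rintro σ ⟨ha, hq⟩
    refine ⟨fun γ β => σ.injective ?_, fun γ => ?_⟩
    · simp [ha]
    · rw [← hq (σ⁻¹ γ)]
      simp

/-- The action of a permutation of `D` on `ℂ[D]`: `σ (∑ a_γ 𝐞_γ) = ∑ a_γ 𝐞_{σ(γ)}`. -/
def act (σ : Equiv.Perm D) (v : D →₀ ℂ) : D →₀ ℂ := v.mapDomain σ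

end DiscriminantForm

/-! ### The lattice and the Jacobi form attached to a matrix of root coefficients

`G` is an integral matrix; in the application `G r f` is the coefficient `γ_{r,f}` of the simple
root `f` in the positive root `r`. -/

section Lattice

variable {P F : Type*} [Fintype F] (G : Matrix P F ℤ)

/-- The linear form `x ↦ ∑_f γ_{r,f} x_f`. -/
def lin {K : Type*} [CommRing K] (r : P) (x : F → K) : K := ∑ f, (G r f : K) * x f

lemma lin_add {K : Type*} [CommRing K] (r : P) (x y : F → K) : lin G r (x + y) = lin G r x + lin G r y := by
  simp [lin, mul_add, Finset.sum_add_distrib]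

lemma lin_neg {K : Type*} [CommRing K] (r : P) (x : F → K) : lin G r (-x) = -lin G r x := by
  simp [lin]

variable [Fintype P]

/-- The bilinear form `(x, y) = ∑_r (∑_f γ_{r,f} x_f) (∑_f γ_{r,f} y_f)`, i.e. the one with
`Q(x) = (x, x) / 2`. -/
def form {K : Type*} [CommRing K] (x y : F → K) : K := ∑ r, lin G r x * lin G r y

section FormLemmas

variable {K : Type*} [CommRing K]

lemma form_add_left (x y z : F → K) : form G (x + y) z = form G x z + form G y z := by
  simp [form, lin_add, add_mul, Finset.sum_add_distrib]

lemma form_neg_left (x y : F → K) : form G (-x) y = -form G x y := by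
  simp [form, lin_neg]

lemma form_comm (x y : F → K) : form G x y = form G y x := by
  simp [form, mul_comm]

lemma form_add_self (x y : F → K) :
    form G (x + y) (x + y) = form G x x + 2 * form G x y + form G y y := by
  rw [form_add_left, form_comm G x, form_comm G y, form_add_left, form_add_left,
    form_comm G y x]
  ring

lemma form_intCast (x y : F → ℤ) :
    form G (fun f => (x f : ℚ)) (fun f => (y f : ℚ)) = ((form G x y : ℤ) : ℚ) := by
  simp [form, lin]

end FormLemmas

/-- The maximal even sublattice `L_ev = {x ∈ L : (x, x) ∈ 2ℤ}` of the integral lattice `L = ℤ^F`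
with the bilinear form `form G`, as a subgroup of `ℚ ⊗ L = ℚ^F`. -/
def evenLattice : AddSubgroup (F → ℚ) where
  carrier := {x | ∃ y : F → ℤ, x = (fun f => (y f : ℚ)) ∧ Even (form G y y)}
  zero_mem' := ⟨0, by ext; simp, by simp [form, lin]⟩
  add_mem' := by
    rintro _ _ ⟨x, rfl, hx⟩ ⟨y, rfl, hy⟩
    refine ⟨x + y, by ext; simp, ?_⟩
    rw [form_add_self]
    exact (hx.add (even_two_mul _)).add hy
  neg_mem' := by
    rintro _ ⟨x, rfl, hx⟩
    refine ⟨-x, by ext; simp, ?_⟩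
    rw [form_neg_left, form_comm, form_neg_left, neg_neg]
    exact hx

/-- The dual lattice `L_ev^∨ = {y ∈ ℚ ⊗ L : (y, x) ∈ ℤ for all x ∈ L_ev}`. -/
def dualLattice : AddSubgroup (F → ℚ) where
  carrier := {y | ∀ x ∈ evenLattice G, ∃ m : ℤ, form G y x = m}
  zero_mem' := fun x _ => ⟨0, by simp [form, lin]⟩
  add_mem' := by
    intro y y' h h' x hx
    obtain ⟨m, hm⟩ := h x hx
    obtain ⟨m', hm'⟩ := h' x hx
    exact ⟨m + m', by rw [form_add_left, hm, hm']; push_cast; rfl⟩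
  neg_mem' := by
    intro y h x hx
    obtain ⟨m, hm⟩ := h x hx
    exact ⟨-m, by rw [form_neg_left, hm]; push_cast; rfl⟩

/-- The discriminant group `D = D(L_ev) = L_ev^∨ / L_ev`. -/
abbrev Disc : Type _ := dualLattice G ⧸ (evenLattice G).addSubgroupOf (dualLattice G)

/-- The quadratic form `q(x + L_ev) = (x, x)/2 mod ℤ` on `D(L_ev)`. -/
def discForm : Disc G → AddCircle (1 : ℚ) := fun γ =>
  Quotient.liftOn' γ
    (fun x : dualLattice G => ((form G (x : F → ℚ) (x : F → ℚ) / 2 : ℚ) : AddCircle (1 : ℚ)))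
    (by
      intro x y hxy
      rw [QuotientAddGroup.leftRel_apply, AddSubgroup.mem_addSubgroupOf] at hxy
      obtain ⟨m, hm⟩ := x.2 _ hxy
      obtain ⟨z, hz, k, hk⟩ := hxy
      have hy : (y : F → ℚ) = (x : F → ℚ) + ((-x + y : dualLattice G) : F → ℚ) := by simp
      have hq : form G (y : F → ℚ) (y : F → ℚ) / 2
          = form G (x : F → ℚ) (x : F → ℚ) / 2 + ((m + k : ℤ) : ℚ) := by
        rw [hy, form_add_self, hm]
        rw [hz, form_intCast, hk]
        push_cast
        ring
      change ((form G (x : F → ℚ) (x : F → ℚ) / 2 : ℚ) : AddCircle (1 : ℚ)) =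
        ((form G (y : F → ℚ) (y : F → ℚ) / 2 : ℚ) : AddCircle (1 : ℚ))
      rw [hq, AddCircle.coe_add, left_eq_add, AddCircle.coe_eq_zero_iff]
      exact ⟨m + k, by simp⟩)

/-- The theta series `Θ_γ(τ, 𝔷) = ∑_{ℓ ∈ γ + L_ev} q^{(ℓ, ℓ)/2} ζ^ℓ` for `𝔷 ∈ ℂ ⊗ L_ev = ℂ^F`. -/
def thetaSeries (γ : Disc G) (τ : ℍ) (z : F → ℂ) : ℂ :=
  ∑' l : {l : dualLattice G // (l : Disc G) = γ},
    Complex.exp (2 * Real.pi * Complex.I *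
        ((form G (l : F → ℚ) (l : F → ℚ) / 2 : ℚ) : ℂ) * (τ : ℂ)) *
      Complex.exp (2 * Real.pi * Complex.I * form G (fun f => ((l : F → ℚ) f : ℂ)) z)

/-- The Jacobi theta function `ϑ(τ, z) = ∑_n (-4/n) q^{n²/8} e^{πinz}`; the Kronecker symbol
`(-4/n)` is the nontrivial character modulo `4`. -/
def jacobiTheta (τ : ℍ) (z : ℂ) : ℂ :=
  ∑' n : ℤ, ((ZMod.χ₄ (n : ZMod 4) : ℤ) : ℂ) *
    Complex.exp (2 * Real.pi * Complex.I * ((n : ℂ) ^ 2 / 8) * (τ : ℂ)) *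
    Complex.exp (Real.pi * Complex.I * (n : ℂ) * z)

/-- The function `η(τ)^{n - N} ∏_r ϑ(τ, ∑_f γ_{r,f} z_f)`, where `n = |F|` and `N` is the number
of rows of `G`. -/
def thetaBlock (τ : ℍ) (z : F → ℂ) : ℂ :=
  ModularForm.eta (τ : ℂ) ^ ((Fintype.card F : ℤ) - (Fintype.card P : ℤ)) *
    ∏ r, jacobiTheta τ (lin G r z)

/-- `θ` corresponds to the function `thetaBlock G`, i.e.
`thetaBlock G (τ, 𝔷) = ∑_{γ ∈ D} θ_γ(τ) Θ_γ(τ, 𝔷)`. -/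
def CorrespondsToThetaBlock (θ : ℍ → (Disc G →₀ ℂ)) : Prop :=
  ∀ (τ : ℍ) (z : F → ℂ), thetaBlock G τ z = (θ τ).sum fun γ a => a * thetaSeries G γ τ z

end Lattice

/-! ### Root systems -/

section RootSystem

variable {ι V W : Type*} [AddCommGroup V] [Module ℝ V] [AddCommGroup W] [Module ℝ W]
  {R : RootPairing ι ℝ V W} (b : R.Base)

/-- (Indices of) the positive roots with respect to a base. -/
abbrev PosRoot : Type _ := {i : ι // b.IsPos i}

instance [Finite ι] : Fintype (PosRoot b) := Fintype.ofFinite _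

/-- The matrix of the non-negative integers `γ_{r,f}` with `r = ∑_f γ_{r,f} f`, where `r` runs
through the positive and `f` through the simple roots. -/
def posRootCoeff : Matrix (PosRoot b) b.support ℤ := fun r f =>
  b.toWeightBasisInt.repr (R.rootSpanMem ℤ r) f

/-- The Cartan matrix of `R` is `C`, up to a numbering of the simple roots. -/
def HasCartanMatrix [R.IsCrystallographic] {m : Type} (C : Matrix m m ℤ) : Prop :=
  ∃ s : m ≃ b.support, ∀ i j, b.cartanMatrix (s i) (s j) = C i j

/-- The Cartan matrix of a direct sum of two root systems. -/
def cartanSum {m m' : Type} (C : Matrix m m ℤ) (C' : Matrix m' m' ℤ) :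
    Matrix (m ⊕ m') (m ⊕ m') ℤ :=
  Matrix.fromBlocks C 0 0 C'

/-- The Cartan matrix of a direct sum of `k` copies of a root system. -/
def cartanCopies (k : ℕ) {m : Type} (C : Matrix m m ℤ) : Matrix (m × Fin k) (m × Fin k) ℤ :=
  Matrix.blockDiagonal fun _ => C

open CartanMatrix in
/-- `R` is one of the root systems `A₄`, `A₁ ⊕ B₃`, `A₁ ⊕ C₃`, `B₂ ⊕ G₂`, `3A₂`, `3A₁ ⊕ A₃`,
`2A₁ ⊕ A₂ ⊕ B₂`, `8A₁`. -/
def IsOneOfTheEight [R.IsCrystallographic] : Prop :=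
  HasCartanMatrix b (A 4) ∨
  HasCartanMatrix b (cartanSum (A 1) (B 3)) ∨
  HasCartanMatrix b (cartanSum (A 1) (C 3)) ∨
  HasCartanMatrix b (cartanSum (B 2) G₂) ∨
  HasCartanMatrix b (cartanCopies 3 (A 2)) ∨
  HasCartanMatrix b (cartanSum (cartanCopies 3 (A 1)) (A 3)) ∨
  HasCartanMatrix b (cartanSum (cartanCopies 2 (A 1)) (cartanSum (A 2) (B 2))) ∨
  HasCartanMatrix b (cartanCopies 8 (A 1))

end RootSystem

end RootTheta

end

/-! Multiplying out the theta functions in the block gives a sum over `k ∈ ℤ^P`. The point `(k_r +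
1/2)` of `ℚ^P` splits orthogonally into its projection `l` to `ℚ ⊗ L`, which lies in `L_ev^∨` and
produces a term of a theta series, and a remainder whose norm produces a power of `q`. Collecting
terms by `l` gives the components of `θ_R`. They depend only on `l` modulo `L_ev`
(`blockCoeff_add`). They change sign under reflections in roots, because `ϑ` is odd and a reflection
makes an odd number of positive roots negative (`blockCoeff_symmetry`). They vanish unless `l` pairs
with `L` like the Weyl vector modulo integers (`blockCoeff_eq_zero`).

For each of the eight types a finite computation shows that the functions on `D` with the last two
properties are multiples of one function `f`, which takes the values `±1` on its support and is
supported on isotropic elements (`IsSignFunction`). Hence `θ_R = c(τ) f`, where `c` is the component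
at the Weyl vector (`thetaVec_eq`).

The theta series of the cosets are linearly independent, and Poisson summation shows that their span
is stable under `S` and `T`; this realizes the Weil representation (`exists_weilRepresentation`).
Since `n + 2N = 24`, the block transforms like these theta series, in the same weight `n/2`, so
`θ_R` has weight `0` for `ρ_D`. Therefore `c` is invariant under `T` and is multiplied by a scalar
`κ` under `S`. If `c` is not identically zero, the relations `S² = -1` and `(ST)³ = -1` give `κ² =
κ³ = 1`, so `κ = 1`. As the Weyl vector has norm at most `2`, `c` is bounded at the cusp, hence
constant.

It remains to let `O(D)` act on `f`. The support of `f` is characterized by `q` and the group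
structure alone, certain values of the bilinear form force opposite signs, and these relations
connect the support. So an automorphism can only multiply `f` by `±1`, and a reflection gives `-1`
(`signFunction_invariant`, `exists_signFunction_reversed`). -/

noncomputable section

namespace RootTheta

open UpperHalfPlane MatrixGroups Manifold

/-! ### The lattice `L_ev`, its dual and the finiteness of the discriminant group. -/

section LatticeBasics

variable {P F : Type*} [Fintype F] (G : Matrix P F ℤ)

lemma lin_smul {K : Type*} [CommRing K] (r : P) (c : K) (x : F → K) :
    lin G r (c • x) = c * lin G r x := by
  simp [lin, Finset.mul_sum, mul_left_comm]

lemma lin_zero {K : Type*} [CommRing K] (r : P) : lin G r (0 : F → K) = 0 := by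
  simp [lin]

lemma lin_sub {K : Type*} [CommRing K] (r : P) (x y : F → K) :
    lin G r (x - y) = lin G r x - lin G r y := by
  simp [sub_eq_add_neg, lin_add, lin_neg]

lemma lin_map {K K' : Type*} [CommRing K] [CommRing K'] (φ : K →+* K') (r : P) (x : F → K) :
    lin G r (fun f => φ (x f)) = φ (lin G r x) := by
  simp [lin]

lemma lin_intCast {K : Type*} [CommRing K] (r : P) (x : F → ℤ) :
    lin G r (fun f => (x f : K)) = ((lin G r x : ℤ) : K) :=
  lin_map G (Int.castRingHom K) r x

lemma lin_ratCast {K : Type*} [Field K] [CharZero K] (r : P) (x : F → ℚ) :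
    lin G r (fun f => (x f : K)) = ((lin G r x : ℚ) : K) :=
  lin_map G (Rat.castHom K) r x

lemma lin_ofReal (r : P) (x : F → ℝ) :
    lin G r (fun f => (x f : ℂ)) = ((lin G r x : ℝ) : ℂ) :=
  lin_map G Complex.ofRealHom r x

variable [Fintype P]

lemma form_map {K K' : Type*} [CommRing K] [CommRing K'] (φ : K →+* K') (x y : F → K) :
    form G (fun f => φ (x f)) (fun f => φ (y f)) = φ (form G x y) := by
  simp [form, lin_map]

lemma form_ratCast {K : Type*} [Field K] [CharZero K] (x y : F → ℚ) :
    form G (fun f => (x f : K)) (fun f => (y f : K)) = ((form G x y : ℚ) : K) :=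
  form_map G (Rat.castHom K) x y

lemma form_ofReal (x y : F → ℝ) :
    form G (fun f => (x f : ℂ)) (fun f => (y f : ℂ)) = ((form G x y : ℝ) : ℂ) :=
  form_map G Complex.ofRealHom x y

section

variable {K : Type*} [CommRing K]

lemma form_add_right (x y z : F → K) : form G x (y + z) = form G x y + form G x z := by
  rw [form_comm, form_add_left, form_comm G y, form_comm G z]

lemma form_neg_right (x y : F → K) : form G x (-y) = -form G x y := by
  rw [form_comm, form_neg_left, form_comm]

lemma form_sub_left (x y z : F → K) : form G (x - y) z = form G x z - form G y z := by
  rw [sub_eq_add_neg, form_add_left, form_neg_left, sub_eq_add_neg]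

lemma form_smul_left (c : K) (x y : F → K) : form G (c • x) y = c * form G x y := by
  simp [form, lin_smul, Finset.mul_sum, mul_assoc]

lemma form_smul_right (c : K) (x y : F → K) : form G x (c • y) = c * form G x y := by
  rw [form_comm, form_smul_left, form_comm]

lemma form_zero_left (y : F → K) : form G 0 y = 0 := by
  simp [form, lin]

lemma form_zero_right (y : F → K) : form G y 0 = 0 := by
  simp [form, lin]

/-- `form G` as a bilinear form. -/
def formBilin (K : Type*) [CommRing K] : LinearMap.BilinForm K (F → K) :=
  LinearMap.mk₂ K (form G) (form_add_left G) (form_smul_left G) (form_add_right G)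
    (form_smul_right G)

@[simp] lemma formBilin_apply (x y : F → K) : formBilin G K x y = form G x y := rfl

lemma form_sum_left {ι : Type*} (s : Finset ι) (x : ι → F → K) (y : F → K) :
    form G (∑ i ∈ s, x i) y = ∑ i ∈ s, form G (x i) y := by
  exact LinearMap.map_sum₂ (formBilin G K) s x y

lemma form_sum_right {ι : Type*} (s : Finset ι) (x : ι → F → K) (y : F → K) :
    form G y (∑ i ∈ s, x i) = ∑ i ∈ s, form G y (x i) := by
  rw [form_comm, form_sum_left]
  simp_rw [form_comm G y]

end

/-- Every unit vector is a row of `G`: this holds if the rows contain the simple roots. -/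
def HasUnitRows [DecidableEq F] : Prop := ∀ f : F, ∃ r : P, G r = Pi.single f 1

section Positivity

variable {G} [DecidableEq F]

omit [Fintype P] in
lemma lin_of_eq_single {K : Type*} [CommRing K] {r : P} {f : F} (h : G r = Pi.single f 1)
    (x : F → K) : lin G r x = x f := by
  simp [lin, h, Pi.single_apply]

/-- The rows that are unit vectors already contribute the left side. This bound gives positive
definiteness and all later convergence. -/
lemma HasUnitRows.sum_sq_le (hG : HasUnitRows G) {K : Type*} [Field K] [LinearOrder K]
    [IsStrictOrderedRing K] (x : F → K) :
    ∑ f, x f ^ 2 ≤ form G x x := by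
  choose r hr using hG
  have hinj : Function.Injective r := by
    intro f f' h
    have h' := (hr f).symm.trans (h ▸ hr f')
    by_contra hne
    simpa [hne] using congrFun h' f
  classical
  calc ∑ f, x f ^ 2 = ∑ f, lin G (r f) x * lin G (r f) x := by
        simp_rw [lin_of_eq_single (hr _), sq]
    _ = ∑ s ∈ Finset.univ.map ⟨r, hinj⟩, lin G s x * lin G s x := by simp
    _ ≤ _ := Finset.sum_le_sum_of_subset_of_nonneg (Finset.subset_univ _)
        (fun _ _ _ => mul_self_nonneg _)

lemma HasUnitRows.eq_zero_of_form (hG : HasUnitRows G) {K : Type*} [Field K] [LinearOrder K]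
    [IsStrictOrderedRing K] {x : F → K} (h : form G x x = 0) : x = 0 := by
  have h1 := hG.sum_sq_le x
  rw [h] at h1
  have h2 := (Finset.sum_eq_zero_iff_of_nonneg (fun f _ => sq_nonneg (x f))).mp
    (le_antisymm h1 (Finset.sum_nonneg fun f _ => sq_nonneg (x f)))
  ext f
  simpa using h2 f (Finset.mem_univ f)

lemma HasUnitRows.nondegenerate (hG : HasUnitRows G) : (formBilin G ℚ).Nondegenerate := by
  refine ⟨fun x hx => hG.eq_zero_of_form (hx x), fun x hx => hG.eq_zero_of_form (hx x)⟩

end Positivity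

/-- `L_ev` as a submodule of `ℤ^F`. -/
def evenSubmodule : Submodule ℤ (F → ℤ) where
  carrier := {x | Even (form G x x)}
  zero_mem' := by simp [form_zero_left]
  add_mem' := by
    intro x y hx hy
    simp only [Set.mem_ofPred_eq] at *
    rw [form_add_self]
    exact (hx.add (even_two_mul _)).add hy
  smul_mem' := by
    intro c x hx
    simp only [Set.mem_ofPred_eq] at *
    rw [form_smul_left, form_smul_right]
    exact (hx.mul_left _).mul_left _

lemma mem_evenSubmodule {x : F → ℤ} : x ∈ evenSubmodule G ↔ Even (form G x x) := Iff.rfl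

/-- Since `2L ⊆ L_ev`, the quotient is torsion. -/
lemma finrank_evenSubmodule : Module.finrank ℤ (evenSubmodule G) = Fintype.card F := by
  have h := (evenSubmodule G).finrank_quotient_add_finrank
  rw [Module.finrank_fintype_fun_eq_card] at h
  have h0 : Module.finrank ℤ ((F → ℤ) ⧸ evenSubmodule G) = 0 := by
    rw [Module.finrank_eq_zero_iff_isTorsion]
    intro (x : (F → ℤ) ⧸ evenSubmodule G)
    induction x using Submodule.Quotient.induction_on with
    | _ x =>
      refine ⟨⟨2, by simp⟩, ?_⟩
      change (2 : ℤ) • (Submodule.Quotient.mk x : (F → ℤ) ⧸ evenSubmodule G) = 0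
      rw [← Submodule.Quotient.mk_smul, Submodule.Quotient.mk_eq_zero, mem_evenSubmodule,
        form_smul_left]
      exact even_two_mul _
  lia

/-- A basis `h` of `L_ev` and the dual basis `g` of `L_ev^∨`. -/
structure DualBases where
  /-- the basis of `L_ev` -/
  h : F → F → ℤ
  /-- the basis of `L_ev^∨` -/
  g : F → F → ℚ
  even : ∀ i, Even (form G (h i) (h i))
  dual_self : ∀ i, form G (g i) (fun f => (h i f : ℚ)) = 1
  dual_ne : ∀ i j, i ≠ j → form G (g i) (fun f => (h j f : ℚ)) = 0
  span : ∀ x : F → ℤ, Even (form G x x) → ∃ c : F → ℤ, x = ∑ i, c i • h i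
  expand : ∀ y : F → ℚ, y = ∑ i, form G y (fun f => (h i f : ℚ)) • g i

/-- A ℤ-basis of `L_ev` stays independent over `ℚ`, and positive definiteness provides its dual
basis. These bases identify both lattices with `ℤ^F`. -/
lemma HasUnitRows.exists_dualBases [DecidableEq F] (hG : HasUnitRows G) :
    Nonempty (DualBases G) := by
  classical
  obtain ⟨n, ⟨b⟩⟩ := Submodule.nonempty_basis_of_pid (Pi.basisFun ℤ F) (evenSubmodule G)
  have hn : Fintype.card (Fin n) = Fintype.card F := by
    rw [← finrank_evenSubmodule G, Module.finrank_eq_card_basis b]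
  let b' : Module.Basis F ℤ (evenSubmodule G) := b.reindex (Fintype.equivOfCardEq hn)
  let c : (F → ℤ) →ₗ[ℤ] (F → ℚ) := (Int.castAddHom ℚ).toIntLinearMap.compLeft F
  have hc : Function.Injective (c ∘ₗ (evenSubmodule G).subtype) := by
    intro x y hxy
    ext f
    have := congrFun hxy f
    simpa [c] using this
  have hli : LinearIndependent ℤ (fun i => (c ∘ₗ (evenSubmodule G).subtype) (b' i)) :=
    b'.linearIndependent.map' _ (LinearMap.ker_eq_bot.mpr hc)
  have hliQ : LinearIndependent ℚ (fun i => (c ∘ₗ (evenSubmodule G).subtype) (b' i)) :=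
    (LinearIndependent.iff_fractionRing ℤ ℚ).mp hli
  let hb : Module.Basis F ℚ (F → ℚ) := basisOfLinearIndependentOfCardEqFinrank' _ hliQ (by simp)
  have hb_apply (i : F) : hb i = fun f => ((b' i : F → ℤ) f : ℚ) := by
    simp only [hb, coe_basisOfLinearIndependentOfCardEqFinrank']
    rfl
  let g := (formBilin G ℚ).dualBasis hG.nondegenerate hb
  have hd (i j) : form G (g i) (fun f => ((b' j : F → ℤ) f : ℚ)) = if i = j then 1 else 0 := by
    have := LinearMap.BilinForm.apply_dualBasis_left hG.nondegenerate hb i j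
    rw [formBilin_apply, hb_apply] at this
    rw [this]
    simp [eq_comm]
  refine ⟨⟨fun i => b' i, g, fun i => (b' i).2, fun i => by simp [hd],
    fun i j hij => by simp [hd, hij], ?_, ?_⟩⟩
  · intro x hx
    refine ⟨fun i => b'.repr ⟨x, hx⟩ i, ?_⟩
    have := congrArg (evenSubmodule G).subtype (b'.sum_repr ⟨x, hx⟩)
    rw [map_sum] at this
    exact this.symm
  · intro y
    have h1 := g.sum_repr y
    have h2 (i : F) : form G y (fun f => ((b' i : F → ℤ) f : ℚ)) = g.repr y i := by
      conv_lhs => rw [← h1]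
      rw [form_sum_left]
      simp [form_smul_left, hd]
    simp_rw [h2]
    exact h1.symm

variable {G}

namespace DualBases

variable (b : DualBases G)

lemma dual [DecidableEq F] (i j : F) :
    form G (b.g i) (fun f => (b.h j f : ℚ)) = if i = j then 1 else 0 := by
  split_ifs with h
  · rw [← h, b.dual_self]
  · exact b.dual_ne i j h

lemma cast_sum_h (c : F → ℤ) : (fun f => (((∑ i, c i • b.h i) f : ℤ) : ℚ)) =
    ∑ i, (c i : ℚ) • (fun f => (b.h i f : ℚ)) := by
  ext f
  simp

lemma form_g_sum (i : F) (c : F → ℤ) :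
    form G (b.g i) (∑ j, (c j : ℚ) • (fun f => (b.h j f : ℚ))) = c i := by
  classical
  simp [form_sum_right, form_smul_right, b.dual]

lemma form_sum_h (i : F) (c : F → ℤ) :
    form G (∑ j, (c j : ℚ) • b.g j) (fun f => (b.h i f : ℚ)) = c i := by
  classical
  simp [form_sum_left, form_smul_left, b.dual]

lemma g_mem (i : F) : b.g i ∈ dualLattice G := by
  rintro _ ⟨x, rfl, hx⟩
  obtain ⟨c, rfl⟩ := b.span x hx
  refine ⟨c i, ?_⟩
  rw [b.cast_sum_h, b.form_g_sum]

lemma h_mem (i : F) : (fun f => (b.h i f : ℚ)) ∈ evenLattice G := ⟨_, rfl, b.even i⟩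

/-- The lattice `L_ev^∨` is `ℤ^F`. -/
def dualEquiv : dualLattice G ≃ (F → ℤ) where
  toFun y i := ⌊form G (y : F → ℚ) (fun f => (b.h i f : ℚ))⌋
  invFun m := ⟨∑ i, m i • b.g i, sum_mem fun i _ => zsmul_mem (b.g_mem i) _⟩
  left_inv y := by
    ext1
    have key (i : F) : ((⌊form G (y : F → ℚ) (fun f => (b.h i f : ℚ))⌋ : ℤ) : ℚ) =
        form G (y : F → ℚ) (fun f => (b.h i f : ℚ)) := by
      obtain ⟨m, hm⟩ := y.2 _ (b.h_mem i)
      simp [hm]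
    conv_rhs => rw [b.expand (y : F → ℚ)]
    refine Finset.sum_congr rfl fun i _ => ?_
    rw [← key, Int.cast_smul_eq_zsmul]
  right_inv m := by
    ext i
    simp_rw [← Int.cast_smul_eq_zsmul ℚ, b.form_sum_h, Int.floor_intCast]

lemma dualEquiv_apply (y : dualLattice G) (i : F) :
    ((b.dualEquiv y i : ℤ) : ℚ) = form G (y : F → ℚ) (fun f => (b.h i f : ℚ)) := by
  obtain ⟨m, hm⟩ := y.2 _ (b.h_mem i)
  simp [dualEquiv, hm]

/-- The lattice `L_ev` is `ℤ^F`. -/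
def evenEquiv : evenLattice G ≃ (F → ℤ) where
  toFun y i := ⌊form G (b.g i) (y : F → ℚ)⌋
  invFun m := ⟨∑ i, m i • (fun f => (b.h i f : ℚ)), sum_mem fun i _ => zsmul_mem (b.h_mem i) _⟩
  left_inv y := by
    obtain ⟨y, x, rfl, hx⟩ := y
    obtain ⟨c, rfl⟩ := b.span x hx
    ext1
    change (∑ i, ⌊form G (b.g i) (fun f => (((∑ j, c j • b.h j) f : ℤ) : ℚ))⌋ •
      (fun f => (b.h i f : ℚ))) = fun f => (((∑ j, c j • b.h j) f : ℤ) : ℚ)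
    simp_rw [b.cast_sum_h, b.form_g_sum, Int.floor_intCast, Int.cast_smul_eq_zsmul]
  right_inv m := by
    ext i
    simp_rw [← Int.cast_smul_eq_zsmul ℚ, b.form_g_sum, Int.floor_intCast]

lemma evenEquiv_symm_apply (m : F → ℤ) :
    ((b.evenEquiv.symm m : evenLattice G) : F → ℚ) = ∑ i, m i • (fun f => (b.h i f : ℚ)) := rfl

lemma dualEquiv_symm_apply (m : F → ℤ) :
    ((b.dualEquiv.symm m : dualLattice G) : F → ℚ) = ∑ i, m i • b.g i := rfl

end DualBases

lemma evenLattice_le_dualLattice : evenLattice G ≤ dualLattice G := by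
  rintro _ ⟨x, rfl, -⟩ _ ⟨y, rfl, -⟩
  exact ⟨form G x y, form_intCast G x y⟩

/-- A common denominator of the elements of `L_ev^∨`. -/
lemma exists_denominator (b : DualBases G) : ∃ M : ℕ, 0 < M ∧
    ∀ y ∈ dualLattice G, ∃ k : F → ℤ, ∀ f, y f = k f / M := by
  refine ⟨∏ i : F, ∏ f : F, (b.g i f).den,
    Finset.prod_pos fun i _ => Finset.prod_pos fun f _ => (b.g i f).pos, fun y hy => ?_⟩
  set M := ∏ i : F, ∏ f : F, (b.g i f).den with hM
  have hM0 : (M : ℚ) ≠ 0 := by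
    simp [hM, Finset.prod_eq_zero_iff]
  have h1 (i f : F) : ∃ k : ℤ, b.g i f = k / M := by
    have hdvd : (b.g i f).den ∣ M :=
      (Finset.dvd_prod_of_mem (fun f => (b.g i f).den) (Finset.mem_univ f)).trans
        (Finset.dvd_prod_of_mem (fun i => ∏ f : F, (b.g i f).den) (Finset.mem_univ i))
    obtain ⟨c, hc⟩ := hdvd
    refine ⟨(b.g i f).num * c, ?_⟩
    have hc0 : (c : ℚ) ≠ 0 := by
      rintro h
      rw [hc] at hM0
      simp [h] at hM0
    rw [hc]
    push_cast
    rw [mul_div_mul_right _ _ hc0, Rat.num_div_den]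
  choose k hk using h1
  have h2 := b.dualEquiv.symm_apply_apply ⟨y, hy⟩
  refine ⟨fun f => ∑ i, b.dualEquiv ⟨y, hy⟩ i * k i f, fun f => ?_⟩
  have h3 := congrFun (congrArg Subtype.val h2) f
  rw [b.dualEquiv_symm_apply] at h3
  refine h3.symm.trans ?_
  rw [Finset.sum_apply, Int.cast_sum, Finset.sum_div]
  refine Finset.sum_congr rfl fun i _ => ?_
  rw [Pi.smul_apply, hk, zsmul_eq_mul, Int.cast_mul, mul_div_assoc]

/-- The group is finitely generated, and `2M` kills it for a common denominator `M`, because `M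
L_ev^∨ ⊆ L` and `2L ⊆ L_ev`. -/
lemma finite_disc (b : DualBases G) : Finite (Disc G) := by
  have : AddGroup.FG (dualLattice G) := by
    have e : dualLattice G ≃+ (F → ℤ) :=
      { b.dualEquiv with
        map_add' := fun x y => by
          ext i
          have : ((b.dualEquiv (x + y) i : ℤ) : ℚ) =
              ((b.dualEquiv x i + b.dualEquiv y i : ℤ) : ℚ) := by
            push_cast
            simp only [b.dualEquiv_apply]
            simp [form_add_left]
          exact_mod_cast this }
    exact AddGroup.fg_of_surjective (f := e.symm.toAddMonoidHom) e.symm.surjective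
  have : AddGroup.FG (Disc G) := QuotientAddGroup.fg _
  refine AddCommGroup.finite_of_fg_isAddTorsion _ fun γ => ?_
  obtain ⟨M, hM, hy⟩ := exists_denominator b
  induction γ using QuotientAddGroup.induction_on with
  | H y =>
    obtain ⟨k, hk⟩ := hy y y.2
    rw [isOfFinAddOrder_iff_nsmul_eq_zero]
    refine ⟨2 * M, by positivity, ?_⟩
    rw [← QuotientAddGroup.mk_nsmul, QuotientAddGroup.eq_zero_iff, AddSubgroup.mem_addSubgroupOf]
    refine ⟨fun f => 2 * k f, ?_, ?_⟩
    · ext f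
      have : (M : ℚ) ≠ 0 := by positivity
      simp [hk]
      field_simp
    · have : (fun f => 2 * k f) = (2 : ℤ) • k := by ext; simp
      rw [this, form_smul_left]
      exact even_two_mul _

end LatticeBasics

end RootTheta

end

noncomputable section

namespace RootTheta

open UpperHalfPlane MatrixGroups Manifold

/-! ### Absolute convergence of products of series and of Gaussian lattice sums. -/

section Summability

lemma summable_norm_prod_and_hasSum_aux {ι : Type*} [Finite ι] {κ : Type*} (_ : Fintype ι)
    (f : ι → κ → ℂ) (hf : ∀ i, Summable fun k => ‖f i k‖) :
    (Summable fun n : ι → κ => ‖∏ i, f i (n i)‖) ∧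
      HasSum (fun n : ι → κ => ∏ i, f i (n i)) (∏ i, ∑' k, f i k) := by
  induction ι using Finite.induction_empty_option with
  | @of_equiv α β e ih =>
    let := Fintype.ofEquiv β e.symm
    obtain ⟨h1, h2⟩ := ih inferInstance (fun a => f (e a)) (fun a => hf (e a))
    have key (n : β → κ) : ∏ i, f i (n i) = ∏ a, f (e a) (n (e a)) :=
      (Equiv.prod_comp e fun i => f i (n i)).symm
    constructor
    · simp_rw [key]
      exact ((Equiv.arrowCongr e.symm (Equiv.refl κ)).summable_iff
        (f := fun n : α → κ => ‖∏ a, f (e a) (n a)‖)).mpr h1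
    · simp_rw [key]
      rw [← Equiv.prod_comp e fun i => ∑' k, f i k]
      exact ((Equiv.arrowCongr e.symm (Equiv.refl κ)).hasSum_iff
        (f := fun n : α → κ => ∏ a, f (e a) (n a))).mpr h2
  | h_empty =>
    refine ⟨Summable.of_finite, ?_⟩
    simp
  | @h_option α _ ih =>
    obtain ⟨h1, h2⟩ := ih inferInstance (fun a => f (some a)) (fun a => hf (some a))
    have h0 := hf none
    have hn : Summable fun p : κ × (α → κ) => ‖f none p.1 * ∏ a, f (some a) (p.2 a)‖ := by
      simp_rw [norm_mul]
      exact h0.mul_of_nonneg h1 (fun _ => norm_nonneg _) (fun _ => norm_nonneg _)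
    have hs : HasSum (fun p : κ × (α → κ) => f none p.1 * ∏ a, f (some a) (p.2 a))
        ((∑' k, f none k) * ∏ a, ∑' k, f (some a) k) := by
      rw [← h2.tsum_eq, tsum_mul_tsum_of_summable_norm h0 h1]
      exact hn.of_norm.hasSum
    have key (g : Option α → ℂ) : ∏ i, g i = g none * ∏ a, g (some a) := by
      rw [← Fintype.prod_option]
      congr!
    constructor
    · simp_rw [key]
      exact ((Equiv.piOptionEquivProd (β := fun _ : Option α => κ)).summable_iff
        (f := fun p : κ × (α → κ) => ‖f none p.1 * ∏ a, f (some a) (p.2 a)‖)).mpr hn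
    · simp_rw [key]
      exact ((Equiv.piOptionEquivProd (β := fun _ : Option α => κ)).hasSum_iff
        (f := fun p : κ × (α → κ) => f none p.1 * ∏ a, f (some a) (p.2 a))).mpr hs

/-- A product of absolutely convergent series is an absolutely convergent series over functions. -/
lemma summable_norm_prod_and_hasSum {ι : Type*} [Fintype ι] {κ : Type*} (f : ι → κ → ℂ)
    (hf : ∀ i, Summable fun k => ‖f i k‖) :
    (Summable fun n : ι → κ => ‖∏ i, f i (n i)‖) ∧
      HasSum (fun n : ι → κ => ∏ i, f i (n i)) (∏ i, ∑' k, f i k) :=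
  summable_norm_prod_and_hasSum_aux _ f hf

lemma summable_exp_neg_sq {c M : ℝ} (hc : 0 < c) (hM : M ≠ 0) (x : ℝ) :
    Summable fun k : ℤ => Real.exp (-(c * (k / M + x) ^ 2)) := by
  -- With this `τ` and `z = icx/(Mπ)`, the norm of the `k`-th term of `jacobiTheta₂`, times
  -- `exp(-cx²)`, is the summand with its square completed.
  have hτ : 0 < (Complex.I * ((c / (M ^ 2 * Real.pi) : ℝ) : ℂ)).im := by
    simp only [Complex.mul_im, Complex.I_re, Complex.ofReal_im, Complex.I_im, Complex.ofReal_re]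
    have := Real.pi_pos
    have : 0 < M ^ 2 := by positivity
    simpa using by positivity
  have h := ((summable_jacobiTheta₂_term_iff
    (Complex.I * ((c * x / (M * Real.pi) : ℝ) : ℂ)) _).mpr hτ).norm.mul_left
    (Real.exp (-(c * x ^ 2)))
  refine h.congr fun k => ?_
  rw [norm_jacobiTheta₂_term, ← Real.exp_add]
  congr 1
  have := Real.pi_pos.ne'
  simp only [Complex.mul_im, Complex.I_re, Complex.ofReal_im, Complex.I_im, Complex.ofReal_re]
  field_simp
  ring

lemma summable_exp_neg_sum_sq {ι : Type*} [Fintype ι] {c M : ℝ} (hc : 0 < c) (hM : M ≠ 0)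
    (x : ι → ℝ) :
    Summable fun k : ι → ℤ => Real.exp (-(c * ∑ i, (k i / M + x i) ^ 2)) := by
  have h := (summable_norm_prod_and_hasSum (ι := ι)
    (fun i (k : ℤ) => ((Real.exp (-(c * (k / M + x i) ^ 2)) : ℝ) : ℂ)) fun i => by
      refine (summable_exp_neg_sq hc hM (x i)).congr fun k => ?_
      rw [Complex.norm_real, Real.norm_of_nonneg (Real.exp_pos _).le]).1
  refine h.congr fun k => ?_
  rw [← Complex.ofReal_prod, Complex.norm_real, ← Real.exp_sum, Real.norm_of_nonneg (Real.exp_pos _).le,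
    Finset.sum_neg_distrib, Finset.mul_sum]

variable {P F : Type*} [Fintype F] [Fintype P] {G : Matrix P F ℤ}

/-- The embedding `ℚ^F → ℝ^F`. -/
def toReal (x : F → ℚ) : F → ℝ := fun f => (x f : ℝ)

omit [Fintype F] in
@[simp] lemma toReal_apply (x : F → ℚ) (f : F) : toReal x f = (x f : ℝ) := rfl

omit [Fintype F] in
lemma toReal_add (x y : F → ℚ) : toReal (x + y) = toReal x + toReal y := by
  ext; simp

omit [Fintype F] in
lemma toReal_neg (x : F → ℚ) : toReal (-x) = -toReal x := by
  ext; simp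

lemma form_toReal (x y : F → ℚ) : form G (toReal x) (toReal y) = ((form G x y : ℚ) : ℝ) :=
  form_ratCast G x y

/-- The dual lattice lies in `M⁻¹ ℤ^F` and the form dominates the sum of squares of the coordinates.
-/
lemma summable_exp_neg_form [DecidableEq F] (hG : HasUnitRows G) {c : ℝ} (hc : 0 < c)
    (x : F → ℝ) :
    Summable fun l : dualLattice G =>
      Real.exp (-(c * form G (toReal (l : F → ℚ) + x) (toReal (l : F → ℚ) + x))) := by
  obtain ⟨b⟩ := hG.exists_dualBases
  obtain ⟨M, hM, hk⟩ := exists_denominator b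
  have hM' : (M : ℚ) ≠ 0 := by positivity
  choose k hk using fun l : dualLattice G => hk l l.2
  have hinj : Function.Injective k := by
    intro l l' h
    ext f
    rw [hk, hk, h]
  refine Summable.of_nonneg_of_le (fun _ => (Real.exp_pos _).le) (fun l => ?_)
    ((summable_exp_neg_sum_sq hc (M := M) (by positivity) x).comp_injective hinj)
  rw [Function.comp_apply, Real.exp_le_exp, neg_le_neg_iff]
  refine mul_le_mul_of_nonneg_left (le_trans (le_of_eq ?_)
    (hG.sum_sq_le (toReal (l : F → ℚ) + x))) hc.le
  refine Finset.sum_congr rfl fun f _ => ?_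
  simp [hk l f]

end Summability

end RootTheta

end

noncomputable section

namespace RootTheta

open UpperHalfPlane hiding I
open MatrixGroups Manifold

/-! ### Poisson summation on `ℝ^F`. -/

section Poisson

open MeasureTheory Complex

variable {F : Type*} [Fintype F]

/-- The embedding `ℤ^F → ℝ^F`. -/
def intToReal (k : F → ℤ) : F → ℝ := fun f => (k f : ℝ)

lemma mFourier_coe (n : F → ℤ) (t : F → ℝ) :
    UnitAddTorus.mFourier n (fun i => (t i : UnitAddCircle)) =
      cexp (2 * Real.pi * I * ∑ i, (n i : ℂ) * (t i : ℂ)) := by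
  simp only [UnitAddTorus.mFourier, ContinuousMap.coe_mk, fourier_coe_apply, Finset.mul_sum,
    Complex.exp_sum]
  refine Finset.prod_congr rfl fun i _ => ?_
  congr 1
  push_cast
  ring

/-- The half-open unit cube translated by an integral vector. -/
def unitCube (k : F → ℤ) : Set (F → ℝ) := {t | ∀ i, t i ∈ Set.Ioc (k i : ℝ) (k i + 1)}

omit [Fintype F] in
lemma mem_unitCube_iff {k : F → ℤ} {t : F → ℝ} : t ∈ unitCube k ↔ ∀ i, ⌈t i⌉ = k i + 1 := by
  refine forall_congr' fun i => ?_
  rw [Int.ceil_eq_iff]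
  push_cast
  simp

lemma measurableSet_unitCube (k : F → ℤ) : MeasurableSet (unitCube k) :=
  MeasurableSet.univ_pi' fun _ => measurableSet_Ioc

omit [Fintype F] in
lemma pairwise_disjoint_unitCube : Pairwise (Function.onFun Disjoint (unitCube (F := F))) := by
  intro k k' hk
  rw [Function.onFun, Set.disjoint_left]
  intro t ht ht'
  rw [mem_unitCube_iff] at ht ht'
  exact hk (funext fun i => by linarith [ht i, ht' i])

omit [Fintype F] in
lemma iUnion_unitCube : ⋃ k, unitCube (F := F) k = Set.univ := by
  refine Set.eq_univ_of_forall fun t => Set.mem_iUnion.mpr ⟨fun i => ⌈t i⌉ - 1, ?_⟩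
  rw [mem_unitCube_iff]
  simp

lemma setIntegral_unitCube {E : Type*} [NormedAddCommGroup E] [NormedSpace ℝ E]
    (g : (F → ℝ) → E) (k : F → ℤ) :
    ∫ t in unitCube k, g t = ∫ t in unitCube 0, g (t + intToReal k) := by
  have h := (measurePreserving_add_right (volume : Measure (F → ℝ)) (intToReal k)).setIntegral_preimage_emb
    (MeasurableEquiv.addRight (intToReal k)).measurableEmbedding g (unitCube k)
  rw [← h]
  congr 2
  ext t
  simp only [unitCube, Set.mem_preimage, Set.mem_ofPred_eq, Set.mem_Ioc, Pi.add_apply, intToReal]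
  refine forall_congr' fun i => ?_
  simp only [Pi.zero_apply, Int.cast_zero]
  constructor <;> rintro ⟨h1, h2⟩ <;> constructor <;> linarith

lemma hasSum_setIntegral_unitCube {E : Type*} [NormedAddCommGroup E] [NormedSpace ℝ E]
    {g : (F → ℝ) → E} (hg : Integrable g) :
    HasSum (fun k : F → ℤ => ∫ t in unitCube 0, g (t + intToReal k)) (∫ t, g t) := by
  have := hasSum_integral_iUnion (μ := volume) (f := g) (s := unitCube (F := F))
    measurableSet_unitCube pairwise_disjoint_unitCube hg.integrableOn
  rw [iUnion_unitCube, setIntegral_univ] at this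
  simpa only [setIntegral_unitCube g] using this

/-- **Poisson summation** in several variables. -/
theorem hasSum_poisson {g : (F → ℝ) → ℂ} (hc : Continuous g) (hi : Integrable g)
    (hsum : ∀ R : ℝ, ∃ u : (F → ℤ) → ℝ, Summable u ∧
      ∀ (k : F → ℤ) (t : F → ℝ), ‖t‖ ≤ R → ‖g (t + intToReal k)‖ ≤ u k)
    (hf : Summable fun m : F → ℤ =>
      ∫ t : F → ℝ, cexp (-(2 * Real.pi * I * ∑ i, (m i : ℂ) * (t i : ℂ))) * g t)
    (t : F → ℝ) :
    HasSum (fun m : F → ℤ =>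
      (∫ t : F → ℝ, cexp (-(2 * Real.pi * I * ∑ i, (m i : ℂ) * (t i : ℂ))) * g t) *
        cexp (2 * Real.pi * I * ∑ i, (m i : ℂ) * (t i : ℂ)))
      (∑' k : F → ℤ, g (t + intToReal k)) := by
  have hsummable (t : F → ℝ) : Summable fun k : F → ℤ => ‖g (t + intToReal k)‖ := by
    obtain ⟨u, hu, hu'⟩ := hsum ‖t‖
    exact Summable.of_nonneg_of_le (fun _ => norm_nonneg _) (fun k => hu' k t le_rfl) hu
  let G0 : (F → ℝ) → ℂ := fun t => ∑' k : F → ℤ, g (t + intToReal k)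
  have hG0c : Continuous G0 := by
    rw [continuous_iff_continuousAt]
    intro t
    obtain ⟨u, hu, hu'⟩ := hsum (‖t‖ + 1)
    have hon : ContinuousOn G0 (Metric.ball t 1) := by
      refine continuousOn_tsum (fun k => ?_) hu fun k s hs => hu' k s ?_
      · exact (hc.comp (continuous_id.add continuous_const)).continuousOn
      · have h1 : ‖s - t‖ < 1 := by simpa [dist_eq_norm] using hs
        calc ‖s‖ = ‖t + (s - t)‖ := by simp
          _ ≤ ‖t‖ + ‖s - t‖ := norm_add_le _ _
          _ ≤ _ := by linarith
    exact hon.continuousAt (Metric.ball_mem_nhds t one_pos)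
  have hper (t : F → ℝ) (k : F → ℤ) : G0 (t + intToReal k) = G0 t := by
    simp only [G0]
    rw [← (Equiv.addLeft k).tsum_eq (fun k => g (t + intToReal k))]
    refine tsum_congr fun k' => ?_
    congr 1
    ext i
    simp [intToReal, add_assoc]
  let π : (F → ℝ) → UnitAddTorus F := fun t i => (t i : UnitAddCircle)
  have hπ : IsOpenQuotientMap π :=
    IsOpenQuotientMap.piMap fun _ => QuotientAddGroup.isOpenQuotientMap_mk
  -- An arbitrary section suffices: the periodization does not see the choice, and continuity
  -- descends along the quotient map.
  let s : UnitAddTorus F → (F → ℝ) := Function.surjInv hπ.surjective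
  have hs (t : F → ℝ) : G0 (s (π t)) = G0 t := by
    have h1 : π (s (π t)) = π t := Function.surjInv_eq hπ.surjective (π t)
    have h2 (i : F) : ∃ n : ℤ, s (π t) i = t i + n := by
      have := congrFun h1 i
      simp only [π] at this
      rw [← sub_eq_zero, ← AddCircle.coe_sub, AddCircle.coe_eq_zero_iff] at this
      obtain ⟨n, hn⟩ := this
      exact ⟨n, by rw [zsmul_one] at hn; linarith⟩
    choose k hk using h2
    have h3 : s (π t) = t + intToReal k := by
      ext i
      simp [hk, intToReal]
    rw [h3, hper]
  let Φ : C(UnitAddTorus F, ℂ) := ⟨G0 ∘ s, by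
    rw [hπ.isQuotientMap.continuous_iff]
    refine hG0c.congr fun t => (hs t).symm⟩
  have hΦ (t : F → ℝ) : Φ (fun i => (t i : UnitAddCircle)) = G0 t := hs t
  -- Unfolding: the integral over the unit cube of the sum over integral translates is the integral
  -- over the whole space, since the character is periodic.
  have hcoeff (m : F → ℤ) : UnitAddTorus.mFourierCoeff Φ m =
      ∫ t : F → ℝ, cexp (-(2 * Real.pi * I * ∑ i, (m i : ℂ) * (t i : ℂ))) * g t := by
    let ψ : (F → ℝ) → ℂ := fun t => cexp (-(2 * Real.pi * I * ∑ i, (m i : ℂ) * (t i : ℂ)))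
    have hψn (t : F → ℝ) : ‖ψ t‖ = 1 := by
      have : ψ t = cexp (((-(2 * Real.pi * ∑ i, (m i : ℝ) * t i) : ℝ) : ℂ) * I) := by
        simp only [ψ]
        push_cast
        ring_nf
      rw [this, Complex.norm_exp_ofReal_mul_I]
    have hψp (t : F → ℝ) (k : F → ℤ) : ψ (t + intToReal k) = ψ t := by
      simp only [ψ, Pi.add_apply, intToReal]
      have : -(2 * Real.pi * I * ∑ i, (m i : ℂ) * ((t i + (k i : ℝ) : ℝ) : ℂ)) =
          -(2 * Real.pi * I * ∑ i, (m i : ℂ) * (t i : ℂ)) +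
          ((-∑ i, m i * k i : ℤ) : ℂ) * (2 * Real.pi * I) := by
        push_cast
        simp only [mul_add, Finset.sum_add_distrib]
        ring
      rw [this, Complex.exp_add, Complex.exp_int_mul_two_pi_mul_I, mul_one]
    have hψc : Continuous ψ := by fun_prop
    have hint : Integrable fun t => ψ t * g t := by
      refine hi.bdd_mul (c := 1) hψc.aestronglyMeasurable ?_
      exact Filter.Eventually.of_forall fun t => (hψn t).le
    have e1 : UnitAddTorus.mFourierCoeff Φ m = ∫ t in unitCube 0, ψ t * G0 t := by
      rw [UnitAddTorus.mFourierCoeff_eq_integral _ _ 0]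
      have : {x : F → ℝ | ∀ i, x i ∈ Set.Ioc ((0 : F → ℝ) i) ((0 : F → ℝ) i + 1)} =
          unitCube 0 := by
        ext; simp [unitCube]
      rw [this]
      congr 1
      ext t
      rw [hΦ, mFourier_coe, smul_eq_mul]
      simp only [ψ]
      congr 2
      simp
    rw [e1]
    have hint' (k : F → ℤ) : Integrable (fun t => ψ t * g (t + intToReal k)) := by
      refine (hi.comp_add_right (intToReal k)).bdd_mul (c := 1) hψc.aestronglyMeasurable ?_
      exact Filter.Eventually.of_forall fun t => (hψn t).le
    have h1 := hasSum_integral_of_summable_integral_norm (μ := volume.restrict (unitCube (F := F) 0))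
      (F := fun k t => ψ t * g (t + intToReal k)) (fun k => (hint' k).integrableOn) (by
        have := (hasSum_setIntegral_unitCube hi.norm).summable
        simpa [hψn] using this)
    have h2 := hasSum_setIntegral_unitCube hint
    simp only [hψp] at h2
    rw [← h1.unique h2]
    simp only [G0, tsum_mul_left]
  have h := UnitAddTorus.hasSum_mFourier_series_apply_of_summable (f := Φ)
    (by simpa only [funext hcoeff] using hf) (fun i => (t i : UnitAddCircle))
  simpa only [hcoeff, hΦ, mFourier_coe, smul_eq_mul] using h

end Poisson

end RootTheta

end

noncomputable section

namespace RootTheta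

open UpperHalfPlane hiding I
open MatrixGroups Manifold

/-! ### Poisson summation for Gaussians on `L_ev`. -/

section GaussianPoisson

open MeasureTheory Complex

variable {P F : Type*} [Fintype F] [Fintype P] {G : Matrix P F ℤ}

/-- The isometric embedding of `ℝ ⊗ L` into `ℝ^P`. -/
def rowMap (G : Matrix P F ℤ) : (F → ℝ) →ₗ[ℝ] EuclideanSpace ℝ P where
  toFun x := WithLp.toLp 2 fun r => lin G r x
  map_add' x y := by ext r; simp [lin_add]
  map_smul' c x := by ext r; simp [lin_smul]

lemma inner_rowMap (x y : F → ℝ) : inner ℝ (rowMap G x) (rowMap G y) = form G x y := by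
  simp [rowMap, form, PiLp.inner_apply, mul_comm]

variable [DecidableEq F]

lemma HasUnitRows.rowMap_injective (hG : HasUnitRows G) : Function.Injective (rowMap G) := by
  rw [injective_iff_map_eq_zero]
  intro x hx
  refine hG.eq_zero_of_form ?_
  rw [← inner_rowMap, hx, inner_zero_left]

/-- The isometry between `ℝ ⊗ L` and its image in `ℝ^P`. -/
def HasUnitRows.rowEquiv (hG : HasUnitRows G) : (F → ℝ) ≃ₗ[ℝ] LinearMap.range (rowMap G) :=
  LinearEquiv.ofInjective (rowMap G) hG.rowMap_injective

lemma HasUnitRows.inner_rowEquiv (hG : HasUnitRows G) (x y : F → ℝ) :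
    inner ℝ (hG.rowEquiv x) (hG.rowEquiv y) = form G x y := by
  rw [Submodule.coe_inner, HasUnitRows.rowEquiv, LinearEquiv.ofInjective_apply,
    LinearEquiv.ofInjective_apply, inner_rowMap]

lemma HasUnitRows.norm_rowEquiv_sq (hG : HasUnitRows G) (x : F → ℝ) :
    ‖hG.rowEquiv x‖ ^ 2 = form G x x := by
  rw [← hG.inner_rowEquiv, real_inner_self_eq_norm_sq]

namespace DualBases

variable (b : DualBases G)

/-- Coordinates with respect to the basis of `L_ev`. -/
def coordMap : (F → ℝ) →ₗ[ℝ] (F → ℝ) where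
  toFun t := ∑ i, t i • fun f => (b.h i f : ℝ)
  map_add' s t := by simp [add_smul, Finset.sum_add_distrib]
  map_smul' c t := by simp [mul_smul, Finset.smul_sum]

lemma form_g_coordMap (t : F → ℝ) (i : F) : form G (toReal (b.g i)) (b.coordMap t) = t i := by
  have (j : F) : form G (toReal (b.g i)) (fun f => (b.h j f : ℝ)) = if i = j then 1 else 0 := by
    have := form_toReal (G := G) (b.g i) (fun f => (b.h j f : ℚ))
    rw [b.dual] at this
    have e : toReal (fun f => (b.h j f : ℚ)) = fun f => (b.h j f : ℝ) := by ext; simp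
    rw [e] at this
    rw [this]
    split_ifs <;> simp
  simp [coordMap, form_sum_right, form_smul_right, this]

/-- Coordinates with respect to the basis of `L_ev`, as an isomorphism. -/
def coordEquiv : (F → ℝ) ≃ₗ[ℝ] (F → ℝ) :=
  LinearEquiv.ofInjectiveEndo b.coordMap (by
    intro s t h
    ext i
    rw [← b.form_g_coordMap s, h, b.form_g_coordMap])

lemma coordEquiv_apply (t : F → ℝ) : b.coordEquiv t = b.coordMap t := rfl

lemma coordEquiv_intToReal (k : F → ℤ) :
    b.coordEquiv (intToReal k) = toReal (b.evenEquiv.symm k : F → ℚ) := by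
  ext f
  simp [coordEquiv_apply, coordMap, b.evenEquiv_symm_apply, intToReal]

lemma form_coordEquiv_dual (t : F → ℝ) (m : F → ℤ) :
    form G (b.coordEquiv t) (toReal (b.dualEquiv.symm m : F → ℚ)) = ∑ i, m i * t i := by
  have : toReal (b.dualEquiv.symm m : F → ℚ) = ∑ i, (m i : ℝ) • toReal (b.g i) := by
    ext f
    simp [b.dualEquiv_symm_apply]
  rw [this, form_sum_right]
  refine Finset.sum_congr rfl fun i _ => ?_
  rw [form_smul_right, form_comm, coordEquiv_apply, b.form_g_coordMap]

end DualBases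

lemma re_pi_div_pos (τ : ℍ) : 0 < ((Real.pi : ℂ) / (-I * τ)).re := by
  have hτ := τ.im_pos
  have h1 : (-I * (τ : ℂ)).re = τ.im := by simp
  have h0 : -I * (τ : ℂ) ≠ 0 := by
    intro h
    rw [h] at h1
    simp at h1
    linarith
  rw [div_eq_mul_inv, Complex.re_ofReal_mul, Complex.inv_re, h1]
  have := Complex.normSq_pos.mpr h0
  have := Real.pi_pos
  positivity

/-- A theta function of the lattice `L_ev`, and its image under `S`. -/
theorem HasUnitRows.gaussian_poisson (hG : HasUnitRows G) : ∃ C : ℝ, 0 < C ∧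
    ∀ (τ : ℍ) (x v : F → ℝ),
      ∑' l : evenLattice G, cexp (-(Real.pi / (-I * τ)) *
          (form G (v + toReal (l : F → ℚ)) (v + toReal (l : F → ℚ)) : ℝ) +
          2 * Real.pi * I * (form G x (v + toReal (l : F → ℚ)) : ℝ)) =
      C * (-I * τ) ^ ((Fintype.card F : ℂ) / 2) * ∑' l : dualLattice G,
        cexp (Real.pi * I * τ * (form G (toReal (l : F → ℚ) - x) (toReal (l : F → ℚ) - x) : ℝ) +
          2 * Real.pi * I * (form G (toReal (l : F → ℚ)) v : ℝ)) := by
  obtain ⟨b⟩ := hG.exists_dualBases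
  let E := LinearMap.range (rowMap G)
  let A : (F → ℝ) ≃L[ℝ] E := (b.coordEquiv.trans hG.rowEquiv).toContinuousLinearEquiv
  have hA (t : F → ℝ) : A t = hG.rowEquiv (b.coordEquiv t) := rfl
  have hmeas : (Measure.map A (volume : Measure (F → ℝ))).IsAddHaarMeasure :=
    A.isAddHaarMeasure_map volume
  -- Haar measures are proportional. The constant, a covolume factor, is never computed; only its
  -- positivity matters.
  obtain ⟨c, hc0, hctop, hc⟩ : ∃ c : ENNReal, c ≠ 0 ∧ c ≠ ⊤ ∧
      Measure.map A (volume : Measure (F → ℝ)) = c • (volume : Measure E) := by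
    refine ⟨Measure.addHaarScalarFactor (Measure.map A (volume : Measure (F → ℝ))) volume, ?_,
      ENNReal.coe_ne_top, Measure.isAddLeftInvariant_eq_smul _ _⟩
    simpa only [ne_eq, ENNReal.coe_eq_zero] using
      (Measure.addHaarScalarFactor_pos_of_isAddHaarMeasure _ _).ne'
  have hfin : Module.finrank ℝ E = Fintype.card F := by
    rw [← LinearEquiv.finrank_eq hG.rowEquiv, Module.finrank_fintype_fun_eq_card]
  refine ⟨c.toReal, ENNReal.toReal_pos hc0 hctop, fun τ x v => ?_⟩
  set β : ℂ := Real.pi / (-I * τ) with hβ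
  have hβre : 0 < β.re := re_pi_div_pos τ
  have hτ0 : (τ : ℂ) ≠ 0 := τ.ne_zero
  have hpi : (Real.pi : ℂ) ≠ 0 := by exact_mod_cast Real.pi_ne_zero
  let X : E := hG.rowEquiv x
  let f : E → ℂ := fun w => cexp (-β * ‖w‖ ^ 2 + 2 * Real.pi * I * inner ℝ X w)
  let g : (F → ℝ) → ℂ := fun t => f (A t)
  have hfint : Integrable f := GaussianFourier.integrable_cexp_neg_mul_sq_norm_add hβre _ X
  have hchange (φ : E → ℂ) : ∫ t, φ (A t) = c.toReal * ∫ w, φ w := by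
    have h1 := A.toHomeomorph.measurableEmbedding.integral_map (μ := volume) φ
    have h2 : (Measure.map A.toHomeomorph (volume : Measure (F → ℝ))) = c • volume := hc
    rw [h2, integral_smul_measure] at h1
    rw [← Complex.real_smul]
    exact h1.symm
  have hgint : Integrable g := by
    have h2 : (Measure.map A.toHomeomorph (volume : Measure (F → ℝ))) = c • volume := hc
    have h1 := A.toHomeomorph.measurableEmbedding.integrable_map_iff (μ := volume) (g := f)
    rw [h2] at h1
    exact h1.mp (hfint.smul_measure hctop)
  have hfnorm (w : E) : ‖f w‖ = Real.exp (-(β.re * ‖w‖ ^ 2)) := by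
    have : f w = cexp (-β * ‖w‖ ^ 2) * cexp (((2 * Real.pi * inner ℝ X w : ℝ) : ℂ) * I) := by
      simp only [f]
      rw [← Complex.exp_add]
      push_cast
      ring_nf
    rw [this, norm_mul, Complex.norm_exp_ofReal_mul_I, mul_one, Complex.norm_exp]
    congr 1
    rw [← Complex.ofReal_pow, Complex.re_mul_ofReal]
    simp
  have hgc : Continuous g := by fun_prop
  have hfour (m : F → ℤ) :
      ∫ t : F → ℝ, cexp (-(2 * Real.pi * I * ∑ i, (m i : ℂ) * (t i : ℂ))) * g t =
      c.toReal * ((-I * τ) ^ ((Fintype.card F : ℂ) / 2) *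
        cexp (Real.pi * I * τ * (form G (toReal (b.dualEquiv.symm m : F → ℚ) - x)
          (toReal (b.dualEquiv.symm m : F → ℚ) - x) : ℝ))) := by
    let w : E := hG.rowEquiv (toReal (b.dualEquiv.symm m : F → ℚ))
    have h1 (t : F → ℝ) : ∑ i, (m i : ℂ) * (t i : ℂ) = (inner ℝ (A t) w : ℝ) := by
      rw [hA, hG.inner_rowEquiv, b.form_coordEquiv_dual]
      push_cast
      rfl
    simp_rw [h1]
    rw [hchange (fun v => cexp (-(2 * Real.pi * I * (inner ℝ v w : ℝ))) * f v)]
    congr 1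
    have h2 := fourier_gaussian_innerProductSpace' hβre X w
    rw [Real.fourier_eq', hfin] at h2
    have e1 : (Real.pi : ℂ) / β = -I * τ := by
      rw [hβ]
      field_simp
    have e2 : -(Real.pi : ℂ) ^ 2 * ‖X - w‖ ^ 2 / β = Real.pi * I * τ *
        (form G (toReal (b.dualEquiv.symm m : F → ℚ) - x)
          (toReal (b.dualEquiv.symm m : F → ℚ) - x) : ℝ) := by
      rw [← hG.norm_rowEquiv_sq, map_sub, norm_sub_rev]
      have : -(Real.pi : ℂ) ^ 2 * ‖w - X‖ ^ 2 / β = -Real.pi * ‖w - X‖ ^ 2 * (Real.pi / β) := by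
        ring
      rw [this, e1]
      push_cast
      ring
    rw [e1, e2] at h2
    rw [← h2]
    congr 1
    ext v
    simp only [smul_eq_mul, f]
    congr 2
    push_cast
    ring
  have hsum : ∀ R : ℝ, ∃ u : (F → ℤ) → ℝ, Summable u ∧
      ∀ (k : F → ℤ) (t : F → ℝ), ‖t‖ ≤ R → ‖g (t + intToReal k)‖ ≤ u k := by
    intro R
    -- The majorant comes from `‖A k‖² ≤ 2‖A (t + k)‖² + 2‖A t‖²`: half of the Gaussian decay in `k`
    -- survives uniformly for bounded `t`.
    refine ⟨fun k => Real.exp (β.re * (‖(A : (F → ℝ) →L[ℝ] E)‖ * R) ^ 2) *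
      Real.exp (-(β.re / 2 * ‖A (intToReal k)‖ ^ 2)), Summable.mul_left _ ?_, fun k t ht => ?_⟩
    · have h1 := summable_exp_neg_form hG (c := β.re / 2) (by linarith) 0
      have h2 : Function.Injective fun k : F → ℤ =>
          (⟨b.evenEquiv.symm k, evenLattice_le_dualLattice (b.evenEquiv.symm k).2⟩ : dualLattice G) := by
        intro k k' h
        exact b.evenEquiv.symm.injective (Subtype.ext (by simpa using h))
      refine (h1.comp_injective h2).congr fun k => ?_
      rw [Function.comp_apply, hA, hG.norm_rowEquiv_sq, b.coordEquiv_intToReal, add_zero]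
    · beta_reduce
      rw [← Real.exp_add, hfnorm, Real.exp_le_exp]
      have h1 : ‖A t‖ ≤ ‖(A : (F → ℝ) →L[ℝ] E)‖ * R :=
        ((A : (F → ℝ) →L[ℝ] E).le_opNorm t).trans
          (mul_le_mul_of_nonneg_left ht (ContinuousLinearMap.opNorm_nonneg _))
      have h2 : ‖A (intToReal k)‖ ≤ ‖A (t + intToReal k)‖ + ‖A t‖ := by
        have : A (intToReal k) = A (t + intToReal k) - A t := by rw [map_add]; abel
        rw [this]
        exact norm_sub_le _ _
      have h3 : ‖A t‖ ^ 2 ≤ (‖(A : (F → ℝ) →L[ℝ] E)‖ * R) ^ 2 :=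
        pow_le_pow_left₀ (norm_nonneg _) h1 2
      have h4 : ‖A (intToReal k)‖ ^ 2 ≤ 2 * ‖A (t + intToReal k)‖ ^ 2 + 2 * ‖A t‖ ^ 2 := by
        have := pow_le_pow_left₀ (norm_nonneg _) h2 2
        nlinarith [sq_nonneg (‖A (t + intToReal k)‖ - ‖A t‖)]
      nlinarith
  have hfsum : Summable fun m : F → ℤ =>
      ∫ t : F → ℝ, cexp (-(2 * Real.pi * I * ∑ i, (m i : ℂ) * (t i : ℂ))) * g t := by
    simp_rw [hfour]
    refine Summable.mul_left _ (Summable.mul_left _ (Summable.of_norm ?_))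
    have h1 := summable_exp_neg_form hG (c := Real.pi * τ.im) (by
      have := Real.pi_pos; have := τ.im_pos; positivity) (-x)
    refine ((b.dualEquiv.symm.summable_iff).mpr h1).congr fun m => ?_
    rw [Function.comp_apply, Complex.norm_exp, Complex.re_mul_ofReal, ← sub_eq_add_neg]
    congr 1
    simp
  have key := (hasSum_poisson hgc hgint hsum hfsum (b.coordEquiv.symm v)).tsum_eq
  have hleft : ∑' l : evenLattice G, cexp (-β *
          (form G (v + toReal (l : F → ℚ)) (v + toReal (l : F → ℚ)) : ℝ) +
          2 * Real.pi * I * (form G x (v + toReal (l : F → ℚ)) : ℝ)) =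
      ∑' k : F → ℤ, g (b.coordEquiv.symm v + intToReal k) := by
    rw [← b.evenEquiv.symm.tsum_eq]
    refine tsum_congr fun k => ?_
    simp only [g, f, X]
    rw [hA, map_add, LinearEquiv.apply_symm_apply, b.coordEquiv_intToReal, hG.inner_rowEquiv,
      ← hG.norm_rowEquiv_sq]
    push_cast
    rfl
  rw [hleft, ← key, ← b.dualEquiv.symm.tsum_eq, ← tsum_mul_left]
  refine tsum_congr fun m => ?_
  rw [hfour]
  have : ∑ i, (m i : ℂ) * ((b.coordEquiv.symm v i : ℝ) : ℂ) =
      (form G (toReal (b.dualEquiv.symm m : F → ℚ)) v : ℝ) := by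
    have := b.form_coordEquiv_dual (b.coordEquiv.symm v) m
    rw [LinearEquiv.apply_symm_apply, form_comm] at this
    rw [this]
    push_cast
    rfl
  rw [this, Complex.exp_add]
  ring

end GaussianPoisson

end RootTheta

end

noncomputable section

namespace RootTheta

open UpperHalfPlane hiding I
open MatrixGroups Manifold

/-! ### Uniqueness of Fourier coefficients. -/

section FourierUniqueness

open MeasureTheory Complex

variable {F : Type*} [Fintype F]

/-- The coefficients of an absolutely convergent Fourier series in several variables are unique. -/
lemma eq_zero_of_tsum_exp {a : (F → ℤ) → ℂ} (ha : Summable a)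
    (h : ∀ t : F → ℝ, ∑' m, a m * cexp (2 * Real.pi * I * ∑ i, (m i : ℂ) * (t i : ℂ)) = 0) :
    a = 0 := by
  have hs : Summable fun m => a m • UnitAddTorus.mFourier (d := F) m := by
    refine Summable.of_norm (ha.norm.congr fun m => ?_)
    rw [norm_smul, UnitAddTorus.mFourier_norm, mul_one]
  have h0 : ∑' m, a m • UnitAddTorus.mFourier (d := F) m = 0 := by
    ext t
    obtain ⟨s, rfl⟩ : ∃ s : F → ℝ, (fun i => (s i : UnitAddCircle)) = t := by
      choose s hs using fun i => QuotientAddGroup.mk_surjective (t i)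
      exact ⟨s, funext hs⟩
    rw [ContinuousMap.zero_apply, ← h s]
    have h1 := hs.hasSum.map (ContinuousMap.evalCLM ℂ (fun i => (s i : UnitAddCircle)))
      (ContinuousLinearMap.continuous _)
    refine (h1.tsum_eq.symm.trans ?_)
    refine tsum_congr fun m => ?_
    simp [← mFourier_coe]
  -- Uniform convergence passes to `L²`, where the characters are orthonormal, so each coefficient
  -- is an inner product with the zero function.
  have h1 : HasSum (fun m => a m • UnitAddTorus.mFourierLp (d := F) 2 m) 0 := by
    let : MeasureSpace UnitAddCircle := ⟨AddCircle.haarAddCircle⟩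
    have : IsProbabilityMeasure (volume : Measure UnitAddCircle) :=
      inferInstanceAs (IsProbabilityMeasure AddCircle.haarAddCircle)
    have h2 := hs.hasSum
    rw [h0] at h2
    have h3 := h2.mapL (ContinuousMap.toLp (E := ℂ) 2 (volume : Measure (UnitAddTorus F)) ℂ)
    rw [map_zero] at h3
    simp only [map_smul] at h3
    exact h3
  ext m
  have h3 := h1.mapL (innerSL ℂ (UnitAddTorus.mFourierLp (d := F) 2 m))
  have h4 := hasSum_single m (f := fun n => innerSL ℂ (UnitAddTorus.mFourierLp (d := F) 2 m)
    (a n • UnitAddTorus.mFourierLp (d := F) 2 n)) (by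
      intro n hn
      rw [map_smul, innerSL_apply_apply, UnitAddTorus.orthonormal_mFourier.2 hn.symm, smul_zero])
  have h5 := h3.unique h4
  rw [map_zero, map_smul, innerSL_apply_apply, inner_self_eq_norm_sq_to_K,
    UnitAddTorus.orthonormal_mFourier.1] at h5
  simpa using h5.symm

end FourierUniqueness

/-! ### The action of the modular group on functions of `τ` and real characteristics. -/

section SlashRepresentation

open Complex

variable {F : Type*}

/-- The factor of automorphy `cτ + d`. -/
def autFactor (A : SL(2, ℤ)) (τ : ℍ) : ℂ := ((A 1 0 : ℤ) : ℂ) * τ + ((A 1 1 : ℤ) : ℂ)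

lemma autFactor_ne_zero (A : SL(2, ℤ)) (τ : ℍ) : autFactor A τ ≠ 0 := by
  have h := denom_ne_zero (A : GL (Fin 2) ℝ) τ
  rw [ModularGroup.denom_apply] at h
  simpa [autFactor] using h

lemma coe_smul_eq (A : SL(2, ℤ)) (τ : ℍ) : ((A • τ : ℍ) : ℂ) =
    (((A 0 0 : ℤ) : ℂ) * τ + ((A 0 1 : ℤ) : ℂ)) / autFactor A τ := by
  rw [coe_specialLinearGroup_apply]
  simp [autFactor]

lemma autFactor_mul (A B : SL(2, ℤ)) (τ : ℍ) :
    autFactor (A * B) τ = autFactor A (B • τ) * autFactor B τ := by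
  have hB := autFactor_ne_zero B τ
  conv_rhs => rw [autFactor, coe_smul_eq]
  rw [add_mul, mul_assoc, div_mul_cancel₀ _ hB]
  simp only [autFactor, Matrix.SpecialLinearGroup.coe_mul, Matrix.mul_apply, Fin.sum_univ_two]
  push_cast
  ring

lemma autFactor_one (τ : ℍ) : autFactor 1 τ = 1 := by
  simp [autFactor]

/-- The action of `SL₂(ℤ)` on functions of `τ` and of real vectors `x`, `y` (the characteristics of
a theta function), in weight `k`. -/
def slashRep (F : Type*) (k : ℤ) : Representation ℂ SL(2, ℤ) (ℍ → (F → ℝ) → (F → ℝ) → ℂ) where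
  toFun A :=
    { toFun := fun φ τ x y => autFactor A⁻¹ τ ^ (-k) * φ (A⁻¹ • τ)
        (((A 0 0 : ℤ) : ℝ) • x + ((A 1 0 : ℤ) : ℝ) • y)
        (((A 0 1 : ℤ) : ℝ) • x + ((A 1 1 : ℤ) : ℝ) • y)
      map_add' := fun φ ψ => by
        ext τ x y
        simp [mul_add]
      map_smul' := fun c φ => by
        ext τ x y
        simp [mul_left_comm] }
  map_one' := by
    ext φ τ x y
    simp [autFactor_one]
  map_mul' A B := by
    ext φ τ x y
    simp only [LinearMap.coe_mk, AddHom.coe_mk, Module.End.mul_apply, mul_inv_rev,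
      Matrix.SpecialLinearGroup.coe_mul, Matrix.mul_apply, Fin.sum_univ_two]
    rw [autFactor_mul, mul_zpow, mul_smul, ← mul_assoc,
      mul_comm (autFactor B⁻¹ (A⁻¹ • τ) ^ (-k))]
    congr 2
    · ext f
      simp only [Pi.add_apply, Pi.smul_apply, smul_eq_mul]
      push_cast
      ring
    · ext f
      simp only [Pi.add_apply, Pi.smul_apply, smul_eq_mul]
      push_cast
      ring

lemma slashRep_apply (k : ℤ) (A : SL(2, ℤ)) (φ : ℍ → (F → ℝ) → (F → ℝ) → ℂ) (τ : ℍ)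
    (x y : F → ℝ) : slashRep F k A φ τ x y = autFactor A⁻¹ τ ^ (-k) * φ (A⁻¹ • τ)
        (((A 0 0 : ℤ) : ℝ) • x + ((A 1 0 : ℤ) : ℝ) • y)
        (((A 0 1 : ℤ) : ℝ) • x + ((A 1 1 : ℤ) : ℝ) • y) := rfl

lemma coe_T_inv_smul (τ : ℍ) : ((ModularGroup.T⁻¹ • τ : ℍ) : ℂ) = τ - 1 := by
  rw [coe_smul_eq]
  simp [autFactor, sub_eq_add_neg]

lemma coe_S_inv_smul (τ : ℍ) : ((ModularGroup.S⁻¹ • τ : ℍ) : ℂ) = -1 / τ := by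
  rw [coe_smul_eq]
  simp [autFactor, ModularGroup.coe_S, neg_div]

lemma slashRep_T (k : ℤ) (φ : ℍ → (F → ℝ) → (F → ℝ) → ℂ) (τ : ℍ)
    (x y : F → ℝ) : slashRep F k ModularGroup.T φ τ x y = φ (ModularGroup.T⁻¹ • τ) x (x + y) := by
  rw [slashRep_apply]
  simp [autFactor, ModularGroup.coe_T]

lemma slashRep_S (k : ℤ) (φ : ℍ → (F → ℝ) → (F → ℝ) → ℂ) (τ : ℍ)
    (x y : F → ℝ) : slashRep F k ModularGroup.S φ τ x y =
      (-(τ : ℂ)) ^ (-k) * φ (ModularGroup.S⁻¹ • τ) y (-x) := by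
  rw [slashRep_apply]
  simp [autFactor, ModularGroup.coe_S, Matrix.adjugate_fin_two]

lemma slashRep_neg_one (k : ℤ) (φ : ℍ → (F → ℝ) → (F → ℝ) → ℂ) (τ : ℍ)
    (x y : F → ℝ) : slashRep F k (-1) φ τ x y = (-1) ^ (-k) * φ τ (-x) (-y) := by
  rw [slashRep_apply]
  have h1 : (-1 : SL(2, ℤ))⁻¹ = -1 := by
    rw [inv_eq_iff_mul_eq_one]; simp
  have h2 : (-1 : SL(2, ℤ)) • τ = τ := by
    rw [ModularGroup.SL_neg_smul, one_smul]
  rw [h1, h2]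
  simp [autFactor]

end SlashRepresentation

end RootTheta

end

noncomputable section

namespace RootTheta

open UpperHalfPlane hiding I
open MatrixGroups Manifold

/-! ### Characters of `ℚ/ℤ` and representatives in the discriminant form. -/

section Exponential

open Complex

lemma e_coe (x : ℚ) : e (x : AddCircle (1 : ℚ)) = cexp (2 * Real.pi * I * (x : ℂ)) := rfl

lemma e_zero : e 0 = 1 := by
  have := e_coe 0
  simpa using this

lemma star_e (x : AddCircle (1 : ℚ)) : (starRingEnd ℂ) (e x) = e (-x) := by
  induction x using QuotientAddGroup.induction_on with | H x => ?_
  rw [← AddCircle.coe_neg, e_coe, e_coe, ← Complex.exp_conj]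
  simp [map_ofNat]

end Exponential

section DiscForm

variable {P F : Type*} [Fintype F] [Fintype P] {G : Matrix P F ℤ}

lemma discForm_coe (l : dualLattice G) : discForm G (l : Disc G) =
    ((form G (l : F → ℚ) (l : F → ℚ) / 2 : ℚ) : AddCircle (1 : ℚ)) := rfl

lemma polar_discForm_coe (l l' : dualLattice G) :
    QuadraticMap.polar (discForm G) (l : Disc G) (l' : Disc G) =
    ((form G (l : F → ℚ) (l' : F → ℚ) : ℚ) : AddCircle (1 : ℚ)) := by
  rw [QuadraticMap.polar, ← QuotientAddGroup.mk_add, discForm_coe, discForm_coe, discForm_coe,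
    ← AddCircle.coe_sub, ← AddCircle.coe_sub]
  congr 1
  rw [AddSubgroup.coe_add, form_add_self]
  ring

lemma polar_discForm_zero_left (γ : Disc G) : QuadraticMap.polar (discForm G) 0 γ = 0 := by
  induction γ using QuotientAddGroup.induction_on with | H l => ?_
  rw [← QuotientAddGroup.mk_zero, polar_discForm_coe, AddSubgroup.coe_zero, form_zero_left]
  simp

lemma polar_discForm_zero_right (γ : Disc G) : QuadraticMap.polar (discForm G) γ 0 = 0 := by
  rw [QuadraticMap.polar_comm, polar_discForm_zero_left]

lemma tsum_eq_sum_fiber [Fintype (Disc G)] {f : dualLattice G → ℂ} (hf : Summable f) :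
    ∑' l, f l = ∑ γ : Disc G, ∑' l : {l : dualLattice G // (l : Disc G) = γ}, f l := by
  let E := Equiv.sigmaFiberEquiv fun l : dualLattice G => (l : Disc G)
  have h : Summable (f ∘ E) := E.summable_iff.mpr hf
  exact (E.tsum_eq f).symm.trans (h.tsum_sigma.trans (tsum_fintype _))

/-- A coset of `L_ev` is a translate of it. -/
def fiberEquiv (l₀ : dualLattice G) :
    evenLattice G ≃ {l : dualLattice G // (l : Disc G) = (l₀ : Disc G)} where
  toFun x := ⟨l₀ + ⟨x, evenLattice_le_dualLattice x.2⟩, by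
    rw [eq_comm, QuotientAddGroup.eq, AddSubgroup.mem_addSubgroupOf]
    simp⟩
  invFun l := ⟨((-l₀ + l : dualLattice G) : F → ℚ), by
    have := l.2
    rw [eq_comm, QuotientAddGroup.eq, AddSubgroup.mem_addSubgroupOf] at this
    exact this⟩
  left_inv x := by ext1; simp
  right_inv l := by ext1; ext1; simp

lemma fiberEquiv_apply (l₀ : dualLattice G) (x : evenLattice G) :
    (((fiberEquiv l₀ x : {l : dualLattice G // (l : Disc G) = (l₀ : Disc G)}) : dualLattice G) :
      F → ℚ) = l₀ + x := rfl

end DiscForm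

/-! ### Theta series with characteristics and their transformation under `S` and `T`. -/

section CharTheta

open Complex

variable {P F : Type*} [Fintype F] [Fintype P] {G : Matrix P F ℤ}

/-- The terms of theta series with characteristics `x`, `y`. -/
def charTerm (G : Matrix P F ℤ) (τ : ℍ) (x y v : F → ℝ) : ℂ :=
  cexp (Real.pi * I * τ * (form G (v + x) (v + x) : ℝ) + 2 * Real.pi * I * (form G v y : ℝ) +
    Real.pi * I * (form G x y : ℝ))

/-- The theta series `Θ_γ` in terms of real characteristics: up to an elementary factor this is
`Θ_γ(τ, τx + y)`. -/
def charTheta (G : Matrix P F ℤ) (γ : Disc G) (τ : ℍ) (x y : F → ℝ) : ℂ :=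
  ∑' l : {l : dualLattice G // (l : Disc G) = γ}, charTerm G τ x y (toReal (l : F → ℚ))

lemma norm_charTerm (τ : ℍ) (x y v : F → ℝ) :
    ‖charTerm G τ x y v‖ = Real.exp (-(Real.pi * τ.im * form G (v + x) (v + x))) := by
  rw [charTerm, Complex.norm_exp]
  congr 1
  simp

lemma summable_charTerm [DecidableEq F] (hG : HasUnitRows G) (τ : ℍ) (x y : F → ℝ) :
    Summable fun l : dualLattice G => charTerm G τ x y (toReal (l : F → ℚ)) := by
  refine Summable.of_norm ?_
  simp_rw [norm_charTerm]
  exact summable_exp_neg_form hG (mul_pos Real.pi_pos τ.im_pos) x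

lemma cast_form_toReal (x y : F → ℚ) : ((form G (toReal x) (toReal y) : ℝ) : ℂ) =
    ((form G x y : ℚ) : ℂ) := by
  rw [form_toReal]
  push_cast
  rfl

lemma charTheta_neg (γ : Disc G) (τ : ℍ) (x y : F → ℝ) :
    charTheta G γ τ (-x) (-y) = charTheta G (-γ) τ x y := by
  let E : {l : dualLattice G // (l : Disc G) = γ} ≃ {l : dualLattice G // (l : Disc G) = -γ} :=
    (Equiv.neg _).subtypeEquiv fun l => by simp
  rw [charTheta, charTheta, ← E.tsum_eq]
  refine tsum_congr fun l => ?_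
  have h1 : toReal (((E l : {l : dualLattice G // (l : Disc G) = -γ}) : dualLattice G) : F → ℚ) =
      -toReal (l : F → ℚ) := toReal_neg _
  have h2 : -toReal (l : F → ℚ) + x = -(toReal (l : F → ℚ) + -x) := by abel
  rw [h1, charTerm, charTerm, h2, form_neg_left G (_ + _), form_neg_right G _ (_ + _), neg_neg,
    form_neg_left, form_neg_right, form_neg_right, form_neg_left, neg_neg]

/-- The factor `e((x, y)/2)` in `charTerm` absorbs the cross terms, so that only `e(-(l, l)/2)`
remains, and this is constant on a coset. -/
lemma charTheta_T (γ : Disc G) (τ : ℍ) (x y : F → ℝ) :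
    charTheta G γ (ModularGroup.T⁻¹ • τ) x (x + y) = e (-discForm G γ) * charTheta G γ τ x y := by
  rw [charTheta, charTheta, ← tsum_mul_left]
  refine tsum_congr fun l => ?_
  obtain ⟨l, rfl⟩ := l
  rw [discForm_coe, ← AddCircle.coe_neg, e_coe, charTerm, charTerm, ← Complex.exp_add,
    coe_T_inv_smul]
  congr 1
  rw [form_add_self, form_add_right G x, form_add_right G _ x y]
  push_cast
  rw [← cast_form_toReal]
  ring

/-- Poisson summation turns the sum over `l₀ + L_ev` into a sum over `L_ev^∨`, which is then grouped
by classes. Even rank makes the exponent `n/2` an integer and so removes the choice of a square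
root. -/
lemma HasUnitRows.charTheta_S [DecidableEq F] [Fintype (Disc G)] (hG : HasUnitRows G) {k : ℕ}
    (hk : Fintype.card F = 2 * k) : ∃ C : ℝ, 0 < C ∧
    ∀ (γ : Disc G) (τ : ℍ) (x y : F → ℝ), charTheta G γ (ModularGroup.S⁻¹ • τ) y (-x) =
      C * (-I * τ) ^ k *
        ∑ β, e (QuadraticMap.polar (discForm G) γ β) * charTheta G β τ x y := by
  obtain ⟨C, hC, h⟩ := hG.gaussian_poisson
  refine ⟨C, hC, fun γ τ x y => ?_⟩
  induction γ using QuotientAddGroup.induction_on with | H l₀ => ?_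
  have hk' : (-I * (τ : ℂ)) ^ ((Fintype.card F : ℂ) / 2) = (-I * (τ : ℂ)) ^ k := by
    rw [hk, ← Complex.cpow_natCast]
    congr 1
    push_cast
    ring
  have h1 := h τ (-x) (toReal (l₀ : F → ℚ) + y)
  rw [hk'] at h1
  have h2 : charTheta G l₀ (ModularGroup.S⁻¹ • τ) y (-x) = cexp (Real.pi * I * (form G x y : ℝ)) *
      ∑' l : evenLattice G, cexp (-(Real.pi / (-I * τ)) *
          (form G (toReal (l₀ : F → ℚ) + y + toReal (l : F → ℚ))
            (toReal (l₀ : F → ℚ) + y + toReal (l : F → ℚ)) : ℝ) +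
          2 * Real.pi * I * (form G (-x) (toReal (l₀ : F → ℚ) + y + toReal (l : F → ℚ)) : ℝ)) := by
    rw [charTheta, ← (fiberEquiv l₀).tsum_eq, ← tsum_mul_left]
    refine tsum_congr fun l => ?_
    rw [fiberEquiv_apply, toReal_add, charTerm, ← Complex.exp_add, add_right_comm, coe_S_inv_smul]
    have h3 : -((Real.pi : ℂ) / (-I * τ)) = Real.pi * I * (-1 / τ) := by
      have := τ.ne_zero
      field_simp
      simp
    rw [h3]
    congr 1
    rw [form_comm G x y]
    simp only [form_neg_right, form_neg_left, form_add_right]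
    rw [form_comm G x y, form_comm G x, form_comm G x]
    simp only [form_add_left]
    push_cast
    ring
  rw [h2, h1, mul_left_comm, ← tsum_mul_left]
  congr 1
  have h4 (l : dualLattice G) : cexp (Real.pi * I * (form G x y : ℝ)) *
      cexp (Real.pi * I * τ *
          (form G (toReal (l : F → ℚ) - -x) (toReal (l : F → ℚ) - -x) : ℝ) +
        2 * Real.pi * I * (form G (toReal (l : F → ℚ)) (toReal (l₀ : F → ℚ) + y) : ℝ)) =
      e (QuadraticMap.polar (discForm G) (l₀ : Disc G) (l : Disc G)) *
        charTerm G τ x y (toReal (l : F → ℚ)) := by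
    rw [polar_discForm_coe, e_coe, charTerm, ← Complex.exp_add, ← Complex.exp_add, sub_neg_eq_add,
      form_add_right G (toReal (l : F → ℚ)) (toReal (l₀ : F → ℚ)), Complex.ofReal_add,
      cast_form_toReal, form_comm G (l₀ : F → ℚ)]
    congr 1
    ring
  simp_rw [h4]
  rw [tsum_eq_sum_fiber]
  · refine Finset.sum_congr rfl fun β _ => ?_
    rw [charTheta, ← tsum_mul_left]
    refine tsum_congr fun l => ?_
    rw [l.2]
  · refine Summable.of_norm ?_
    refine (summable_charTerm hG τ x y).norm.congr fun l => ?_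
    rw [norm_mul, polar_discForm_coe, e_coe]
    have : cexp (2 * Real.pi * I * ((form G (l₀ : F → ℚ) (l : F → ℚ) : ℚ) : ℂ)) =
        cexp (((2 * Real.pi * (form G (l₀ : F → ℚ) (l : F → ℚ) : ℚ) : ℝ) : ℂ) * I) := by
      push_cast
      ring_nf
    rw [this, Complex.norm_exp_ofReal_mul_I, one_mul]

/-- For fixed `τ`, the theta series of the cosets are linearly independent functions. -/
lemma HasUnitRows.charTheta_injective [DecidableEq F] [Fintype (Disc G)] (hG : HasUnitRows G)
    (τ : ℍ) {c : Disc G → ℂ} (h : ∀ y, ∑ γ, c γ * charTheta G γ τ 0 y = 0) : c = 0 := by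
  obtain ⟨b⟩ := hG.exists_dualBases
  have hs (y : F → ℝ) : Summable fun l : dualLattice G =>
      c (l : Disc G) * charTerm G τ 0 y (toReal (l : F → ℚ)) := by
    obtain ⟨B, hB⟩ := (Set.finite_range fun γ => ‖c γ‖).bddAbove
    refine Summable.of_norm_bounded ((summable_charTerm hG τ 0 y).norm.mul_left B) fun l => ?_
    rw [norm_mul]
    exact mul_le_mul_of_nonneg_right (hB ⟨_, rfl⟩) (norm_nonneg _)
  have h1 (y : F → ℝ) : ∑' l : dualLattice G,
      c (l : Disc G) * charTerm G τ 0 y (toReal (l : F → ℚ)) = 0 := by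
    rw [tsum_eq_sum_fiber (hs y), ← h y]
    refine Finset.sum_congr rfl fun γ _ => ?_
    rw [charTheta, ← tsum_mul_left]
    refine tsum_congr fun l => ?_
    rw [l.2]
  -- For `x = 0` the combination is a Fourier series in the coordinates of `y`. Its coefficients are
  -- the `c γ` times nonvanishing exponentials.
  let a : (F → ℤ) → ℂ := fun m => c ((b.dualEquiv.symm m : dualLattice G) : Disc G) *
    charTerm G τ 0 0 (toReal (b.dualEquiv.symm m : F → ℚ))
  have ha : a = 0 := by
    refine eq_zero_of_tsum_exp (b.dualEquiv.symm.summable_iff.mpr (hs 0)) fun t => ?_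
    rw [← h1 (b.coordEquiv t), ← b.dualEquiv.symm.tsum_eq]
    refine tsum_congr fun m => ?_
    simp only [a]
    rw [mul_assoc]
    congr 1
    rw [charTerm, charTerm, ← Complex.exp_add, form_comm G _ (b.coordEquiv t),
      b.form_coordEquiv_dual]
    congr 1
    simp only [form_zero_left, form_zero_right]
    push_cast
    ring
  ext γ
  induction γ using QuotientAddGroup.induction_on with | H l => ?_
  have h2 := congrFun ha (b.dualEquiv l)
  simp only [a, Equiv.symm_apply_apply] at h2
  exact (mul_eq_zero.mp h2).resolve_right (Complex.exp_ne_zero _)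

lemma thetaSeries_eq_charTheta (γ : Disc G) (τ : ℍ) (x y : F → ℝ) :
    thetaSeries G γ τ (fun f => (τ : ℂ) * x f + y f) =
      cexp (-(Real.pi * I * τ * (form G x x : ℝ) + Real.pi * I * (form G x y : ℝ))) *
        charTheta G γ τ x y := by
  rw [thetaSeries, charTheta, ← tsum_mul_left]
  refine tsum_congr fun l => ?_
  rw [charTerm, ← Complex.exp_add, ← Complex.exp_add]
  congr 1
  have h1 : form G (fun f => (((l : dualLattice G) : F → ℚ) f : ℂ)) (fun f => (τ : ℂ) * x f + y f) =
      τ * (form G (toReal (l : F → ℚ)) x : ℝ) + (form G (toReal (l : F → ℚ)) y : ℝ) := by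
    have e1 : (fun f => (τ : ℂ) * x f + y f) =
      (τ : ℂ) • (fun f => (x f : ℂ)) + (fun f => (y f : ℂ)) := rfl
    rw [e1, form_add_right, form_smul_right, ← form_ofReal, ← form_ofReal]
    simp
  rw [h1]
  push_cast
  rw [form_add_self, form_comm G x x, ← cast_form_toReal]
  push_cast
  ring

end CharTheta

end RootTheta

end

noncomputable section

namespace RootTheta

open UpperHalfPlane hiding I
open MatrixGroups Manifold

/-! ### The Weil representation on the span of the theta series. -/

section WeilRepresentation

open Complex

variable {P F : Type*} [Fintype F] [Fintype P] {G : Matrix P F ℤ}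

/-- The functions `∑ v_γ Θ_γ`. -/
def thetaMap (G : Matrix P F ℤ) : (Disc G →₀ ℂ) →ₗ[ℂ] (ℍ → (F → ℝ) → (F → ℝ) → ℂ) :=
  Finsupp.linearCombination ℂ (charTheta G)

lemma thetaMap_single (γ : Disc G) : thetaMap G (Finsupp.single γ 1) = charTheta G γ := by
  simp [thetaMap]

lemma thetaMap_apply [Fintype (Disc G)] (v : Disc G →₀ ℂ) (τ : ℍ) (x y : F → ℝ) :
    thetaMap G v τ x y = ∑ γ, v γ * charTheta G γ τ x y := by
  rw [thetaMap, Finsupp.linearCombination_apply, Finsupp.sum_fintype _ _ (by simp)]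
  simp [Finset.sum_apply]

lemma HasUnitRows.thetaMap_injective_at [DecidableEq F] [Fintype (Disc G)] (hG : HasUnitRows G)
    (τ : ℍ) {v w : Disc G →₀ ℂ} (h : ∀ x y, thetaMap G v τ x y = thetaMap G w τ x y) : v = w := by
  have h1 := hG.charTheta_injective τ (c := fun γ => v γ - w γ) (fun y => by
    have := h 0 y
    rw [thetaMap_apply, thetaMap_apply] at this
    simp only [sub_mul, Finset.sum_sub_distrib, this, sub_self])
  ext γ
  exact sub_eq_zero.mp (congrFun h1 γ)

lemma HasUnitRows.thetaMap_injective [DecidableEq F] [Fintype (Disc G)] (hG : HasUnitRows G) :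
    Function.Injective (thetaMap G) := fun v w h =>
  hG.thetaMap_injective_at UpperHalfPlane.I fun x y => by rw [h]

/-- A subspace of a representation of `SL₂(ℤ)` that is stable under `S` and `T` carries a
representation. -/
lemma exists_representation_of_generators {V W : Type*} [AddCommGroup V] [Module ℂ V]
    [FiniteDimensional ℂ V] [AddCommGroup W] [Module ℂ W] (ρ : Representation ℂ SL(2, ℤ) W)
    (Θ : V →ₗ[ℂ] W) (hΘ : Function.Injective Θ)
    (hS : ∃ M : V →ₗ[ℂ] V, ∀ v, Θ (M v) = ρ ModularGroup.S (Θ v))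
    (hT : ∃ M : V →ₗ[ℂ] V, ∀ v, Θ (M v) = ρ ModularGroup.T (Θ v)) :
    ∃ ρ' : Representation ℂ SL(2, ℤ) V, ∀ A v, Θ (ρ' A v) = ρ A (Θ v) := by
  have h (A : SL(2, ℤ)) : ∃ M : V →ₗ[ℂ] V, ∀ v, Θ (M v) = ρ A (Θ v) := by
    have hA : A ∈ Subgroup.closure {ModularGroup.S, ModularGroup.T} := by
      rw [SpecialLinearGroup.SL2Z_generators]
      trivial
    induction hA using Subgroup.closure_induction with
    | mem A hA =>
      rcases hA with rfl | rfl
      · exact hS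
      · exact hT
    | one => exact ⟨LinearMap.id, fun v => by simp⟩
    | mul A B _ _ hA hB =>
      obtain ⟨M, hM⟩ := hA
      obtain ⟨M', hM'⟩ := hB
      exact ⟨M ∘ₗ M', fun v => by simp [hM, hM']⟩
    | inv A _ hA =>
      obtain ⟨M, hM⟩ := hA
      have hinv (w : W) : ρ A⁻¹ (ρ A w) = w := by
        rw [← Module.End.mul_apply, ← map_mul]
        simp
      -- On a finite-dimensional space an injective endomorphism is invertible, so stability under a
      -- generator implies stability under its inverse.
      have hinj : Function.Injective M := by
        intro v w hvw
        apply hΘ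
        rw [← hinv (Θ v), ← hM, hvw, hM, hinv]
      let E := LinearEquiv.ofInjectiveEndo M hinj
      refine ⟨E.symm.toLinearMap, fun v => ?_⟩
      obtain ⟨u, rfl⟩ := E.surjective v
      have : E u = M u := rfl
      rw [LinearEquiv.coe_coe, E.symm_apply_apply, this, hM, hinv]
  choose M hM using h
  refine ⟨⟨⟨M, ?_⟩, ?_⟩, hM⟩
  · ext v
    apply hΘ
    simp [hM]
  · intro A B
    ext v
    apply hΘ
    simp [hM]

/-- The Weil representation, realized on the theta series. -/
theorem HasUnitRows.exists_weilRepresentation [DecidableEq F] [Fintype (Disc G)]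
    (hG : HasUnitRows G) {k : ℕ} (hk : Fintype.card F = 2 * k) :
    ∃ ρ : Representation ℂ SL(2, ℤ) (Disc G →₀ ℂ), IsWeilRepresentation (discForm G) ρ ∧
      ∀ A v, thetaMap G (ρ A v) = slashRep F k A (thetaMap G v) := by
  obtain ⟨C, hC, hCS⟩ := hG.charTheta_S hk
  have hT (γ : Disc G) : slashRep F k ModularGroup.T (charTheta G γ) =
      thetaMap G (e (-discForm G γ) • Finsupp.single γ 1) := by
    ext τ x y
    rw [slashRep_T, charTheta_T, map_smul, thetaMap_single]
    simp
  -- The automorphy factor `(-τ)^(-k)` cancels against `(-Iτ)^k = I^k (-τ)^k`. Apart from `C > 0`,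
  -- the scalar of `S` is thus known; relations in `SL₂(ℤ)` will identify it with the normalization
  -- by the Gauss sum.
  let κ : ℂ := C * I ^ k
  let cS (γ : Disc G) : Disc G →₀ ℂ :=
    Finsupp.equivFunOnFinite.symm fun β => κ * e (QuadraticMap.polar (discForm G) γ β)
  have hS (γ : Disc G) : slashRep F k ModularGroup.S (charTheta G γ) = thetaMap G (cS γ) := by
    ext τ x y
    rw [slashRep_S, hCS, thetaMap_apply, ← mul_assoc, Finset.mul_sum]
    refine Finset.sum_congr rfl fun β _ => ?_
    simp only [cS, Finsupp.equivFunOnFinite_symm_apply_apply]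
    rw [← mul_assoc]
    congr 2
    have hτ : -(τ : ℂ) ≠ 0 := neg_ne_zero.mpr τ.ne_zero
    have : -I * (τ : ℂ) = I * -τ := by ring
    rw [this, mul_pow, zpow_neg, zpow_natCast]
    simp only [κ]
    field_simp
  have ext_single {M : (Disc G →₀ ℂ) →ₗ[ℂ] (Disc G →₀ ℂ)} {A : SL(2, ℤ)}
      (h : ∀ γ, thetaMap G (M (Finsupp.single γ 1)) = slashRep F k A (charTheta G γ)) (v) :
      thetaMap G (M v) = slashRep F k A (thetaMap G v) := by
    have : thetaMap G ∘ₗ M = (slashRep F k A) ∘ₗ thetaMap G := by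
      refine Finsupp.lhom_ext' fun γ => LinearMap.ext_ring ?_
      simpa [thetaMap_single] using h γ
    exact LinearMap.congr_fun this v
  obtain ⟨ρ, hρ⟩ := exists_representation_of_generators (slashRep F k) (thetaMap G)
    hG.thetaMap_injective
    ⟨Finsupp.linearCombination ℂ cS, ext_single fun γ => by simp [hS]⟩
    ⟨Finsupp.linearCombination ℂ fun γ => e (-discForm G γ) • Finsupp.single γ 1,
      ext_single fun γ => by rw [hT]; simp⟩
  have hρT (γ : Disc G) : ρ ModularGroup.T (Finsupp.single γ 1) =
      e (-discForm G γ) • Finsupp.single γ 1 := by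
    apply hG.thetaMap_injective
    rw [hρ, thetaMap_single, hT]
  have hρS (γ : Disc G) : ρ ModularGroup.S (Finsupp.single γ 1) = cS γ := by
    apply hG.thetaMap_injective
    rw [hρ, thetaMap_single, hS]
  have hρS' (v : Disc G →₀ ℂ) (β : Disc G) : ρ ModularGroup.S v β =
      ∑ γ, v γ * (κ * e (QuadraticMap.polar (discForm G) γ β)) := by
    have : v = ∑ γ, v γ • Finsupp.single γ 1 := by
      simp [Finsupp.univ_sum_single]
    conv_lhs => rw [this]
    rw [map_sum, Finsupp.finsetSum_apply]
    refine Finset.sum_congr rfl fun γ _ => ?_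
    rw [map_smul, hρS]
    rfl
  -- the square of `S`
  have hSS : κ ^ 2 * Fintype.card (Disc G) = (-1) ^ k := by
    have h1 : ρ (-1) (Finsupp.single 0 1) = ((-1 : ℂ) ^ k) • Finsupp.single 0 1 := by
      apply hG.thetaMap_injective
      rw [hρ, map_smul, thetaMap_single]
      ext τ x y
      rw [slashRep_neg_one, charTheta_neg, neg_zero, zpow_neg, zpow_natCast, ← inv_pow]
      norm_num
    have h2 : (-1 : SL(2, ℤ)) = ModularGroup.S * ModularGroup.S := by
      decide
    rw [h2, map_mul, Module.End.mul_apply, hρS] at h1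
    have h3 := DFunLike.congr_fun h1 0
    rw [hρS'] at h3
    simp only [cS, Finsupp.equivFunOnFinite_symm_apply_apply, polar_discForm_zero_left,
      polar_discForm_zero_right, e_zero] at h3
    simp at h3
    rw [← h3]
    ring
  -- The entry at `(0, 0)` of the relation `TSTST = S`; it computes the Gauss sum of `D` without
  -- Milgram's formula.
  have hSTS : κ * ∑ γ : Disc G, e (-discForm G γ) = 1 := by
    have h2 : ModularGroup.T * ModularGroup.S * ModularGroup.T * ModularGroup.S * ModularGroup.T =
        ModularGroup.S := by
      decide
    have h3 : ρ ModularGroup.T * ρ ModularGroup.S * ρ ModularGroup.T * ρ ModularGroup.S *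
        ρ ModularGroup.T = ρ ModularGroup.S := by
      rw [← map_mul, ← map_mul, ← map_mul, ← map_mul, h2]
    have hq0 : discForm G 0 = 0 := by
      have := discForm_coe (G := G) 0
      simpa [form_zero_left] using this
    have hρT' (v : Disc G →₀ ℂ) (β : Disc G) :
        ρ ModularGroup.T v β = e (-discForm G β) * v β := by
      have : v = ∑ γ, v γ • Finsupp.single γ 1 := by
        simp [Finsupp.univ_sum_single]
      conv_lhs => rw [this]
      rw [map_sum, Finsupp.finsetSum_apply, Finset.sum_eq_single β]
      · rw [map_smul, hρT]
        simp [mul_comm]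
      · intro γ _ hγ
        rw [map_smul, hρT]
        simp [hγ]
      · simp
    have h4 := DFunLike.congr_fun (LinearMap.congr_fun h3 (Finsupp.single 0 1)) 0
    simp only [Module.End.mul_apply] at h4
    rw [hρT', hq0, hρT, hq0, hρS'] at h4
    simp only [hρT', neg_zero, e_zero, one_mul, one_smul, hρS, cS,
      Finsupp.equivFunOnFinite_symm_apply_apply, polar_discForm_zero_left,
      polar_discForm_zero_right, mul_one] at h4
    have hκ : κ ≠ 0 := mul_ne_zero (by exact_mod_cast hC.ne') (pow_ne_zero _ Complex.I_ne_zero)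
    rw [← Finset.sum_mul, ← Finset.sum_mul] at h4
    apply mul_right_cancel₀ hκ
    linear_combination h4
  have hcard : (Nat.card (Disc G) : ℂ) ≠ 0 := by
    rw [Nat.card_eq_fintype_card]
    exact_mod_cast Fintype.card_ne_zero
  -- Conjugating the previous identity gives the inverse of the conjugate of `κ`. That conjugate is
  -- `(-1)^k κ` because `C` is real, and `κ² |D| = (-1)^k` finishes the computation.
  have hsum : ∑ γ : Disc G, e (discForm G γ) = κ * Nat.card (Disc G) := by
    have h1 := congrArg (starRingEnd ℂ) hSTS
    rw [map_mul, map_sum, map_one] at h1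
    simp only [star_e, neg_neg] at h1
    have h2 : (starRingEnd ℂ) κ = (-1) ^ k * κ := by
      simp only [κ, map_mul, map_pow, Complex.conj_ofReal, Complex.conj_I]
      rw [neg_pow]
      ring
    rw [h2] at h1
    have h3 : ((-1 : ℂ) ^ k) * (-1) ^ k = 1 := by
      rw [← mul_pow]
      simp
    have hκ : κ ≠ 0 := mul_ne_zero (by exact_mod_cast hC.ne') (pow_ne_zero _ Complex.I_ne_zero)
    rw [Nat.card_eq_fintype_card]
    have h4 : ((-1 : ℂ) ^ k) * κ ≠ 0 := mul_ne_zero (pow_ne_zero _ (by norm_num)) hκ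
    apply mul_left_cancel₀ h4
    rw [h1]
    calc (1 : ℂ) = (-1) ^ k * (-1) ^ k := h3.symm
      _ = (-1) ^ k * (κ ^ 2 * Fintype.card (Disc G)) := by rw [hSS]
      _ = _ := by ring
  have hphase : signPhase (discForm G) / (Real.sqrt (Nat.card (Disc G)) : ℂ) = κ := by
    rw [signPhase, finsum_eq_sum_of_fintype, hsum, div_div, ← Complex.ofReal_mul,
      Real.mul_self_sqrt (by positivity), Complex.ofReal_natCast, mul_div_cancel_right₀ _ hcard]
  refine ⟨ρ, ⟨hρT, fun γ β => ?_⟩, hρ⟩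
  rw [hphase, hρS]
  rfl

/-- An invariant function has the same expansion before and after applying `A`. Linear independence
of the theta series at the single point `A • τ` allows comparing coefficients. -/
lemma HasUnitRows.transform_of_invariant [DecidableEq F] [Fintype (Disc G)] (hG : HasUnitRows G)
    {k : ℤ} {ρ : Representation ℂ SL(2, ℤ) (Disc G →₀ ℂ)}
    (hρ : ∀ A v, thetaMap G (ρ A v) = slashRep F k A (thetaMap G v))
    {Ψ : ℍ → (F → ℝ) → (F → ℝ) → ℂ} (hS : slashRep F k ModularGroup.S Ψ = Ψ)
    (hT : slashRep F k ModularGroup.T Ψ = Ψ) {θ : ℍ → (Disc G →₀ ℂ)}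
    (hθ : ∀ τ x y, Ψ τ x y = thetaMap G (θ τ) τ x y) (A : SL(2, ℤ)) (τ : ℍ) :
    θ (A • τ) = ρ A (θ τ) := by
  have hA : slashRep F k A Ψ = Ψ := by
    have hA : A ∈ Subgroup.closure {ModularGroup.S, ModularGroup.T} := by
      rw [SpecialLinearGroup.SL2Z_generators]
      trivial
    induction hA using Subgroup.closure_induction with
    | mem A hA =>
      rcases hA with rfl | rfl
      · exact hS
      · exact hT
    | one => simp
    | mul A B _ _ hA hB => rw [map_mul, Module.End.mul_apply, hB, hA]
    | inv A _ hA =>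
      conv_lhs => rw [← hA]
      rw [← Module.End.mul_apply, ← map_mul]
      simp
  refine hG.thetaMap_injective_at (A • τ) fun x y => ?_
  rw [← hθ, ← hA, hρ, slashRep_apply, slashRep_apply, inv_smul_smul, hθ]

end WeilRepresentation

end RootTheta

end

noncomputable section

namespace RootTheta

open UpperHalfPlane hiding I
open MatrixGroups Manifold

/-! ### Transformation of `ϑ` and `η` under the generators. -/

section JacobiTheta

open Complex

/-- The terms of the Jacobi theta function, indexed by `n = 2m + 1`. -/
def jacobiTerm (τ : ℍ) (z : ℂ) (m : ℤ) : ℂ :=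
  (-1) ^ m * cexp (Real.pi * I * τ * (m + 1 / 2) ^ 2 + 2 * Real.pi * I * (m + 1 / 2) * z)

lemma jacobiTerm_eq (τ : ℍ) (z : ℂ) (m : ℤ) : jacobiTerm τ z m =
    cexp (Real.pi * I * τ / 4 + Real.pi * I * z) *
      jacobiTheta₂_term m (z + 1 / 2 + τ / 2) τ := by
  have h : (-1 : ℂ) ^ m = cexp (m * (Real.pi * I)) := by
    rw [Complex.exp_int_mul, Complex.exp_pi_mul_I]
  rw [jacobiTerm, h, jacobiTheta₂_term, ← Complex.exp_add, ← Complex.exp_add]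
  congr 1
  ring

lemma summable_norm_jacobiTerm (τ : ℍ) (z : ℂ) : Summable fun m => ‖jacobiTerm τ z m‖ := by
  simp_rw [jacobiTerm_eq, norm_mul]
  exact ((summable_jacobiTheta₂_term_iff _ _).mpr τ.im_pos).norm.mul_left _

lemma jacobiTheta_eq_tsum (τ : ℍ) (z : ℂ) : jacobiTheta τ z = ∑' m, jacobiTerm τ z m := by
  have hinj : Function.Injective fun m : ℤ => 2 * m + 1 := fun m m' h => by
    simpa using h
  rw [jacobiTheta, ← hinj.tsum_eq]
  · refine tsum_congr fun m => ?_
    have h : ((ZMod.χ₄ ((2 * m + 1 : ℤ) : ZMod 4) : ℤ) : ℂ) = (-1) ^ m := by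
      rcases Int.even_or_odd m with hm | hm
      · rw [ZMod.χ₄_int_one_mod_four (by obtain ⟨c, rfl⟩ := hm; omega), hm.neg_one_zpow]
        simp
      · rw [ZMod.χ₄_int_three_mod_four (by obtain ⟨c, rfl⟩ := hm; omega), hm.neg_one_zpow]
        simp
    rw [h, jacobiTerm, mul_assoc, ← Complex.exp_add]
    congr 2
    push_cast
    ring
  · intro n hn
    rcases Int.even_or_odd n with hn' | ⟨c, hc⟩
    · exfalso
      apply hn
      beta_reduce
      rw [ZMod.χ₄_int_eq_if_mod_four, if_pos (Int.even_iff.mp hn')]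
      simp
    · exact ⟨c, hc.symm⟩

lemma jacobiTheta_eq_jacobiTheta₂ (τ : ℍ) (z : ℂ) : jacobiTheta τ z =
    cexp (Real.pi * I * τ / 4 + Real.pi * I * z) * jacobiTheta₂ (z + 1 / 2 + τ / 2) τ := by
  simp_rw [jacobiTheta_eq_tsum, jacobiTerm_eq, tsum_mul_left, jacobiTheta₂]

lemma jacobiTheta_T (τ : ℍ) (z : ℂ) : jacobiTheta (ModularGroup.T⁻¹ • τ) z =
    cexp (-(Real.pi * I / 4)) * jacobiTheta τ z := by
  rw [jacobiTheta_eq_tsum, jacobiTheta_eq_tsum, ← tsum_mul_left]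
  refine tsum_congr fun m => ?_
  rw [jacobiTerm, jacobiTerm, mul_left_comm, ← Complex.exp_add, coe_T_inv_smul]
  congr 1
  -- Since `(m + 1/2)² = m(m + 1) + 1/4` with `m(m + 1)` even, all terms acquire the same root of
  -- unity.
  obtain ⟨c, hc⟩ := Int.even_mul_succ_self m
  have hc' : (m : ℂ) * (m + 1) = c + c := by exact_mod_cast hc
  rw [Complex.exp_eq_exp_iff_exists_int]
  refine ⟨-c, ?_⟩
  push_cast
  linear_combination (-(Real.pi * I : ℂ)) * hc'

lemma jacobiTheta_S (τ : ℍ) (z : ℂ) : jacobiTheta (ModularGroup.S⁻¹ • τ) (-z / τ) =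
    I * (-I * τ) ^ (1 / 2 : ℂ) * cexp (Real.pi * I * z ^ 2 / τ) * jacobiTheta τ z := by
  have hτ : (τ : ℂ) ≠ 0 := τ.ne_zero
  have hs : (-I * (τ : ℂ)) ^ (1 / 2 : ℂ) ≠ 0 := by
    rw [Complex.cpow_ne_zero_iff_of_exponent_ne_zero (by norm_num)]
    exact mul_ne_zero (neg_ne_zero.mpr I_ne_zero) hτ
  -- `Z / τ` is the shifted argument of `jacobiTheta₂` on the left, and `-Z + τ` the one on the
  -- right. The functional equation, parity and quasi-periodicity therefore connect the two sides.
  set Z : ℂ := -z + τ / 2 - 1 / 2 with hZ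
  have h1 := jacobiTheta₂_functional_equation Z τ
  have h2 : jacobiTheta₂ (Z / τ) (-1 / τ) =
      (-I * τ) ^ (1 / 2 : ℂ) * cexp (Real.pi * I * Z ^ 2 / τ) * jacobiTheta₂ Z τ := by
    rw [h1]
    have : cexp (Real.pi * I * Z ^ 2 / τ) * cexp (-Real.pi * I * Z ^ 2 / τ) = 1 := by
      rw [← Complex.exp_add, ← Complex.exp_zero]
      congr 1
      ring
    have aux {s E₁ E₂ J : ℂ} (hs : s ≠ 0) (h : E₁ * E₂ = 1) : J = s * E₁ * (1 / s * E₂ * J) := by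
      have e : s * E₁ * (1 / s * E₂ * J) = (s * (1 / s)) * (E₁ * E₂) * J := by ring
      rw [e, h, mul_one_div_cancel hs, one_mul, one_mul]
    exact aux hs this
  have h3 : jacobiTheta₂ (z + 1 / 2 + τ / 2) τ = -cexp (-(2 * Real.pi * I * z)) *
      jacobiTheta₂ Z τ := by
    have : z + 1 / 2 + (τ : ℂ) / 2 = -Z + τ := by rw [hZ]; ring
    rw [this, jacobiTheta₂_add_left', jacobiTheta₂_neg_left, hZ, ← neg_one_mul (cexp _),
      ← Complex.exp_pi_mul_I, ← Complex.exp_add]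
    congr 1
    rw [Complex.exp_eq_exp_iff_exists_int]
    refine ⟨-1, ?_⟩
    push_cast
    ring
  rw [jacobiTheta_eq_jacobiTheta₂, jacobiTheta_eq_jacobiTheta₂, coe_S_inv_smul, h3]
  have h4 : -z / τ + 1 / 2 + -1 / (τ : ℂ) / 2 = Z / τ := by
    rw [hZ]
    field_simp
    ring
  rw [h4, h2]
  have h5 : cexp (-(Real.pi / 2 * I)) = -I := by
    rw [Complex.exp_neg, Complex.exp_pi_div_two_mul_I, Complex.inv_I]
  have h6 : cexp (Real.pi * I * (-1 / τ) / 4 + Real.pi * I * (-z / τ)) *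
      cexp (Real.pi * I * Z ^ 2 / τ) = cexp (-(Real.pi / 2 * I)) *
      cexp (Real.pi * I * z ^ 2 / τ) * cexp (Real.pi * I * τ / 4 + Real.pi * I * z) *
      cexp (-(2 * Real.pi * I * z)) := by
    simp only [← Complex.exp_add]
    congr 1
    rw [hZ]
    field_simp
    ring
  calc _ = (-I * (τ : ℂ)) ^ (1 / 2 : ℂ) * jacobiTheta₂ Z τ *
        (cexp (Real.pi * I * (-1 / τ) / 4 + Real.pi * I * (-z / τ)) *
          cexp (Real.pi * I * Z ^ 2 / τ)) := by ring
    _ = _ := by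
      rw [h6, h5]
      ring

lemma eta_T (τ : ℍ) : ModularForm.eta ((ModularGroup.T⁻¹ • τ : ℍ) : ℂ) =
    cexp (-(Real.pi * I / 12)) * ModularForm.eta (τ : ℂ) := by
  rw [coe_T_inv_smul, ModularForm.eta, ModularForm.eta, ← mul_assoc]
  congr 1
  · simp only [Function.Periodic.qParam]
    rw [← Complex.exp_add]
    congr 1
    push_cast
    ring
  · congr 1
    ext n
    rw [ModularForm.eta_q_eq_cexp, ModularForm.eta_q_eq_cexp]
    congr 1
    rw [Complex.exp_eq_exp_iff_exists_int]
    refine ⟨-(n + 1), ?_⟩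
    push_cast
    ring

lemma eta_S (τ : ℍ) : ModularForm.eta ((ModularGroup.S⁻¹ • τ : ℍ) : ℂ) =
    (-I * τ) ^ (1 / 2 : ℂ) * ModularForm.eta (τ : ℂ) := by
  have h := ModularForm.eta_comp_eq_csqrt_I_inv τ.im_pos
  simp only [Function.comp_apply, Pi.smul_apply, Pi.mul_apply, smul_eq_mul] at h
  have hτ : (τ : ℂ) ≠ 0 := τ.ne_zero
  rw [coe_S_inv_smul, h, ← mul_assoc]
  congr 1
  -- The branches agree because `0 < arg τ ≤ π` and `arg (-I) = -π/2`.
  have hlog : Complex.log (-I * τ) = Complex.log (-I) + Complex.log τ := by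
    rw [Complex.log_mul_eq_add_log_iff (neg_ne_zero.mpr I_ne_zero) hτ, Complex.arg_neg_I]
    have h1 : 0 < Complex.arg τ := by
      refine lt_of_le_of_ne (Complex.arg_nonneg_iff.mpr τ.im_pos.le) fun h => ?_
      rw [eq_comm, Complex.arg_eq_zero_iff] at h
      exact τ.im_pos.ne' h.2
    have h2 := Complex.arg_le_pi τ
    have := Real.pi_pos
    constructor <;> linarith
  rw [Complex.cpow_def_of_ne_zero (mul_ne_zero (neg_ne_zero.mpr I_ne_zero) hτ), hlog,
    sqrt_eq_exp I_ne_zero, sqrt_eq_exp hτ, ← Complex.exp_neg, ← Complex.exp_add,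
    Complex.log_I, Complex.log_neg_I]
  congr 1
  ring

end JacobiTheta

/-! ### Modularity of the theta block from `n + 2N = 24`. -/

section ThetaBlock

open Complex

variable {P F : Type*} [Fintype F] [Fintype P] {G : Matrix P F ℤ}

/-- The theta block in terms of real characteristics. -/
def charBlock (G : Matrix P F ℤ) (τ : ℍ) (x y : F → ℝ) : ℂ :=
  cexp (Real.pi * I * τ * (form G x x : ℝ) + Real.pi * I * (form G x y : ℝ)) *
    thetaBlock G τ (fun f => (τ : ℂ) * x f + y f)

omit [Fintype P] in
lemma lin_char (τ : ℂ) (x y : F → ℝ) (r : P) :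
    lin G r (fun f => τ * x f + y f) = τ * (lin G r x : ℝ) + (lin G r y : ℝ) := by
  have e1 : (fun f => τ * x f + y f) =
    τ • (fun f => (x f : ℂ)) + (fun f => (y f : ℂ)) := rfl
  rw [e1, lin_add, lin_smul, lin_ofReal, lin_ofReal]

/-- The theta block is invariant under `T` if the order at infinity is integral. -/
lemma charBlock_T (h24 : Fintype.card F + 2 * Fintype.card P = 24) :
    slashRep F k ModularGroup.T (charBlock G) = charBlock G := by
  ext τ x y
  rw [slashRep_T, charBlock, charBlock, thetaBlock, thetaBlock, eta_T, mul_zpow]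
  have h1 (r : P) : lin G r (fun f => ((ModularGroup.T⁻¹ • τ : ℍ) : ℂ) * x f +
      (((x + y) f : ℝ) : ℂ)) = lin G r (fun f => (τ : ℂ) * x f + y f) := by
    congr 1
    ext f
    rw [coe_T_inv_smul]
    simp
    ring
  simp_rw [h1, jacobiTheta_T]
  rw [Finset.prod_mul_distrib, Finset.prod_const, Finset.card_univ, ← Complex.exp_int_mul,
    ← Complex.exp_nat_mul, coe_T_inv_smul, form_add_right]
  have h24' : (Fintype.card F : ℂ) + 2 * Fintype.card P = 24 := by exact_mod_cast h24
  have h2 : cexp (Real.pi * I * (τ - 1) * (form G x x : ℝ) +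
      Real.pi * I * ((form G x x + form G x y : ℝ) : ℂ)) *
      (cexp (((Fintype.card F : ℤ) - (Fintype.card P : ℤ) : ℤ) * -(Real.pi * I / 12)) *
      cexp ((Fintype.card P : ℕ) * -(Real.pi * I / 4))) =
      cexp (Real.pi * I * τ * (form G x x : ℝ) + Real.pi * I * (form G x y : ℝ)) := by
    rw [← Complex.exp_add, ← Complex.exp_add, Complex.exp_eq_exp_iff_exists_int]
    -- The block has leading exponent `(n - N)/24 + N/8 = (n + 2N)/24 = 1`.
    refine ⟨-1, ?_⟩
    push_cast
    linear_combination (-(Real.pi * I / 12 : ℂ)) * h24'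
  rw [← h2]
  ring

/-- The theta block transforms under `S` like a function of weight `n / 2`. -/
lemma charBlock_S (h24 : Fintype.card F + 2 * Fintype.card P = 24) {k : ℕ}
    (hk : Fintype.card F = 2 * k) :
    slashRep F k ModularGroup.S (charBlock G) = charBlock G := by
  ext τ x y
  have hτ : (τ : ℂ) ≠ 0 := τ.ne_zero
  set s : ℂ := (-I * (τ : ℂ)) ^ (1 / 2 : ℂ) with hs
  have hs2 : s ^ 2 = -I * τ := by
    rw [hs, ← Complex.cpow_nat_mul]
    norm_num
  have hs0 : s ≠ 0 := by
    intro h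
    rw [h] at hs2
    have := mul_ne_zero (neg_ne_zero.mpr I_ne_zero) hτ
    simp at hs2
    exact hτ hs2
  rw [slashRep_S, charBlock, charBlock, thetaBlock, thetaBlock, eta_S, mul_zpow]
  have h1 (r : P) : jacobiTheta (ModularGroup.S⁻¹ • τ) (lin G r
      (fun f => ((ModularGroup.S⁻¹ • τ : ℍ) : ℂ) * y f + (((-x) f : ℝ) : ℂ))) =
      I * s * cexp (Real.pi * I * (τ * (lin G r x : ℝ) + (lin G r y : ℝ)) ^ 2 / τ) *
      jacobiTheta τ (lin G r (fun f => (τ : ℂ) * x f + y f)) := by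
    rw [← lin_char, ← jacobiTheta_S]
    congr 1
    rw [lin_char, lin_char, coe_S_inv_smul, lin_neg]
    push_cast
    field_simp
    ring
  simp_rw [h1]
  rw [Finset.prod_mul_distrib, Finset.prod_mul_distrib, Finset.prod_const, Finset.card_univ,
    ← Complex.exp_sum, coe_S_inv_smul]
  have h2 : ∑ r, Real.pi * I * (τ * (lin G r x : ℝ) + (lin G r y : ℝ)) ^ 2 / (τ : ℂ) =
      Real.pi * I * τ * (form G x x : ℝ) + 2 * Real.pi * I * (form G x y : ℝ) +
      Real.pi * I / τ * (form G y y : ℝ) := by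
    simp only [form, Complex.ofReal_sum, Finset.mul_sum, ← Finset.sum_add_distrib]
    refine Finset.sum_congr rfl fun r _ => ?_
    push_cast
    field_simp
    ring
  have h3 : cexp (Real.pi * I * (-1 / τ) * (form G y y : ℝ) +
      Real.pi * I * (form G y (-x) : ℝ)) *
      cexp (∑ r, Real.pi * I * (τ * (lin G r x : ℝ) + (lin G r y : ℝ)) ^ 2 / (τ : ℂ)) =
      cexp (Real.pi * I * τ * (form G x x : ℝ) + Real.pi * I * (form G x y : ℝ)) := by
    rw [← Complex.exp_add, h2, form_neg_right, form_comm G y x]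
    congr 1
    push_cast
    ring
  -- The powers of `s` combine to `s^n = (-Iτ)^k`, and `N = 12 - k` turns `I^N` into `I^(-k)`. All
  -- roots of unity cancel.
  have h4 : (-(τ : ℂ)) ^ (-(k : ℤ)) * (s ^ ((Fintype.card F : ℤ) - (Fintype.card P : ℤ)) *
      (I * s) ^ Fintype.card P) = 1 := by
    rw [mul_pow, zpow_sub₀ hs0, zpow_natCast, zpow_natCast, zpow_neg, zpow_natCast, hk, pow_mul,
      hs2]
    have hN : Fintype.card P = 12 - k := by omega
    have hk12 : k ≤ 12 := by omega
    have hI : (-I) ^ k * I ^ Fintype.card P = (-1) ^ k := by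
      have e1 : I ^ Fintype.card P * I ^ k = 1 := by
        rw [← pow_add, hN, Nat.sub_add_cancel hk12]
        have : (12 : ℕ) = 4 * 3 := rfl
        rw [this, pow_mul, I_pow_four, one_pow]
      have e2 : (-I) ^ k = (-1) ^ k * I ^ k := by rw [← mul_pow]; simp
      rw [e2, mul_assoc, mul_comm (I ^ k), e1, mul_one]
    have e3 : (-(τ : ℂ)) ^ k = (-1) ^ k * τ ^ k := by rw [← mul_pow]; simp
    have hτk : (τ : ℂ) ^ k ≠ 0 := pow_ne_zero _ hτ
    have hsN : s ^ Fintype.card P ≠ 0 := pow_ne_zero _ hs0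
    have h1k : (-1 : ℂ) ^ k ≠ 0 := pow_ne_zero _ (by norm_num)
    rw [e3, mul_pow]
    field_simp
    exact hI
  calc _ = ((-(τ : ℂ)) ^ (-(k : ℤ)) * (s ^ ((Fintype.card F : ℤ) - (Fintype.card P : ℤ)) *
      (I * s) ^ Fintype.card P)) * (cexp (Real.pi * I * (-1 / τ) * (form G y y : ℝ) +
      Real.pi * I * (form G y (-x) : ℝ)) *
      cexp (∑ r, Real.pi * I * (τ * (lin G r x : ℝ) + (lin G r y : ℝ)) ^ 2 / (τ : ℂ))) *
      (ModularForm.eta (τ : ℂ) ^ ((Fintype.card F : ℤ) - (Fintype.card P : ℤ)) *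
      ∏ r, jacobiTheta τ (lin G r (fun f => (τ : ℂ) * x f + y f))) := by ring
    _ = _ := by rw [h3, h4, one_mul]

end ThetaBlock

end RootTheta

end

noncomputable section

namespace RootTheta

open UpperHalfPlane hiding I
open MatrixGroups Manifold

/-! ### Expansion of the product of theta functions along the projection `ℚ^P → ℚ ⊗ L`. -/

section BlockExpansion

open Complex

variable {P F : Type*} [Fintype F] [Fintype P] {G : Matrix P F ℤ} [DecidableEq F]

lemma HasUnitRows.ext_form (hG : HasUnitRows G) {l l' : F → ℚ}
    (h : ∀ x, form G l x = form G l' x) : l = l' := by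
  have h1 : l - l' = 0 := hG.eq_zero_of_form (by
    rw [form_sub_left, h, sub_self])
  exact sub_eq_zero.mp h1

lemma HasUnitRows.exists_proj (hG : HasUnitRows G) (w : P → ℚ) :
    ∃ l : F → ℚ, ∀ x : F → ℚ, form G l x = ∑ r, w r * lin G r x := by
  let φ : Module.Dual ℚ (F → ℚ) :=
    { toFun := fun x => ∑ r, w r * lin G r x
      map_add' := fun x y => by simp [lin_add, mul_add, Finset.sum_add_distrib]
      map_smul' := fun c x => by
        simp [lin_smul, Finset.mul_sum, mul_left_comm] }
  refine ⟨((formBilin G ℚ).toDual hG.nondegenerate).symm φ, fun x => ?_⟩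
  exact LinearMap.congr_fun (((formBilin G ℚ).toDual hG.nondegenerate).apply_symm_apply φ) x

/-- The orthogonal projection `ℚ^P → ℚ ⊗ L`. -/
def HasUnitRows.proj (hG : HasUnitRows G) (w : P → ℚ) : F → ℚ := (hG.exists_proj w).choose

lemma HasUnitRows.form_proj (hG : HasUnitRows G) (w : P → ℚ) (x : F → ℚ) :
    form G (hG.proj w) x = ∑ r, w r * lin G r x := (hG.exists_proj w).choose_spec x

lemma HasUnitRows.proj_eq_iff (hG : HasUnitRows G) {w : P → ℚ} {l : F → ℚ} :
    hG.proj w = l ↔ ∀ x, ∑ r, w r * lin G r x = form G l x := by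
  constructor
  · rintro rfl x
    rw [hG.form_proj]
  · intro h
    exact hG.ext_form fun x => by rw [hG.form_proj, h]

lemma HasUnitRows.form_proj_complex (hG : HasUnitRows G) (w : P → ℚ) (z : F → ℂ) :
    form G (fun f => (hG.proj w f : ℂ)) z = ∑ r, (w r : ℂ) * lin G r z := by
  have h1 : z = ∑ f, z f • (fun f' => ((Pi.single f 1 : F → ℚ) f' : ℂ)) := by
    ext f
    rw [Finset.sum_apply, Finset.sum_eq_single f]
    · simp
    · intro f' _ hf'
      simp [hf'.symm]
    · simp
  conv_lhs => rw [h1]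
  conv_rhs => rw [h1]
  rw [form_sum_right]
  simp_rw [form_smul_right, form_ratCast, hG.form_proj]
  have h2 (r : P) : lin G r (∑ f, z f • (fun f' => ((Pi.single f 1 : F → ℚ) f' : ℂ))) =
      ∑ f, z f * ((lin G r (Pi.single f 1 : F → ℚ) : ℚ) : ℂ) := by
    have : lin G r (∑ f, z f • (fun f' => ((Pi.single f 1 : F → ℚ) f' : ℂ))) =
        ∑ f, lin G r (z f • (fun f' => ((Pi.single f 1 : F → ℚ) f' : ℂ))) := by
      simp only [lin, Finset.sum_apply, Finset.mul_sum]
      exact Finset.sum_comm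
    rw [this]
    simp_rw [lin_smul, lin_ratCast]
  simp_rw [h2, Finset.mul_sum]
  rw [Finset.sum_comm]
  refine Finset.sum_congr rfl fun r _ => ?_
  push_cast
  rw [Finset.mul_sum]
  refine Finset.sum_congr rfl fun f _ => ?_
  ring

/-- The vector in `ℚ^P` with coordinates `k_r + 1/2`. -/
def halfShift (k : P → ℤ) : P → ℚ := fun r => k r + 1 / 2

omit [DecidableEq F] in
-- Squares are congruent to their roots modulo `2`. This is why `L_ev` is the right lattice: half
-- the sum of the positive roots is integral on it.
lemma sum_lin_even {y : F → ℤ} (hy : Even (form G y y)) : Even (∑ r, lin G r y) := by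
  have h : Even (∑ r, (lin G r y * lin G r y - lin G r y)) := by
    refine Finset.even_sum _ fun r _ => ?_
    have := Int.even_mul_pred_self (lin G r y)
    rwa [mul_sub, mul_one] at this
  rw [Finset.sum_sub_distrib] at h
  have h2 : Even (∑ r, lin G r y * lin G r y) := hy
  exact (Int.even_sub.mp h).mp h2

lemma HasUnitRows.proj_halfShift_mem (hG : HasUnitRows G) (k : P → ℤ) :
    hG.proj (halfShift k) ∈ dualLattice G := by
  rintro _ ⟨y, rfl, hy⟩
  obtain ⟨c, hc⟩ := sum_lin_even hy
  refine ⟨∑ r, k r * lin G r y + c, ?_⟩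
  rw [hG.form_proj]
  have hc' : (∑ r, ((lin G r y : ℤ) : ℚ)) = c + c := by exact_mod_cast hc
  simp only [halfShift, lin_intCast, add_mul, Finset.sum_add_distrib, ← Finset.mul_sum, hc']
  push_cast
  ring

/-- The vector of `L_ev^∨` that belongs to a term in the expansion of the product of theta
functions. -/
def HasUnitRows.blockVec (hG : HasUnitRows G) (k : P → ℤ) : dualLattice G :=
  ⟨hG.proj (halfShift k), hG.proj_halfShift_mem k⟩

/-- The sign of a term in the expansion of the product of theta functions. -/
def blockSign (k : P → ℤ) : ℂ := ∏ r, (-1) ^ k r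

/-- The squared norm of the component of `k + 1/2` orthogonal to `L`. -/
def HasUnitRows.excess (hG : HasUnitRows G) (k : P → ℤ) : ℚ :=
  ∑ r, halfShift k r ^ 2 - form G (hG.blockVec k : F → ℚ) (hG.blockVec k : F → ℚ)

/-- Pythagoras for the decomposition of `k + 1/2` along the image of `L`. -/
lemma HasUnitRows.excess_eq (hG : HasUnitRows G) (k : P → ℤ) :
    hG.excess k = ∑ r, (halfShift k r - lin G r (hG.blockVec k : F → ℚ)) ^ 2 := by
  have h := hG.form_proj (halfShift k) (hG.blockVec k : F → ℚ)
  change form G (hG.blockVec k : F → ℚ) (hG.blockVec k : F → ℚ) = _ at h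
  have h2 : ∑ r, (halfShift k r - lin G r (hG.blockVec k : F → ℚ)) ^ 2 =
      ∑ r, halfShift k r ^ 2 - 2 * ∑ r, halfShift k r * lin G r (hG.blockVec k : F → ℚ) +
        form G (hG.blockVec k : F → ℚ) (hG.blockVec k : F → ℚ) := by
    rw [form, Finset.mul_sum, ← Finset.sum_sub_distrib, ← Finset.sum_add_distrib]
    refine Finset.sum_congr rfl fun r _ => ?_
    ring
  rw [h2, ← h, HasUnitRows.excess]
  ring

lemma HasUnitRows.excess_nonneg (hG : HasUnitRows G) (k : P → ℤ) : 0 ≤ hG.excess k := by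
  rw [hG.excess_eq]
  exact Finset.sum_nonneg fun r _ => sq_nonneg _

/-- The terms of `Θ_γ`. -/
def thetaTerm (G : Matrix P F ℤ) (τ : ℍ) (z : F → ℂ) (l : F → ℚ) : ℂ :=
  cexp (2 * Real.pi * I * ((form G l l / 2 : ℚ) : ℂ) * (τ : ℂ)) *
    cexp (2 * Real.pi * I * form G (fun f => (l f : ℂ)) z)

/-- The part orthogonal to `L` of a term in the expansion of the product of theta functions. -/
def HasUnitRows.blockTerm (hG : HasUnitRows G) (τ : ℍ) (k : P → ℤ) : ℂ :=
  blockSign k * cexp (Real.pi * I * (hG.excess k : ℂ) * τ)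

/-- The exponent in `z` sees only the projection to `ℚ ⊗ L`, and the norm in the exponent of `q`
splits orthogonally. -/
lemma HasUnitRows.prod_jacobiTerm (hG : HasUnitRows G) (τ : ℍ) (z : F → ℂ) (k : P → ℤ) :
    ∏ r, jacobiTerm τ (lin G r z) (k r) =
      hG.blockTerm τ k * thetaTerm G τ z (hG.blockVec k : F → ℚ) := by
  simp only [jacobiTerm]
  rw [Finset.prod_mul_distrib, ← Complex.exp_sum, HasUnitRows.blockTerm, thetaTerm,
    mul_assoc (blockSign k), ← Complex.exp_add, ← Complex.exp_add]
  have h := hG.form_proj_complex (halfShift k) z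
  change form G (fun f => ((hG.blockVec k : F → ℚ) f : ℂ)) z = _ at h
  rw [h, HasUnitRows.excess]
  congr 2
  push_cast
  simp only [halfShift]
  rw [Finset.sum_add_distrib, Finset.mul_sum]
  have e1 : ∑ r, Real.pi * I * (τ : ℂ) * ((k r : ℂ) + 1 / 2) ^ 2 =
      Real.pi * I * τ * ∑ r, ((k r : ℂ) + 1 / 2) ^ 2 := by rw [Finset.mul_sum]
  rw [e1]
  push_cast
  have e2 : ∑ r, 2 * Real.pi * I * ((k r : ℂ) + 1 / 2) * lin G r z =
      ∑ r, 2 * Real.pi * I * (((k r : ℂ) + 1 / 2) * lin G r z) :=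
    Finset.sum_congr rfl fun r _ => by ring
  rw [e2]
  ring

lemma HasUnitRows.summable_block (hG : HasUnitRows G) (τ : ℍ) (z : F → ℂ) :
    Summable fun k : P → ℤ =>
      ‖hG.blockTerm τ k * thetaTerm G τ z (hG.blockVec k : F → ℚ)‖ := by
  simp_rw [← hG.prod_jacobiTerm]
  exact (summable_norm_prod_and_hasSum (fun r => jacobiTerm τ (lin G r z))
    fun r => summable_norm_jacobiTerm τ _).1

lemma HasUnitRows.prod_jacobiTheta (hG : HasUnitRows G) (τ : ℍ) (z : F → ℂ) :
    ∏ r, jacobiTheta τ (lin G r z) =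
      ∑' k : P → ℤ, hG.blockTerm τ k * thetaTerm G τ z (hG.blockVec k : F → ℚ) := by
  simp_rw [← hG.prod_jacobiTerm, jacobiTheta_eq_tsum]
  exact (summable_norm_prod_and_hasSum (fun r => jacobiTerm τ (lin G r z))
    fun r => summable_norm_jacobiTerm τ _).2.tsum_eq.symm

omit [Fintype P] [DecidableEq F] in
lemma thetaTerm_ne_zero [Fintype P] (τ : ℍ) (z : F → ℂ) (l : F → ℚ) : thetaTerm G τ z l ≠ 0 :=
  mul_ne_zero (Complex.exp_ne_zero _) (Complex.exp_ne_zero _)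

/-- The coefficient of `q^{(l,l)/2} ζ^l` in the product of theta functions. -/
def HasUnitRows.blockCoeff (hG : HasUnitRows G) (l : dualLattice G) (τ : ℍ) : ℂ :=
  ∑' k : {k : P → ℤ // hG.blockVec k = l}, hG.blockTerm τ k

/-- On the fibre over `l` the factor `thetaTerm` is a nonzero constant, so it can be divided out of
the full convergent sum at `z = 0`. -/
lemma HasUnitRows.summable_blockTerm (hG : HasUnitRows G) (l : dualLattice G) (τ : ℍ) :
    Summable fun k : {k : P → ℤ // hG.blockVec k = l} => ‖hG.blockTerm τ k‖ := by
  have h := (hG.summable_block τ 0).comp_injective (i := fun k : {k : P → ℤ // hG.blockVec k = l} =>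
    (k : P → ℤ)) Subtype.val_injective
  have h2 := h.mul_right ‖thetaTerm G τ 0 (l : F → ℚ)‖⁻¹
  refine h2.congr fun k => ?_
  rw [Function.comp_apply, k.2, norm_mul, mul_inv_cancel_right₀]
  exact norm_ne_zero_iff.mpr (thetaTerm_ne_zero _ _ _)

lemma HasUnitRows.hasSum_blockCoeff (hG : HasUnitRows G) (τ : ℍ) (z : F → ℂ) :
    Summable (fun l : dualLattice G => hG.blockCoeff l τ * thetaTerm G τ z (l : F → ℚ)) ∧
    ∏ r, jacobiTheta τ (lin G r z) =
      ∑' l : dualLattice G, hG.blockCoeff l τ * thetaTerm G τ z (l : F → ℚ) := by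
  let E := Equiv.sigmaFiberEquiv hG.blockVec
  have hs := E.summable_iff.mpr (hG.summable_block τ z).of_norm
  have key (l : dualLattice G) : ∑' k : {k : P → ℤ // hG.blockVec k = l},
      ((fun k : P → ℤ => hG.blockTerm τ k * thetaTerm G τ z (hG.blockVec k : F → ℚ)) ∘ E) ⟨l, k⟩ =
      hG.blockCoeff l τ * thetaTerm G τ z (l : F → ℚ) := by
    rw [HasUnitRows.blockCoeff, ← tsum_mul_right]
    refine tsum_congr fun k => ?_
    have : E ⟨l, k⟩ = (k : P → ℤ) := rfl
    rw [Function.comp_apply, this, k.2]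
  constructor
  · refine hs.sigma.congr fun l => key l
  · rw [hG.prod_jacobiTheta, ← E.tsum_eq]
    refine hs.tsum_sigma.trans ?_
    exact tsum_congr fun l => key l

/-- A linear map that permutes the linear forms given by the rows of `G` up to signs whose product
is `σ`. -/
def IsSignedSymmetry (G : Matrix P F ℤ) (t : (F → ℚ) → (F → ℚ)) (σ : ℤ) : Prop :=
  Function.Surjective t ∧ ∃ (π : Equiv.Perm P) (s : P → ℤ), (∀ r, s r = 1 ∨ s r = -1) ∧
    (∀ r x, lin G r (t x) = s r * lin G (π r) x) ∧ ∏ r, s r = σ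

omit [DecidableEq F] in
lemma IsSignedSymmetry.form_eq {t : (F → ℚ) → (F → ℚ)} {σ : ℤ} (ht : IsSignedSymmetry G t σ)
    (x y : F → ℚ) : form G (t x) (t y) = form G x y := by
  obtain ⟨-, π, s, hs, h, -⟩ := ht
  rw [form, form, ← Equiv.sum_comp π (fun r => lin G r x * lin G r y)]
  refine Finset.sum_congr rfl fun r _ => ?_
  rw [h, h]
  rcases hs r with h1 | h1 <;> simp [h1]

/-- The symmetry permutes the factors `ϑ` and changes the sign of some arguments; each change costs
`-1` because `ϑ` is odd. On indices the sign change is `m ↦ -1 - m`, which negates `m + 1/2`. -/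
lemma HasUnitRows.blockCoeff_symmetry (hG : HasUnitRows G) {t : (F → ℚ) → (F → ℚ)} {σ : ℤ}
    (ht : IsSignedSymmetry G t σ) {l l' : dualLattice G} (hl : (l' : F → ℚ) = t l) (τ : ℍ) :
    hG.blockCoeff l' τ = σ * hG.blockCoeff l τ := by
  have hform := ht.form_eq
  obtain ⟨hsurj, π, s, hs, h, hσ⟩ := ht
  -- the permutation of `ℤ^P` induced by `t`
  let sgn (r : P) : Equiv.Perm ℤ := if s r = 1 then Equiv.refl ℤ else Equiv.subLeft (-1)
  have hsgn (r : P) (m : ℤ) : ((sgn r m : ℤ) : ℚ) + 1 / 2 = s r * (m + 1 / 2) := by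
    rcases hs r with h1 | h1
    · simp [sgn, h1]
    · simp [sgn, h1]
      ring
  have hsgn' (r : P) (m : ℤ) : (-1 : ℂ) ^ (sgn r m) = s r * (-1) ^ m := by
    rcases hs r with h1 | h1
    · simp [sgn, h1]
    · simp only [sgn, h1]
      norm_num
      rw [zpow_sub₀ (by norm_num), zpow_neg, zpow_one]
      rcases Int.even_or_odd m with hm | hm <;> simp [hm.neg_one_zpow]
  let E : Equiv.Perm (P → ℤ) := (Equiv.arrowCongr π.symm (Equiv.refl ℤ)).trans (Equiv.piCongrRight sgn)
  have hE (k : P → ℤ) (r : P) : E k r = sgn r (k (π r)) := rfl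
  have hshift (k : P → ℤ) (r : P) : halfShift (E k) r = s r * halfShift k (π r) := by
    rw [halfShift, hE, hsgn, halfShift]
  have hvec (k : P → ℤ) : (hG.blockVec (E k) : F → ℚ) = t (hG.blockVec k) := by
    refine hG.proj_eq_iff.mpr fun x => ?_
    obtain ⟨y, rfl⟩ := hsurj x
    rw [hform]
    refine Eq.trans ?_ (hG.form_proj (halfShift k) y).symm
    rw [← Equiv.sum_comp π (fun r => halfShift k r * lin G r y)]
    refine Finset.sum_congr rfl fun r _ => ?_
    rw [hshift, h]
    rcases hs r with h1 | h1 <;> simp [h1]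
  have hinj : Function.Injective t := by
    intro x y hxy
    refine hG.ext_form fun w => ?_
    rw [← hform x, hxy, hform]
  have hterm (k : P → ℤ) : hG.blockTerm τ (E k) = σ * hG.blockTerm τ k := by
    have e1 : hG.excess (E k) = hG.excess k := by
      rw [HasUnitRows.excess, HasUnitRows.excess, hvec, hform,
        ← Equiv.sum_comp π (fun r => halfShift k r ^ 2)]
      congr 1
      refine Finset.sum_congr rfl fun r _ => ?_
      rw [hshift]
      rcases hs r with h1 | h1 <;> simp [h1]
    have e2 : blockSign (E k) = σ * blockSign k := by
      rw [blockSign, blockSign, ← Equiv.prod_comp π (fun r => (-1 : ℂ) ^ k r), ← hσ]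
      push_cast
      rw [← Finset.prod_mul_distrib]
      exact Finset.prod_congr rfl fun r _ => by rw [hE, hsgn']
    rw [HasUnitRows.blockTerm, HasUnitRows.blockTerm, e1, e2, mul_assoc]
  let E' : {k : P → ℤ // hG.blockVec k = l} ≃ {k : P → ℤ // hG.blockVec k = l'} :=
    E.subtypeEquiv fun k => by
      rw [Subtype.ext_iff, Subtype.ext_iff, hvec, hl]
      exact hinj.eq_iff.symm
  rw [HasUnitRows.blockCoeff, HasUnitRows.blockCoeff, ← E'.tsum_eq, ← tsum_mul_left]
  exact tsum_congr fun k => hterm k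

/-- Translating `k` by the image of `y ∈ L_ev` moves only the component along `L`. The sign changes
by `(-1)` to the power `∑_r lin G r y`, which is even. -/
lemma HasUnitRows.blockCoeff_add (hG : HasUnitRows G) {l l' : dualLattice G}
    (hl : (l' : F → ℚ) - l ∈ evenLattice G) (τ : ℍ) :
    hG.blockCoeff l' τ = hG.blockCoeff l τ := by
  obtain ⟨y, hy, hey⟩ := hl
  have hl' : (l' : F → ℚ) = l + fun f => (y f : ℚ) := by rw [← hy]; abel
  let E : Equiv.Perm (P → ℤ) := Equiv.addRight fun r => lin G r y
  have hshift (k : P → ℤ) (r : P) :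
      halfShift (E k) r = halfShift k r + lin G r (fun f => (y f : ℚ)) := by
    rw [halfShift, halfShift, lin_intCast]
    simp [E]
    ring
  have hvec (k : P → ℤ) : (hG.blockVec (E k) : F → ℚ) = hG.blockVec k + fun f => (y f : ℚ) := by
    refine hG.proj_eq_iff.mpr fun x => ?_
    have h1 : form G (hG.blockVec k : F → ℚ) x = _ := hG.form_proj (halfShift k) x
    rw [form_add_left, h1]
    simp_rw [hshift, add_mul, Finset.sum_add_distrib]
    rfl
  have hterm (k : P → ℤ) : hG.blockTerm τ (E k) = hG.blockTerm τ k := by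
    have e1 : hG.excess (E k) = hG.excess k := by
      rw [hG.excess_eq, hG.excess_eq]
      refine Finset.sum_congr rfl fun r _ => ?_
      rw [hshift, hvec, lin_add]
      ring
    have e2 : blockSign (E k) = blockSign k := by
      have h1 : blockSign (E k) = blockSign k * ∏ r, (-1 : ℂ) ^ (lin G r y) := by
        rw [blockSign, blockSign, ← Finset.prod_mul_distrib]
        refine Finset.prod_congr rfl fun r _ => ?_
        rw [← zpow_add₀ (by norm_num)]
        rfl
      have h2 : ∏ r, (-1 : ℂ) ^ (lin G r y) = (-1) ^ (∑ r, lin G r y) := by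
        induction (Finset.univ : Finset P) using Finset.cons_induction with
        | empty => simp
        | cons a s ha ih => rw [Finset.prod_cons, Finset.sum_cons, ih, zpow_add₀ (by norm_num)]
      rw [h1, h2, (sum_lin_even hey).neg_one_zpow, mul_one]
    rw [HasUnitRows.blockTerm, HasUnitRows.blockTerm, e1, e2]
  let E' : {k : P → ℤ // hG.blockVec k = l} ≃ {k : P → ℤ // hG.blockVec k = l'} :=
    E.subtypeEquiv fun k => by
      rw [Subtype.ext_iff, Subtype.ext_iff, hvec, hl']
      exact add_left_inj _ |>.symm
  rw [HasUnitRows.blockCoeff, HasUnitRows.blockCoeff, ← E'.tsum_eq]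
  exact tsum_congr fun k => hterm k

/-- Every projected vector pairs with `y` to `∑ (k_r + 1/2) lin G r y`, so otherwise the fibre over
`l` is empty. -/
lemma HasUnitRows.blockCoeff_eq_zero (hG : HasUnitRows G) {l : dualLattice G}
    (hl : ¬ ∀ y : F → ℤ, ∃ m : ℤ, form G (l : F → ℚ) (fun f => (y f : ℚ)) =
      m + (∑ r, lin G r y : ℤ) / 2) (τ : ℍ) :
    hG.blockCoeff l τ = 0 := by
  have : IsEmpty {k : P → ℤ // hG.blockVec k = l} := by
    refine ⟨fun ⟨k, hk⟩ => hl fun y => ⟨∑ r, k r * lin G r y, ?_⟩⟩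
    rw [← hk]
    refine (hG.form_proj (halfShift k) _).trans ?_
    simp only [halfShift, lin_intCast, add_mul, Finset.sum_add_distrib, ← Finset.mul_sum]
    push_cast
    ring
  rw [HasUnitRows.blockCoeff, tsum_empty]

end BlockExpansion

end RootTheta

end

noncomputable section

namespace RootTheta

open UpperHalfPlane hiding I
open MatrixGroups Manifold

/-! ### Invariant functions of level one and the growth of `η`. -/

section LevelOne

/-- A bounded holomorphic function that is invariant under the modular group is constant. -/
lemma exists_const_of_invariant {c : ℍ → ℂ} (hol : MDifferentiable 𝓘(ℂ) 𝓘(ℂ) c)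
    (hb : IsBoundedAtImInfty c) (hS : ∀ τ, c (ModularGroup.S • τ) = c τ)
    (hT : ∀ τ, c (ModularGroup.T • τ) = c τ) : ∃ a, ∀ τ, c τ = a := by
  have h : ∀ A : SL(2, ℤ), SlashAction.map (0 : ℤ) A c = c := by
    apply SlashInvariantForm.slash_action_generators_SL2Z
    · ext τ
      rw [ModularForm.SL_slash_apply, hS]
      simp
    · ext τ
      rw [ModularForm.SL_slash_apply, hT]
      simp
  let f : ModularForm (Matrix.SpecialLinearGroup.mapGL ℝ (R := ℤ) (n := Fin 2)).range 0 :=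
    { toFun := c
      slash_action_eq' := by
        rintro _ ⟨A, rfl⟩
        exact h A
      holo' := hol
      bdd_at_cusps' := by
        intro s hs
        rw [Subgroup.IsArithmetic.isCusp_iff_isCusp_SL2Z] at hs
        rw [OnePoint.isBoundedAt_iff_forall_SL2Z hs]
        intro A _
        rw [h]
        exact hb }
  obtain ⟨a, ha⟩ := ModularFormClass.levelOne_weight_zero_const f
  exact ⟨a, fun τ => congrFun ha τ⟩

open Complex Filter Topology in
/-- The powers of `η` grow like those of `q^{1/24}`. -/
lemma exists_norm_eta_zpow_le (m : ℤ) : ∃ M A : ℝ, ∀ τ : ℍ, A ≤ τ.im →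
    ‖ModularForm.eta (τ : ℂ) ^ m‖ ≤ M * Real.exp (-(Real.pi * τ.im * m / 12)) := by
  have h := ModularForm.tendsto_atImInfty_tprod_one_sub_eta_q_pow.norm.eventually
    (Metric.ball_mem_nhds _ (by norm_num : (0 : ℝ) < 1 / 2))
  obtain ⟨A, hA⟩ := (atImInfty_mem _).mp h
  refine ⟨2 ^ m.natAbs, A, fun τ hτ => ?_⟩
  have h1 : ‖∏' n, (1 - ModularForm.eta_q n τ) ^ 24‖ ∈ Metric.ball ‖(1 : ℂ)‖ (1 / 2) := hA τ hτ
  rw [(ModularForm.multipliableLocallyUniformlyOn_eta.multipliable τ.2).tprod_pow, norm_pow,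
    Metric.mem_ball, Real.dist_eq, norm_one, abs_lt] at h1
  set p : ℂ := ∏' n, (1 - ModularForm.eta_q n τ) with hp
  have hp0 : 0 ≤ ‖p‖ := norm_nonneg _
  -- Near the cusp `‖p‖^24` lies within `1/2` of `1`. The crude bounds `1/2` and `2` for `‖p‖` then
  -- control powers of either sign.
  have hlow : 1 / 2 ≤ ‖p‖ := by
    by_contra! hlt
    have : ‖p‖ ^ 24 ≤ ‖p‖ ^ 1 := pow_le_pow_of_le_one hp0 (by linarith) (by norm_num)
    rw [pow_one] at this
    linarith [h1.1]
  have hup : ‖p‖ ≤ 2 := by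
    by_contra! hlt
    have : ‖p‖ ^ 1 ≤ ‖p‖ ^ 24 := pow_le_pow_right₀ (by linarith) (by norm_num)
    rw [pow_one] at this
    linarith [h1.2]
  have hpm : ‖p‖ ^ m ≤ 2 ^ m.natAbs := by
    rcases Int.natAbs_eq m with hm | hm
    · conv_lhs => rw [hm]
      rw [zpow_natCast]
      exact pow_le_pow_left₀ hp0 hup _
    · conv_lhs => rw [hm]
      rw [zpow_neg, zpow_natCast, ← inv_pow]
      refine pow_le_pow_left₀ (by positivity) ?_ _
      rw [inv_le_comm₀ (by linarith) (by norm_num)]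
      linarith
  have hq : ‖Function.Periodic.qParam 24 (τ : ℂ)‖ ^ m = Real.exp (-(Real.pi * τ.im * m / 12)) := by
    rw [Function.Periodic.norm_qParam, ← Real.rpow_intCast, ← Real.exp_mul]
    congr 1
    rw [coe_im]
    ring
  rw [norm_zpow, ModularForm.eta, norm_mul, mul_zpow, hq, mul_comm]
  exact mul_le_mul_of_nonneg_right hpm (Real.exp_pos _).le

end LevelOne

/-! ### Holomorphy and growth of the components of `θ_R`. -/

section ThetaComponents

open Complex

variable {P F : Type*} [Fintype F] [Fintype P] {G : Matrix P F ℤ} [DecidableEq F]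

lemma HasUnitRows.norm_blockTerm (hG : HasUnitRows G) (τ : ℍ) (k : P → ℤ) :
    ‖hG.blockTerm τ k‖ = Real.exp (-(Real.pi * τ.im * hG.excess k)) := by
  rw [HasUnitRows.blockTerm, norm_mul, blockSign, norm_prod, Complex.norm_exp]
  simp
  ring

/-- The component of `θ_R` at the class of `l`. -/
def HasUnitRows.component (hG : HasUnitRows G) (l : dualLattice G) (τ : ℍ) : ℂ :=
  ModularForm.eta (τ : ℂ) ^ ((Fintype.card F : ℤ) - (Fintype.card P : ℤ)) * hG.blockCoeff l τ

/-- As the excess is nonnegative, the norms of the terms decrease with `Im τ`. The series at half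
the imaginary part therefore dominates near a given point, and `η` has no zeros. -/
lemma HasUnitRows.mdifferentiable_component (hG : HasUnitRows G) (l : dualLattice G) :
    MDifferentiable 𝓘(ℂ) 𝓘(ℂ) (hG.component l) := by
  rw [UpperHalfPlane.mdifferentiable_iff]
  let g (k : P → ℤ) (z : ℂ) : ℂ := blockSign k * cexp (Real.pi * I * (hG.excess k : ℂ) * z)
  have hB : DifferentiableOn ℂ
      (fun z => ∑' k : {k : P → ℤ // hG.blockVec k = l}, g k z) {z | 0 < z.im} := by
    intro z hz
    have hz' : 0 < z.im := hz
    let τ₀ : ℍ := ⟨(z.im / 2 : ℝ) * I, by simpa using hz'⟩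
    have him : τ₀.im = z.im / 2 := by simp [τ₀, UpperHalfPlane.im]
    have hopen : IsOpen {w : ℂ | z.im / 2 < w.im} := isOpen_lt continuous_const continuous_im
    have h1 : DifferentiableOn ℂ (fun z => ∑' k : {k : P → ℤ // hG.blockVec k = l}, g k z)
        {w : ℂ | z.im / 2 < w.im} := by
      refine differentiableOn_tsum_of_summable_norm (hG.summable_blockTerm l τ₀)
        (fun k => ?_) hopen fun k w hw => ?_
      · exact DifferentiableOn.const_mul (by fun_prop) _
      · have hw' : z.im / 2 < w.im := hw
        have h2 := hG.norm_blockTerm ⟨w, by linarith⟩ k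
        change ‖g k w‖ = _ at h2
        rw [h2, hG.norm_blockTerm, Real.exp_le_exp, neg_le_neg_iff, him]
        have h3 : (0 : ℝ) ≤ hG.excess k := by exact_mod_cast hG.excess_nonneg k
        have h4 : (⟨w, by linarith⟩ : ℍ).im = w.im := rfl
        rw [h4]
        gcongr
    exact (h1.differentiableAt (hopen.mem_nhds (by
      change z.im / 2 < z.im
      linarith))).differentiableWithinAt
  have hη : DifferentiableOn ℂ (fun z => ModularForm.eta z ^
      ((Fintype.card F : ℤ) - (Fintype.card P : ℤ))) {z | 0 < z.im} := by
    intro z hz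
    exact ((ModularForm.differentiableAt_eta_of_mem_upperHalfPlaneSet hz).zpow
      (Or.inl (ModularForm.eta_ne_zero hz))).differentiableWithinAt
  refine (hη.mul hB).congr fun z hz => ?_
  have hz' : 0 < z.im := hz
  rw [Function.comp_apply, ofComplex_apply_of_im_pos hz']
  rfl

/-- Each `(k_r + 1/2)²` is at least `1/4`, so the excess is at least `N/4 - 2`. The resulting decay
exactly offsets the growth of `η^(n - N)`, since `(n - N)/12 + N/4 - 2 = (n + 2N)/12 - 2 = 0`. -/
lemma HasUnitRows.isBoundedAtImInfty_component (hG : HasUnitRows G)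
    (h24 : Fintype.card F + 2 * Fintype.card P = 24) {l : dualLattice G}
    (hl : form G (l : F → ℚ) (l : F → ℚ) ≤ 2) : IsBoundedAtImInfty (hG.component l) := by
  obtain ⟨M, A, hM⟩ := exists_norm_eta_zpow_le ((Fintype.card F : ℤ) - (Fintype.card P : ℤ))
  set E : ℝ := (Fintype.card P : ℝ) / 4 - 2 with hE
  have hex (k : {k : P → ℤ // hG.blockVec k = l}) : E ≤ hG.excess k := by
    have h1 : (Fintype.card P : ℚ) / 4 ≤ ∑ r, halfShift (k : P → ℤ) r ^ 2 := by
      have : (Fintype.card P : ℚ) / 4 = ∑ _r : P, (1 / 4 : ℚ) := by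
        simp
        ring
      rw [this]
      refine Finset.sum_le_sum fun r _ => ?_
      have h2 : (0 : ℤ) ≤ (k : P → ℤ) r * ((k : P → ℤ) r + 1) := by
        rcases le_or_gt 0 ((k : P → ℤ) r) with h | h
        · positivity
        · exact mul_nonneg_of_nonpos_of_nonpos h.le (by omega)
      have h3 : (0 : ℚ) ≤ (k : P → ℤ) r * ((k : P → ℤ) r + 1) := by exact_mod_cast h2
      rw [halfShift]
      nlinarith
    have h2 : (Fintype.card P : ℚ) / 4 - 2 ≤ hG.excess k := by
      rw [HasUnitRows.excess, k.2]
      linarith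
    have h3 : (((Fintype.card P : ℚ) / 4 - 2 : ℚ) : ℝ) ≤ hG.excess k := by exact_mod_cast h2
    rw [hE]
    push_cast at h3
    exact h3
  set S : ℝ := ∑' k : {k : P → ℤ // hG.blockVec k = l}, ‖hG.blockTerm UpperHalfPlane.I k‖ with hS
  refine isBoundedAtImInfty_iff.mpr ⟨M * (Real.exp (Real.pi * E) * S), max A 1, fun τ hτ => ?_⟩
  have hτ1 : 1 ≤ τ.im := (le_max_right _ _).trans hτ
  have h1 := hM τ ((le_max_left _ _).trans hτ)
  have h2 : ‖hG.blockCoeff l τ‖ ≤ Real.exp (-(Real.pi * τ.im * E)) * (Real.exp (Real.pi * E) * S) := by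
    rw [HasUnitRows.blockCoeff, hS, ← tsum_mul_left, ← tsum_mul_left]
    refine (norm_tsum_le_tsum_norm (hG.summable_blockTerm l τ)).trans ?_
    refine Summable.tsum_le_tsum (fun k => ?_) (hG.summable_blockTerm l τ)
      (((hG.summable_blockTerm l UpperHalfPlane.I).mul_left _).mul_left _)
    rw [hG.norm_blockTerm, hG.norm_blockTerm, ← Real.exp_add, ← Real.exp_add, Real.exp_le_exp,
      UpperHalfPlane.I_im]
    have h3 : 0 ≤ Real.pi * (τ.im - 1) * (hG.excess k - E) :=
      mul_nonneg (mul_nonneg Real.pi_pos.le (by linarith)) (by linarith [hex k])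
    nlinarith
  rw [HasUnitRows.component, norm_mul]
  refine (mul_le_mul h1 h2 (norm_nonneg _) ((norm_nonneg _).trans h1)).trans (le_of_eq ?_)
  have h24' : (Fintype.card F : ℝ) + 2 * Fintype.card P = 24 := by exact_mod_cast h24
  have h5 : Real.exp (-(Real.pi * τ.im * (((Fintype.card F : ℤ) - (Fintype.card P : ℤ) : ℤ) : ℝ) / 12)) *
      Real.exp (-(Real.pi * τ.im * E)) = 1 := by
    rw [← Real.exp_add, Real.exp_eq_one_iff, hE]
    push_cast
    linear_combination (-(Real.pi * τ.im) / 12) * h24'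
  calc _ = M * (Real.exp (Real.pi * E) * S) * (Real.exp (-(Real.pi * τ.im *
        (((Fintype.card F : ℤ) - (Fintype.card P : ℤ) : ℤ) : ℝ) / 12)) *
        Real.exp (-(Real.pi * τ.im * E))) := by ring
    _ = _ := by rw [h5, mul_one]

/-- The vector-valued function `θ_R`. -/
def HasUnitRows.thetaVec [Finite (Disc G)] (hG : HasUnitRows G) (τ : ℍ) : Disc G →₀ ℂ :=
  Finsupp.equivFunOnFinite.symm fun γ => hG.component γ.out τ

lemma HasUnitRows.thetaVec_coe [Finite (Disc G)] (hG : HasUnitRows G) (τ : ℍ)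
    (l : dualLattice G) : hG.thetaVec τ (l : Disc G) = hG.component l τ := by
  rw [HasUnitRows.thetaVec, Finsupp.equivFunOnFinite_symm_apply_apply, HasUnitRows.component,
    HasUnitRows.component]
  congr 1
  refine hG.blockCoeff_add ?_ τ
  have h1 : ((Quotient.out (l : Disc G) : dualLattice G) : Disc G) = (l : Disc G) :=
    QuotientAddGroup.out_eq' _
  rw [eq_comm, QuotientAddGroup.eq, AddSubgroup.mem_addSubgroupOf] at h1
  simpa [sub_eq_add_neg, add_comm] using h1

lemma HasUnitRows.correspondsToThetaBlock [Fintype (Disc G)] (hG : HasUnitRows G) :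
    CorrespondsToThetaBlock G hG.thetaVec := by
  intro τ z
  obtain ⟨h1, h2⟩ := hG.hasSum_blockCoeff τ z
  rw [thetaBlock, h2, Finsupp.sum_fintype _ _ (by simp), tsum_eq_sum_fiber h1, Finset.mul_sum]
  refine Finset.sum_congr rfl fun γ _ => ?_
  rw [thetaSeries, ← tsum_mul_left, ← tsum_mul_left]
  refine tsum_congr fun l => ?_
  obtain ⟨l, rfl⟩ := l
  rw [hG.thetaVec_coe, HasUnitRows.component, mul_assoc]
  rfl

omit [DecidableEq F] in
lemma charBlock_of_corresponds [Fintype (Disc G)] {θ : ℍ → (Disc G →₀ ℂ)}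
    (hθ : CorrespondsToThetaBlock G θ) (τ : ℍ) (x y : F → ℝ) :
    charBlock G τ x y = thetaMap G (θ τ) τ x y := by
  rw [charBlock, hθ, thetaMap_apply, Finsupp.sum_fintype _ _ (by simp), Finset.mul_sum]
  refine Finset.sum_congr rfl fun γ _ => ?_
  rw [thetaSeries_eq_charTheta, mul_left_comm, ← mul_assoc (cexp _), ← Complex.exp_add,
    add_neg_cancel, Complex.exp_zero, one_mul]

end ThetaComponents

end RootTheta

end

noncomputable section

namespace RootTheta

open UpperHalfPlane hiding I
open MatrixGroups Manifold

/-! ### Reduction of the theorem to a sign function on the discriminant form. -/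

section Main

variable {P F : Type*} [Fintype F] [Fintype P] {G : Matrix P F ℤ} [DecidableEq F]

/-- The vector `l` pairs with `y ∈ L` like the Weyl vector, up to integers. -/
def IsShadow (G : Matrix P F ℤ) (l : F → ℚ) : Prop :=
  ∀ y : F → ℤ, ∃ m : ℤ, form G l (fun f => (y f : ℚ)) = m + (∑ r, lin G r y : ℤ) / 2

/-- The function `f` on the discriminant form spans the functions that are antisymmetric under
reflections and supported on shadow vectors, and it is invariant under `O(D)` up to sign. -/
structure IsSignFunction (G : Matrix P F ℤ) (ρ : dualLattice G) (f : Disc G → ℂ) : Prop where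
  norm_le : form G (ρ : F → ℚ) (ρ : F → ℚ) ≤ 2
  apply_rho : f ρ = 1
  isotropic : ∀ γ, f γ ≠ 0 → discForm G γ = 0
  unique : ∀ θ : Disc G → ℂ,
    (∀ t σ (l l' : dualLattice G), IsSignedSymmetry G t σ → (l' : F → ℚ) = t l →
      θ l' = σ * θ l) →
    (∀ l : dualLattice G, ¬ IsShadow G l → θ l = 0) → ∀ γ, θ γ = θ ρ * f γ
  invariant : ∀ σ ∈ orthogonalGroup (discForm G), (∀ γ, f (σ γ) = f γ) ∨ ∀ γ, f (σ γ) = -f γ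
  reversed : ∃ σ ∈ orthogonalGroup (discForm G), ∀ γ, f (σ γ) = -f γ

lemma HasUnitRows.thetaVec_eq [Finite (Disc G)] (hG : HasUnitRows G) {ρ : dualLattice G}
    {f : Disc G → ℂ} (hf : IsSignFunction G ρ f) (τ : ℍ) (γ : Disc G) :
    hG.thetaVec τ γ = hG.component ρ τ * f γ := by
  have h := hf.unique (fun γ => hG.thetaVec τ γ) (fun t σ l l' ht hl => by
    rw [hG.thetaVec_coe, hG.thetaVec_coe, HasUnitRows.component, HasUnitRows.component,
      hG.blockCoeff_symmetry ht hl]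
    ring) (fun l hl => by
    rw [hG.thetaVec_coe, HasUnitRows.component, hG.blockCoeff_eq_zero hl, mul_zero]) γ
  rw [h, hG.thetaVec_coe]

/-- The nontrivial character of `O(D)` by which it acts on a function that is invariant up to
sign. -/
lemma exists_sign_character {D : Type*} [AddCommGroup D] {q : D → AddCircle (1 : ℚ)} {f : D → ℂ}
    {γ₀ : D} (h₀ : f γ₀ ≠ 0)
    (hinv : ∀ σ ∈ orthogonalGroup q, (∀ γ, f (σ γ) = f γ) ∨ ∀ γ, f (σ γ) = -f γ)
    (hrev : ∃ σ ∈ orthogonalGroup q, ∀ γ, f (σ γ) = -f γ) :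
    ∃ χ : orthogonalGroup q →* ℂˣ, orderOf χ = 2 ∧ ∀ (σ : orthogonalGroup q) γ,
      f ((σ : Equiv.Perm D) γ) = (χ σ : ℂ) * f γ := by
  classical
  have h (σ : orthogonalGroup q) : ∃ u : ℂˣ, (u = 1 ∨ u = -1) ∧
      ∀ γ, f ((σ : Equiv.Perm D) γ) = (u : ℂ) * f γ := by
    rcases hinv σ σ.2 with h | h
    · exact ⟨1, Or.inl rfl, by simpa using h⟩
    · exact ⟨-1, Or.inr rfl, by simpa using h⟩
  choose u hu hu' using h
  have huniq (σ : orthogonalGroup q) (v : ℂˣ)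
      (hv : f ((σ : Equiv.Perm D) γ₀) = (v : ℂ) * f γ₀) : u σ = v := by
    rw [hu'] at hv
    exact Units.ext (mul_right_cancel₀ h₀ hv)
  let χ : orthogonalGroup q →* ℂˣ :=
    { toFun := u
      map_one' := huniq 1 1 (by simp)
      map_mul' := fun σ σ' => huniq _ _ (by
        rw [Subgroup.coe_mul, Equiv.Perm.mul_apply, hu', hu']
        push_cast
        ring) }
  refine ⟨χ, orderOf_eq_prime ?_ ?_, hu'⟩
  · ext σ
    change ((u σ ^ 2 : ℂˣ) : ℂ) = 1
    rcases hu σ with h | h <;> simp [h]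
  · intro h1
    obtain ⟨σ, hσ, hσ'⟩ := hrev
    have h2 : u ⟨σ, hσ⟩ = 1 := DFunLike.congr_fun h1 ⟨σ, hσ⟩
    have h3 := hu' ⟨σ, hσ⟩ γ₀
    rw [h2, Units.val_one, one_mul] at h3
    have h4 := hσ' γ₀
    rw [h3] at h4
    exact h₀ (self_eq_neg.mp h4)

/-- The main theorem for a matrix with a sign function on its discriminant form. -/
theorem HasUnitRows.main (hG : HasUnitRows G) (h24 : Fintype.card F + 2 * Fintype.card P = 24)
    {k : ℕ} (hk : Fintype.card F = 2 * k) {ρ : dualLattice G} {f : Disc G → ℂ}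
    (hf : IsSignFunction G ρ f) :
    ∃ W : Representation ℂ SL(2, ℤ) (Disc G →₀ ℂ), IsWeilRepresentation (discForm G) W ∧
      ∃ θ : ℍ → (Disc G →₀ ℂ), IsHolomorphicModularForm (discForm G) W 0 θ ∧
        CorrespondsToThetaBlock G θ ∧
        (∀ θ' : ℍ → (Disc G →₀ ℂ), CorrespondsToThetaBlock G θ' → θ' = θ) ∧
        ∃ χ : orthogonalGroup (discForm G) →* ℂˣ, orderOf χ = 2 ∧
          ∀ (σ : orthogonalGroup (discForm G)) (τ : ℍ),
            act (σ : Equiv.Perm _) (θ τ) = (χ σ : ℂ) • θ τ := by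
  obtain ⟨b⟩ := hG.exists_dualBases
  have := finite_disc b
  have := Fintype.ofFinite (Disc G)
  obtain ⟨W, hW, hWΘ⟩ := hG.exists_weilRepresentation hk
  have hcorr := hG.correspondsToThetaBlock
  have htrans := hG.transform_of_invariant hWΘ (charBlock_S h24 hk) (charBlock_T h24)
    (charBlock_of_corresponds hcorr)
  let v : Disc G →₀ ℂ := Finsupp.equivFunOnFinite.symm f
  have hθ (τ : ℍ) : hG.thetaVec τ = hG.component ρ τ • v := by
    ext γ
    exact hG.thetaVec_eq hf τ γ
  -- the component at the Weyl vector is constant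
  have hc (A : SL(2, ℤ)) (τ : ℍ) :
      hG.component ρ (A • τ) = W A v (ρ : Disc G) * hG.component ρ τ := by
    have h1 := DFunLike.congr_fun (htrans A τ) (ρ : Disc G)
    rw [hθ, hθ, map_smul, Finsupp.smul_apply, Finsupp.smul_apply] at h1
    have h2 : v (ρ : Disc G) = 1 := hf.apply_rho
    rw [h2, smul_eq_mul, mul_one, smul_eq_mul, mul_comm] at h1
    exact h1
  -- `T` acts diagonally, and the class of the Weyl vector is isotropic.
  have hT : W ModularGroup.T v (ρ : Disc G) = 1 := by
    have h1 : v = ∑ γ, v γ • Finsupp.single γ 1 := by simp [Finsupp.univ_sum_single]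
    rw [h1, map_sum, Finsupp.finsetSum_apply, Finset.sum_eq_single (ρ : Disc G)]
    · rw [map_smul, hW.map_T]
      have h2 : v (ρ : Disc G) = 1 := hf.apply_rho
      rw [hf.isotropic (ρ : Disc G) (by rw [hf.apply_rho]; exact one_ne_zero), h2]
      simp [e_zero]
    · intro γ _ hγ
      rw [map_smul, hW.map_T]
      simp [hγ]
    · simp
  obtain ⟨a, ha⟩ : ∃ a, ∀ τ, hG.component ρ τ = a := by
    by_cases h0 : ∀ τ, hG.component ρ τ = 0
    · exact ⟨0, h0⟩
    push Not at h0
    obtain ⟨τ₀, hτ₀⟩ := h0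
    set κ := W ModularGroup.S v (ρ : Disc G) with hκ
    have hS (τ : ℍ) : hG.component ρ (ModularGroup.S • τ) = κ * hG.component ρ τ := hc _ τ
    have hT' (τ : ℍ) : hG.component ρ (ModularGroup.T • τ) = hG.component ρ τ := by
      rw [hc, hT, one_mul]
    -- `S² = -1` and `(ST)³ = -1` act trivially on the upper half-plane. Evaluating at a point where
    -- the component is nonzero gives `κ² = κ³ = 1`.
    have h2 : κ * κ = 1 := by
      have h3 : ModularGroup.S • ModularGroup.S • τ₀ = τ₀ := by
        have : ModularGroup.S * ModularGroup.S = -1 := by decide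
        rw [← mul_smul, this, ModularGroup.SL_neg_smul, one_smul]
      have h4 := congrArg (hG.component ρ) h3
      rw [hS, hS, ← mul_assoc] at h4
      exact mul_right_cancel₀ hτ₀ (h4.trans (one_mul _).symm)
    have h3 : κ * (κ * κ) = 1 := by
      have h3 : ModularGroup.S • ModularGroup.T • ModularGroup.S • ModularGroup.T •
          ModularGroup.S • ModularGroup.T • τ₀ = τ₀ := by
        have : ModularGroup.S * (ModularGroup.T * (ModularGroup.S * (ModularGroup.T *
            (ModularGroup.S * ModularGroup.T)))) = -1 := by decide
        simp only [← mul_smul]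
        rw [this, ModularGroup.SL_neg_smul, one_smul]
      have h4 := congrArg (hG.component ρ) h3
      rw [hS, hT', hS, hT', hS, hT', ← mul_assoc, ← mul_assoc] at h4
      exact (mul_assoc _ _ _).symm.trans (mul_right_cancel₀ hτ₀ (h4.trans (one_mul _).symm))
    have h1 : κ = 1 := by rwa [h2, mul_one] at h3
    exact exists_const_of_invariant (hG.mdifferentiable_component ρ)
      (hG.isBoundedAtImInfty_component h24 hf.norm_le) (fun τ => by rw [hS, h1, one_mul]) hT'
  have hconst (τ : ℍ) (γ : Disc G) : hG.thetaVec τ γ = a * f γ := by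
    rw [hG.thetaVec_eq hf, ha]
  obtain ⟨χ, hχ, hχ'⟩ := exists_sign_character (γ₀ := (ρ : Disc G))
    (by rw [hf.apply_rho]; exact one_ne_zero) hf.invariant hf.reversed
  refine ⟨W, hW, hG.thetaVec, ⟨fun γ => ?_, fun A τ => ?_, ?_⟩, hcorr, fun θ' hθ' => ?_, χ, hχ,
    fun σ τ => ?_⟩
  · simp_rw [hconst]
    exact mdifferentiable_const
  · rw [zpow_zero, one_smul, htrans]
  · refine ⟨fun γ n => if n = 0 then a * f γ else 0, fun γ n hn => ?_, fun γ τ => ?_⟩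
    · have h0 : n = 0 := by
        by_contra h
        simp [h] at hn
      subst h0
      simp only [if_true] at hn
      rw [hf.isotropic γ (right_ne_zero_of_mul hn)]
      simp
    · have h1 := hasSum_single (0 : ℚ) (f := fun n : ℚ => (if n = 0 then a * f γ else 0) *
        Complex.exp (2 * Real.pi * Complex.I * (n : ℂ) * (τ : ℂ))) (by
          intro n hn
          simp [hn])
      rw [hconst]
      simpa using h1
  · ext1 τ
    refine hG.thetaMap_injective_at τ fun x y => ?_
    rw [← charBlock_of_corresponds hθ', ← charBlock_of_corresponds hcorr]
  · ext γ
    obtain ⟨γ, rfl⟩ := (σ : Equiv.Perm (Disc G)).surjective γ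
    rw [act, Finsupp.mapDomain_apply (σ : Equiv.Perm (Disc G)).injective, Finsupp.smul_apply,
      hconst, hconst, hχ', smul_eq_mul]
    -- `act` moves the coefficient at `γ` to `σ γ`, so the inverse of `χ σ` appears; it equals `χ σ`
    -- because `χ` has order `2`.
    have h1 : (χ σ : ℂ) * χ σ = 1 := by
      have : χ ^ 2 = 1 := by rw [← hχ, pow_orderOf_eq_one]
      have h2 := DFunLike.congr_fun this σ
      rw [MonoidHom.pow_apply, MonoidHom.one_apply, sq] at h2
      rw [← Units.val_mul, h2, Units.val_one]
    linear_combination (-(a * f γ)) * h1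

end Main

end RootTheta

end

noncomputable section

namespace RootTheta

open UpperHalfPlane hiding I
open MatrixGroups Manifold

/-! ### Vectors as integer lists, with missing entries read as zero, and chains for checking
connectedness. -/

section IntegerLists

/-- `a + c b` for vectors given by lists, whose missing entries are `0`. -/
def addSmul (c : ℤ) : List ℤ → List ℤ → List ℤ
  | [], b => b.map (c * ·)
  | a, [] => a
  | x :: a, y :: b => (x + c * y) :: addSmul c a b

lemma getD_map_mul (c : ℤ) (a : List ℤ) (i : ℕ) : (a.map (c * ·)).getD i 0 = c * a.getD i 0 := by
  induction a generalizing i with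
  | nil => simp
  | cons x a ih =>
    cases i with
    | zero => simp
    | succ i => rw [List.map_cons, List.getD_cons_succ, List.getD_cons_succ, ih]

lemma getD_addSmul (c : ℤ) (a b : List ℤ) (i : ℕ) :
    (addSmul c a b).getD i 0 = a.getD i 0 + c * b.getD i 0 := by
  induction a generalizing b i with
  | nil => rw [addSmul, getD_map_mul]; simp
  | cons x a ih =>
    cases b with
    | nil => simp [addSmul]
    | cons y b =>
      cases i with
      | zero => simp [addSmul]
      | succ i => simpa [addSmul] using ih b i

/-- The dot product of vectors given by lists. -/
def dot : List ℤ → List ℤ → ℤ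
  | x :: a, y :: b => x * y + dot a b
  | _, _ => 0

lemma dot_eq_sum {n : ℕ} {a : List ℤ} (ha : a.length ≤ n) (b : List ℤ) :
    dot a b = ∑ i : Fin n, a.getD i 0 * b.getD i 0 := by
  induction n generalizing a b with
  | zero =>
    have : a = [] := List.length_eq_zero_iff.mp (by omega)
    subst this
    simp [dot]
  | succ n ih =>
    rw [Fin.sum_univ_succ]
    cases a with
    | nil => simp [dot]
    | cons x a =>
      cases b with
      | nil => simp [dot]
      | cons y b =>
        simp only [dot, Fin.val_zero, Fin.val_succ, List.getD_cons_zero, List.getD_cons_succ]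
        rw [ih (by simpa using ha)]

/-- The standard basis vectors as lists. -/
def unitList (i : ℕ) : List ℤ := List.replicate i 0 ++ [1]

lemma getD_unitList (i j : ℕ) : (unitList i).getD j 0 = if j = i then 1 else 0 := by
  induction i generalizing j with
  | zero => cases j <;> simp [unitList]
  | succ i ih =>
    cases j with
    | zero => simp [unitList, List.replicate_succ]
    | succ j =>
      have := ih j
      simpa [unitList, List.replicate_succ] using this

/-- Every element of the second list is related to an earlier one, the elements of the first list
counting as earlier. -/
def isChain {α : Type*} (E : α → α → Bool) : List α → List α → Bool
  | _, [] => true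
  | acc, x :: l => (acc.any fun y => E y x) && isChain E (x :: acc) l

/-- Every new element has an earlier neighbour, so `Q` spreads along a spanning tree. The predicate
`S` keeps membership available in the step. -/
lemma isChain_induction {α : Type*} {E : α → α → Bool} {S Q : α → Prop}
    (step : ∀ y x, S y → S x → E y x → Q y → Q x) {acc l : List α}
    (h : isChain E acc l) (hacc : ∀ y ∈ acc, S y ∧ Q y) (hl : ∀ x ∈ l, S x) :
    ∀ x ∈ l, Q x := by
  induction l generalizing acc with
  | nil => simp
  | cons x l ih =>
    rw [isChain, Bool.and_eq_true, List.any_eq_true] at h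
    obtain ⟨⟨y, hy, hyx⟩, h⟩ := h
    have hx : Q x := step y x (hacc y hy).1 (hl x (by simp)) hyx (hacc y hy).2
    intro z hz
    rcases List.mem_cons.mp hz with rfl | hz
    · exact hx
    · refine ih h ?_ (fun w hw => hl w (by simp [hw])) z hz
      intro w hw
      rcases List.mem_cons.mp hw with rfl | hw
      · exact ⟨hl w (by simp), hx⟩
      · exact hacc w hw

end IntegerLists

/-- Numerical data for a root system and the discriminant form of its lattice. A list `y` stands
for the vector `y / denom`. -/
structure SignTable where
  /-- the rank -/
  dim : ℕ
  /-- the coefficients of the positive roots -/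
  rows : List (List ℤ)
  /-- the Gram matrix of the lattice -/
  gram : List (List ℤ)
  /-- the coroots in the dual coordinates -/
  coroots : List (List ℤ)
  /-- a common denominator of the elements of the dual lattice -/
  denom : ℤ
  /-- elements `(m, h, g)`, where the `h` form a basis of `L_ev` with the dual basis `g / denom`,
  and `m g / denom` is in `L_ev` -/
  basis : List (ℕ × List ℤ × List ℤ)
  /-- the Weyl vector -/
  weyl : List ℤ
  /-- the remaining elements of the support of the sign function, with their signs -/
  orbit : List (List ℤ × ℤ)
  /-- inner products modulo `1`, multiplied by `denom ^ 2`, that change the sign -/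
  pairings : List ℤ
  /-- integers that do not annihilate any element of the support -/
  orders : List ℕ

/-! ### Decidable conditions on a table of roots and signs. -/

namespace SignTable

variable (d : SignTable)

/-- The bilinear form of the lattice. -/
def form (a b : List ℤ) : ℤ := dot (d.gram.map fun B => dot B a) b

/-- The reflection in the root with number `r`. -/
def refl (r : ℕ) (a : List ℤ) : List ℤ :=
  addSmul (-dot (d.rows.getD r []) a) a (d.coroots.getD r [])

/-- The reflection in the root with number `r` applied to the root with number `i`. -/
def image (r i : ℕ) : List ℤ :=
  addSmul (-dot (d.rows.getD i []) (d.coroots.getD r [])) (d.rows.getD i []) (d.rows.getD r [])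

/-- The sign of a reflected root. -/
def imageSign (r i : ℕ) : ℤ := if ∀ x ∈ d.image r i, 0 ≤ x then 1 else -1

/-- The number of a reflected root up to sign. -/
def imageIdx (r i : ℕ) : ℕ := d.rows.idxOf ((d.image r i).map (d.imageSign r i * ·))

/-- Equality modulo `L_ev`. -/
def same (a b : List ℤ) : Bool :=
  (((addSmul (-1) a b).take d.dim).all fun x => x % d.denom == 0) &&
    d.form (addSmul (-1) a b) (addSmul (-1) a b) % (2 * (d.denom * d.denom)) == 0

/-- The inner products with `L` are those of the Weyl vector modulo integers. -/
def shadow (a : List ℤ) : Bool :=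
  (List.range d.dim).all fun i => (2 * d.form a (unitList i) -
    d.denom * (d.rows.map fun R => R.getD i 0).sum) % (2 * d.denom) == 0

/-- A condition on an element of the discriminant form that is invariant under automorphisms. -/
def intrinsic (a : List ℤ) : Bool :=
  d.form a a % (2 * (d.denom * d.denom)) == 0 &&
    d.orders.all fun k => !d.same (a.map ((k : ℤ) * ·)) []

/-- Representatives for the discriminant form. -/
def box : List (ℕ × List ℤ × List ℤ) → List (List ℤ)
  | [] => [[]]
  | t :: l => (box l).flatMap fun y => (List.range t.1).map fun k : ℕ => addSmul (k : ℤ) y t.2.2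

/-- The support of the sign function, with the signs. -/
def points : List (List ℤ × ℤ) := (d.weyl, 1) :: d.orbit

/-- The inner product implies opposite signs. -/
def adjacent (a b : List ℤ) : Bool :=
  d.pairings.any fun x => d.form a b % (d.denom * d.denom) == x

/-- Some reflection maps the first element to the second. -/
def reflected (a b : List ℤ) : Bool :=
  (List.range d.rows.length).any fun r => d.same (d.refl r a) b

/-- The rows of the table have the properties of a system of positive roots. -/
structure IsRootTable : Prop where
  denom_pos : 0 < d.denom
  rows_pos : 0 < d.rows.length
  length_le : ∀ R ∈ d.rows, R.length ≤ d.dim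
  gram_length : d.gram.length ≤ d.dim ∧ ∀ B ∈ d.gram, B.length ≤ d.dim
  gram_eq : ∀ i < d.dim, ∀ j < d.dim,
    (d.gram.getD i []).getD j 0 = (d.rows.map fun R => R.getD i 0 * R.getD j 0).sum
  dim_le : d.dim ≤ d.rows.length
  row_unit : ∀ j < d.dim, ∀ k < d.dim, (d.rows.getD j []).getD k 0 = if k = j then 1 else 0
  row_injective : ∀ a < d.rows.length, ∀ a' < d.rows.length,
    (∀ k < d.dim, (d.rows.getD a []).getD k 0 = (d.rows.getD a' []).getD k 0) → a = a'
  height_pos : ∀ a < d.rows.length, 0 < dot (d.rows.getD a []) (List.replicate d.dim 1)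
  -- Every row beyond the simple roots is a simple reflection of an earlier row, which certifies
  -- that it is a root.
  reachable : ∀ a < d.rows.length, d.dim ≤ a →
    ∃ a' ∈ List.range a, ∃ j ∈ List.range d.dim, d.image j a' = d.rows.getD a []
  dim_add : d.dim + 2 * d.rows.length = 24
  dim_even : d.dim % 2 = 0
  dot_coroot : ∀ r < d.rows.length, dot (d.rows.getD r []) (d.coroots.getD r []) = 2
  image_eq : ∀ r < d.rows.length, ∀ i < d.rows.length, d.imageIdx r i < d.rows.length ∧
    d.rows.getD (d.imageIdx r i) [] = (d.image r i).map (d.imageSign r i * ·)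
  image_nodup : ∀ r < d.rows.length, ((List.range d.rows.length).map (d.imageIdx r)).Nodup
  image_sign : ∀ r < d.rows.length, ((List.range d.rows.length).map (d.imageSign r)).prod = -1

/-- The table describes a sign function on the discriminant form. -/
structure IsSignTable : Prop where
  basis_pos : ∀ t ∈ d.basis, 0 < t.1
  basis_even : ∀ t ∈ d.basis, d.form t.2.1 t.2.1 % 2 = 0
  basis_order : ∀ t ∈ d.basis, d.same (t.2.2.map ((t.1 : ℤ) * ·)) []
  expand : ∀ i < d.dim, ∀ j < d.dim,
    (d.basis.map fun t => d.form (unitList i) t.2.1 * t.2.2.getD j 0).sum =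
      if j = i then d.denom else 0
  form_weyl : d.form d.weyl d.weyl ≤ 2 * (d.denom * d.denom)
  sign : ∀ p ∈ d.points, p.2 = 1 ∨ p.2 = -1
  points_shadow : d.points.all fun p => d.shadow p.1
  points_intrinsic : d.points.all fun p => d.intrinsic p.1
  sign_eq : d.points.all fun p => d.points.all fun p' => !d.same p.1 p'.1 || p.2 == p'.2
  connected_refl : isChain (fun p p' : List ℤ × ℤ => p'.2 == -p.2 && d.reflected p.1 p'.1)
    [(d.weyl, 1)] d.orbit
  -- A class outside the support is not a shadow or is fixed by a reflection. In both cases the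
  -- functions under consideration vanish there.
  box_cases : (box d.basis).all fun y => if d.intrinsic y then d.points.any fun p => d.same y p.1
    else !d.shadow y || d.reflected y y
  sign_adjacent : d.points.all fun p => d.points.all fun p' =>
    !d.adjacent p.1 p'.1 || p'.2 == -p.2
  connected_adjacent : isChain (fun p p' : List ℤ × ℤ => d.adjacent p.1 p'.1)
    [(d.weyl, 1)] d.orbit
  reversed : d.points.any fun p => p.2 == -1 && d.same (d.refl 0 d.weyl) p.1

end SignTable

end RootTheta

end

/-! ### Translation of list computations into statements about the lattice. -/

noncomputable section

namespace RootTheta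

open UpperHalfPlane hiding I
open MatrixGroups Manifold

lemma sum_map_eq_sum_fin {α : Type*} {M : Type*} [AddCommMonoid M] (l : List α) (f : α → M)
    (x : α) : (l.map f).sum = ∑ k : Fin l.length, f (l.getD k x) := by
  induction l with
  | nil => simp
  | cons a l ih =>
    rw [List.map_cons, List.sum_cons, ih]
    simp only [List.length_cons]
    rw [Fin.sum_univ_succ]
    simp

/-- The rows of the matrix `G` are those of the table, up to a numbering of rows and columns. -/
structure SignTable.Realization {P F : Type*} (d : SignTable) (G : Matrix P F ℤ) where
  /-- the numbering of the columns -/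
  col : F ≃ Fin d.dim
  /-- the numbering of the rows -/
  row : P ≃ Fin d.rows.length
  apply_eq : ∀ r f, G r f = (d.rows.getD (row r) []).getD (col f) 0

lemma SignTable.IsRootTable.denom_ne_zero {d : SignTable} (hd : d.IsRootTable) :
    (d.denom : ℚ) ≠ 0 := by exact_mod_cast hd.denom_pos.ne'

lemma all_take_iff (e : ℤ) (n : ℕ) (a : List ℤ) :
    ((a.take n).all fun x => x % e == 0) = true ↔ ∀ i < n, e ∣ a.getD i 0 := by
  induction n generalizing a with
  | zero => simp
  | succ n ih =>
    cases a with
    | nil => simp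
    | cons x a =>
      rw [List.take_succ_cons, List.all_cons, Bool.and_eq_true, ih, Nat.forall_lt_succ_left,
        beq_iff_eq, ← Int.dvd_iff_emod_eq_zero]
      rfl

namespace SignTable.Realization

variable {P F : Type*} [Fintype F] [Fintype P] {G : Matrix P F ℤ} {d : SignTable}
  (L : d.Realization G)

/-- The vector in `ℤ^F` described by a list. -/
def vec (a : List ℤ) : F → ℤ := fun f => a.getD (L.col f) 0

/-- The vector in `ℚ^F` described by a list. -/
def pt (a : List ℤ) : F → ℚ := fun f => (L.vec a f : ℚ) / d.denom

omit [Fintype F] [Fintype P] in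
lemma pt_addSmul (c : ℤ) (a b : List ℤ) : L.pt (addSmul c a b) = L.pt a + (c : ℚ) • L.pt b := by
  ext f
  simp only [pt, vec, getD_addSmul, Pi.add_apply, Pi.smul_apply, smul_eq_mul]
  push_cast
  ring

omit [Fintype F] [Fintype P] in
lemma pt_map (c : ℤ) (a : List ℤ) : L.pt (a.map (c * ·)) = (c : ℚ) • L.pt a := by
  ext f
  simp only [pt, vec, getD_map_mul, Pi.smul_apply, smul_eq_mul]
  push_cast
  ring

omit [Fintype F] [Fintype P] in
lemma pt_nil : L.pt [] = 0 := by
  ext f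
  simp [pt, vec]

include L in
omit [Fintype P] in
lemma card_col : Fintype.card F = d.dim := by
  rw [Fintype.card_congr L.col, Fintype.card_fin]

include L in
omit [Fintype F] in
lemma card_row : Fintype.card P = d.rows.length := by
  rw [Fintype.card_congr L.row, Fintype.card_fin]

variable (hd : d.IsRootTable)

include hd

omit [Fintype F] [Fintype P] in
lemma length_row_le (r : P) : (d.rows.getD (L.row r) []).length ≤ d.dim := by
  rw [List.getD_eq_getElem _ _ (L.row r).2]
  exact hd.length_le _ (List.getElem_mem _)

omit [Fintype P] in
lemma lin_vec (r : P) (a : List ℤ) : lin G r (L.vec a) = dot (d.rows.getD (L.row r) []) a := by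
  rw [dot_eq_sum (L.length_row_le hd r), ← Equiv.sum_comp L.col, lin]
  exact Finset.sum_congr rfl fun f _ => by rw [L.apply_eq]; rfl

lemma form_vec (a b : List ℤ) : RootTheta.form G (L.vec a) (L.vec b) = d.form a b := by
  have h1 (j : ℕ) : (d.gram.map fun B => dot B a).getD j 0 = dot (d.gram.getD j []) a := by
    rcases lt_or_ge j d.gram.length with hj | hj
    · simp [hj]
    · rw [List.getD_eq_default _ _ (by simpa using hj), List.getD_eq_default _ _ hj]
      rfl
  have h2 (j : ℕ) : (d.gram.getD j []).length ≤ d.dim := by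
    rcases lt_or_ge j d.gram.length with hj | hj
    · rw [List.getD_eq_getElem _ _ hj]
      exact hd.gram_length.2 _ (List.getElem_mem _)
    · rw [List.getD_eq_default _ _ hj]
      simp
  rw [SignTable.form, dot_eq_sum (by simpa using hd.gram_length.1)]
  simp_rw [h1, dot_eq_sum (h2 _)]
  have h3 (i j : Fin d.dim) : (d.gram.getD i []).getD j 0 =
      ∑ r : P, (d.rows.getD (L.row r) []).getD i 0 * (d.rows.getD (L.row r) []).getD j 0 := by
    rw [hd.gram_eq i i.2 j j.2, sum_map_eq_sum_fin _ _ [], ← Equiv.sum_comp L.row]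
  simp_rw [h3]
  rw [RootTheta.form]
  simp_rw [L.lin_vec hd, dot_eq_sum (L.length_row_le hd _), Finset.sum_mul_sum, Finset.sum_mul]
  calc _ = ∑ r : P, ∑ j : Fin d.dim, ∑ i : Fin d.dim, _ :=
        Finset.sum_congr rfl fun r _ => Finset.sum_comm
    _ = ∑ j : Fin d.dim, ∑ r : P, ∑ i : Fin d.dim, _ := Finset.sum_comm
    _ = ∑ j : Fin d.dim, ∑ i : Fin d.dim, ∑ r : P, _ :=
        Finset.sum_congr rfl fun j _ => Finset.sum_comm
    _ = _ := Finset.sum_congr rfl fun j _ => Finset.sum_congr rfl fun i _ =>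
        Finset.sum_congr rfl fun r _ => by ring

omit hd [Fintype F] [Fintype P] in
lemma pt_eq_smul (a : List ℤ) : L.pt a = (d.denom : ℚ)⁻¹ • fun f => (L.vec a f : ℚ) := by
  ext f
  simp [pt, div_eq_inv_mul]

omit [Fintype P] in
lemma lin_pt (r : P) (a : List ℤ) :
    lin G r (L.pt a) = (dot (d.rows.getD (L.row r) []) a : ℚ) / d.denom := by
  rw [pt_eq_smul, lin_smul, lin_intCast, L.lin_vec hd, div_eq_inv_mul]

lemma form_pt (a b : List ℤ) :
    RootTheta.form G (L.pt a) (L.pt b) = (d.form a b : ℚ) / (d.denom * d.denom) := by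
  rw [pt_eq_smul, pt_eq_smul, form_smul_left, form_smul_right, form_intCast, L.form_vec hd]
  field_simp

lemma pt_mem_evenLattice_iff (a : List ℤ) : L.pt a ∈ evenLattice G ↔
    (∀ i < d.dim, d.denom ∣ a.getD i 0) ∧ 2 * (d.denom * d.denom) ∣ d.form a a := by
  have he := hd.denom_ne_zero
  have he' := hd.denom_pos.ne'
  have key (y : F → ℤ) (hy : ∀ f, L.vec a f = d.denom * y f) :
      d.form a a = d.denom * d.denom * RootTheta.form G y y := by
    have : L.vec a = d.denom • y := by
      ext f
      rw [hy]
      rfl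
    rw [← L.form_vec hd, this, form_smul_left, form_smul_right, mul_assoc]
  constructor
  · rintro ⟨y, hy, hev⟩
    have hy' (f : F) : L.vec a f = d.denom * y f := by
      have h1 := congrFun hy f
      simp only [pt] at h1
      field_simp at h1
      exact_mod_cast h1
    refine ⟨fun i hi => ⟨y (L.col.symm ⟨i, hi⟩), ?_⟩, ?_⟩
    · rw [← hy']
      simp [vec]
    · rw [key y hy', mul_comm 2]
      exact mul_dvd_mul_left _ hev.two_dvd
  · rintro ⟨h1, h2⟩
    choose y hy using fun f => h1 (L.col f) (L.col f).2
    refine ⟨y, ?_, ?_⟩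
    · ext f
      rw [pt, vec, hy]
      push_cast
      field_simp
    · rw [key y hy, mul_comm 2] at h2
      exact even_iff_two_dvd.mpr (Int.dvd_of_mul_dvd_mul_left (mul_ne_zero he' he') h2)

lemma same_iff (a b : List ℤ) : d.same a b = true ↔ L.pt a - L.pt b ∈ evenLattice G := by
  have h : L.pt a - L.pt b = L.pt (addSmul (-1) a b) := by
    rw [pt_addSmul]
    push_cast
    rw [neg_one_smul, sub_eq_add_neg]
  rw [h, L.pt_mem_evenLattice_iff hd, SignTable.same, Bool.and_eq_true, all_take_iff, beq_iff_eq,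
    Int.dvd_iff_emod_eq_zero (a := 2 * (d.denom * d.denom))]

omit [Fintype P] hd in
lemma eq_sum_unit (y : F → ℤ) : y = ∑ f, y f • L.vec (unitList (L.col f)) := by
  classical
  ext g
  rw [Finset.sum_apply, Finset.sum_eq_single g]
  · simp only [Pi.smul_apply, vec, getD_unitList, if_true, smul_eq_mul, mul_one]
  · intro f _ hf
    have : ¬ ((L.col g : Fin d.dim) : ℕ) = L.col f := fun h =>
      hf (L.col.injective (Fin.ext h)).symm
    simp only [Pi.smul_apply, vec, getD_unitList, if_neg this, smul_zero]
  · simp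

lemma form_pt_intCast (a : List ℤ) (y : F → ℤ) :
    RootTheta.form G (L.pt a) (fun f => (y f : ℚ)) =
      (∑ f, y f * d.form a (unitList (L.col f)) : ℤ) / d.denom := by
  rw [pt_eq_smul, form_smul_left, form_intCast, div_eq_inv_mul]
  conv_lhs => rw [L.eq_sum_unit y]
  rw [form_sum_right]
  simp_rw [form_smul_right, L.form_vec hd]

omit hd in
lemma sum_lin_eq (y : F → ℤ) :
    ∑ r, lin G r y = ∑ f, y f * (d.rows.map fun R => R.getD (L.col f) 0).sum := by
  simp_rw [lin, sum_map_eq_sum_fin _ _ ([] : List ℤ), ← Equiv.sum_comp L.row, Finset.mul_sum]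
  rw [Finset.sum_comm]
  refine Finset.sum_congr rfl fun f _ => Finset.sum_congr rfl fun r _ => ?_
  rw [L.apply_eq, Int.cast_id, mul_comm]

/-- Both sides of the congruence are additive in `y`, so unit vectors suffice. -/
lemma shadow_iff (a : List ℤ) : d.shadow a = true ↔ IsShadow G (L.pt a) := by
  have he := hd.denom_ne_zero
  simp only [SignTable.shadow, List.all_eq_true, List.mem_range, beq_iff_eq]
  constructor
  · intro h y
    choose k hk using fun f => Int.dvd_of_emod_eq_zero (h (L.col f) (L.col f).2)
    refine ⟨∑ f, y f * k f, ?_⟩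
    rw [L.form_pt_intCast hd, L.sum_lin_eq, div_eq_iff he]
    push_cast
    rw [Finset.sum_div, ← Finset.sum_add_distrib, Finset.sum_mul]
    refine Finset.sum_congr rfl fun f _ => ?_
    have h1 : (2 * d.form a (unitList (L.col f)) : ℚ) -
        d.denom * (d.rows.map fun R => R.getD (L.col f) 0).sum = 2 * d.denom * k f := by
      exact_mod_cast hk f
    push_cast at h1
    linear_combination (y f : ℚ) / 2 * h1
  · intro h i hi
    classical
    obtain ⟨m, hm⟩ := h (Pi.single (L.col.symm ⟨i, hi⟩) 1)
    rw [L.form_pt_intCast hd, L.sum_lin_eq, div_eq_iff he] at hm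
    simp only [Pi.single_apply, ite_mul, one_mul, zero_mul, Finset.sum_ite_eq', Finset.mem_univ,
      if_true, Equiv.apply_symm_apply] at hm
    refine Int.emod_eq_zero_of_dvd ⟨m, ?_⟩
    have h1 : (2 * d.form a (unitList i) : ℚ) -
        d.denom * ((d.rows.map fun R => R.getD i 0).sum : ℤ) = 2 * d.denom * m := by
      linear_combination 2 * hm
    exact_mod_cast h1

end SignTable.Realization

end RootTheta

end

noncomputable section

namespace RootTheta

open UpperHalfPlane hiding I
open MatrixGroups Manifold

/-! ### Shadow vectors, reflections on `D` and representatives of classes. -/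

section Shadow

variable {P F : Type*} [Fintype F] [Fintype P] {G : Matrix P F ℤ}

lemma IsShadow.mem_dualLattice {l : F → ℚ} (h : IsShadow G l) : l ∈ dualLattice G := by
  rintro _ ⟨y, rfl, hy⟩
  obtain ⟨c, hc⟩ := sum_lin_even hy
  obtain ⟨m, hm⟩ := h y
  refine ⟨m + c, ?_⟩
  rw [hm, hc]
  push_cast
  ring

lemma disc_eq_iff {l l' : dualLattice G} :
    (l : Disc G) = l' ↔ (l : F → ℚ) - l' ∈ evenLattice G := by
  rw [eq_comm, QuotientAddGroup.eq, AddSubgroup.mem_addSubgroupOf]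
  simp [sub_eq_neg_add]

lemma discForm_coe_eq_zero_iff (l : dualLattice G) :
    discForm G (l : Disc G) = 0 ↔ ∃ m : ℤ, RootTheta.form G (l : F → ℚ) (l : F → ℚ) = 2 * m := by
  rw [discForm_coe, AddCircle.coe_eq_zero_iff]
  refine exists_congr fun m => ?_
  rw [zsmul_one]
  constructor <;> intro h <;> linarith

end Shadow

namespace SignTable.Realization

variable {P F : Type*} [Fintype F] [Fintype P] {G : Matrix P F ℤ} {d : SignTable}
  (L : d.Realization G)

/-- The reflection in a root. -/
def reflection (r : P) : (F → ℚ) →+ (F → ℚ) where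
  toFun x := x - lin G r x • fun f => (L.vec (d.coroots.getD (L.row r) []) f : ℚ)
  map_zero' := by simp [lin_zero]
  map_add' x y := by
    rw [lin_add]
    module

omit [Fintype P] in
lemma reflection_apply (r : P) (x : F → ℚ) : L.reflection r x =
    x - lin G r x • fun f => (L.vec (d.coroots.getD (L.row r) []) f : ℚ) := rfl

variable (hd : d.IsRootTable)

include hd

omit [Fintype P] in
lemma pt_refl (r : P) (a : List ℤ) : L.pt (d.refl (L.row r) a) = L.reflection r (L.pt a) := by
  rw [SignTable.refl, pt_addSmul, reflection_apply, L.lin_pt hd, L.pt_eq_smul (d.coroots.getD _ _)]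
  ext f
  simp only [Pi.add_apply, Pi.sub_apply, Pi.smul_apply, smul_eq_mul]
  push_cast
  ring

omit [Fintype P] in
lemma reflection_involutive (r : P) : Function.Involutive (L.reflection r) := by
  intro x
  have h : lin G r (fun f => (L.vec (d.coroots.getD (L.row r) []) f : ℚ)) = 2 := by
    rw [lin_intCast, L.lin_vec hd, hd.dot_coroot _ (L.row r).2]
    rfl
  rw [reflection_apply, reflection_apply, lin_sub, lin_smul, h]
  module

/-- Composing a root with the reflection gives the reflected root, which the table locates up to
sign as another row. Distinct rows go to distinct rows, and `image_sign` gives the product of the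
signs. -/
lemma isSignedSymmetry_reflection (r : P) : IsSignedSymmetry G (L.reflection r) (-1) := by
  refine ⟨(L.reflection_involutive hd r).surjective, ?_⟩
  let φ (k : P) : P := L.row.symm ⟨d.imageIdx (L.row r) (L.row k),
    (hd.image_eq _ (L.row r).2 _ (L.row k).2).1⟩
  have hφ : Function.Injective φ := by
    intro k k' h
    have h1 : d.imageIdx (L.row r) (L.row k) = d.imageIdx (L.row r) (L.row k') :=
      congrArg Fin.val (L.row.symm.injective h)
    have h2 := List.inj_on_of_nodup_map (hd.image_nodup _ (L.row r).2)
      (List.mem_range.mpr (L.row k).2) (List.mem_range.mpr (L.row k').2) h1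
    exact L.row.injective (Fin.ext h2)
  have hs (k : P) : d.imageSign (L.row r) (L.row k) = 1 ∨ d.imageSign (L.row r) (L.row k) = -1 := by
    rw [imageSign]
    split_ifs <;> simp
  refine ⟨Equiv.ofBijective φ (Finite.injective_iff_bijective.mp hφ),
    fun k => d.imageSign (L.row r) (L.row k), hs, fun k x => ?_, ?_⟩
  · have h1 (f : F) : G (φ k) f = d.imageSign (L.row r) (L.row k) *
        (G k f - dot (d.rows.getD (L.row k) []) (d.coroots.getD (L.row r) []) * G r f) := by
      rw [L.apply_eq, L.apply_eq, L.apply_eq]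
      simp only [φ, Equiv.apply_symm_apply]
      rw [(hd.image_eq _ (L.row r).2 _ (L.row k).2).2, getD_map_mul, image, getD_addSmul]
      ring
    have h2 : lin G (φ k) x = d.imageSign (L.row r) (L.row k) *
        (lin G k x - dot (d.rows.getD (L.row k) []) (d.coroots.getD (L.row r) []) * lin G r x) := by
      simp only [lin, h1, Finset.mul_sum, ← Finset.sum_sub_distrib]
      refine Finset.sum_congr rfl fun f _ => ?_
      push_cast
      ring
    rw [Equiv.ofBijective_apply, h2, reflection_apply, lin_sub, lin_smul, lin_intCast,
      L.lin_vec hd]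
    have h3 : (d.imageSign (L.row r) (L.row k) : ℚ) * d.imageSign (L.row r) (L.row k) = 1 := by
      rcases hs k with h | h <;> simp [h]
    rw [← mul_assoc, h3]
    ring
  · rw [← hd.image_sign _ (L.row r).2,
      Equiv.prod_comp L.row (fun i : Fin d.rows.length => d.imageSign (L.row r) i),
      ← Finset.prod_range (fun i => d.imageSign (L.row r) i)]
    rfl

lemma reflection_mem_evenLattice (r : P) {x : F → ℚ} (hx : x ∈ evenLattice G) :
    L.reflection r x ∈ evenLattice G := by
  obtain ⟨y, rfl, hy⟩ := hx
  have h1 : L.reflection r (fun f => (y f : ℚ)) =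
      fun f => ((y f - lin G r y * L.vec (d.coroots.getD (L.row r) []) f : ℤ) : ℚ) := by
    rw [reflection_apply, lin_intCast]
    ext f
    simp
  refine ⟨_, h1, ?_⟩
  have h2 := (L.isSignedSymmetry_reflection hd r).form_eq (fun f => (y f : ℚ)) (fun f => (y f : ℚ))
  rw [h1, form_intCast, form_intCast] at h2
  rwa [Int.cast_injective h2]

lemma reflection_mem_dualLattice (r : P) {x : F → ℚ} (hx : x ∈ dualLattice G) :
    L.reflection r x ∈ dualLattice G := by
  intro y hy
  obtain ⟨m, hm⟩ := hx _ (L.reflection_mem_evenLattice hd r hy)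
  refine ⟨m, ?_⟩
  rw [← hm, ← (L.isSignedSymmetry_reflection hd r).form_eq x, L.reflection_involutive hd]

/-- The action of a reflection on the discriminant form. -/
def discReflection (r : P) : Disc G →+ Disc G :=
  QuotientAddGroup.map _ _ (((L.reflection r).comp (dualLattice G).subtype).codRestrict
    (dualLattice G) fun x => L.reflection_mem_dualLattice hd r x.2) (by
      intro x hx
      rw [AddSubgroup.mem_addSubgroupOf] at hx
      rw [AddSubgroup.mem_comap, AddSubgroup.mem_addSubgroupOf]
      exact L.reflection_mem_evenLattice hd r hx)

lemma discReflection_coe (r : P) (l : dualLattice G) : L.discReflection hd r (l : Disc G) =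
    ((⟨L.reflection r l, L.reflection_mem_dualLattice hd r l.2⟩ : dualLattice G) : Disc G) := rfl

lemma discReflection_involutive (r : P) : Function.Involutive (L.discReflection hd r) := by
  intro γ
  induction γ using QuotientAddGroup.induction_on with | H l => ?_
  rw [discReflection_coe, discReflection_coe]
  congr 1
  exact Subtype.ext (L.reflection_involutive hd r _)

lemma discReflection_mem_orthogonalGroup (r : P) :
    (L.discReflection_involutive hd r).toPerm ∈ orthogonalGroup (discForm G) := by
  refine ⟨fun γ β => map_add (L.discReflection hd r) γ β, fun γ => ?_⟩
  change discForm G (L.discReflection hd r γ) = discForm G γ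
  induction γ using QuotientAddGroup.induction_on with | H l => ?_
  rw [discReflection_coe, discForm_coe, discForm_coe]
  rw [(L.isSignedSymmetry_reflection hd r).form_eq]

omit hd in
/-- The class `γ` contains the vector described by the list `a`. -/
def Represents (a : List ℤ) (γ : Disc G) : Prop :=
  ∃ l : dualLattice G, (l : F → ℚ) = L.pt a ∧ (l : Disc G) = γ

variable {L}

omit hd in
lemma Represents.unique {a : List ℤ} {γ γ' : Disc G} (h : L.Represents a γ)
    (h' : L.Represents a γ') : γ = γ' := by
  obtain ⟨l, hl, rfl⟩ := h
  obtain ⟨l', hl', rfl⟩ := h'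
  rw [Subtype.ext (hl.trans hl'.symm)]

lemma Represents.same {a b : List ℤ} {γ : Disc G} (h : L.Represents a γ)
    (h' : L.Represents b γ) : d.same a b = true := by
  obtain ⟨l, hl, rfl⟩ := h
  obtain ⟨l', hl', h'⟩ := h'
  rw [L.same_iff hd, ← hl, ← hl', ← disc_eq_iff, h']

lemma Represents.of_same {a b : List ℤ} {γ : Disc G} (h : L.Represents a γ)
    (h' : d.same a b = true) : L.Represents b γ := by
  obtain ⟨l, hl, rfl⟩ := h
  rw [L.same_iff hd] at h'
  refine ⟨⟨L.pt b, ?_⟩, rfl, ?_⟩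
  · have := (dualLattice G).sub_mem l.2 (evenLattice_le_dualLattice h')
    rwa [hl, sub_sub_cancel] at this
  · rw [eq_comm, disc_eq_iff]
    simpa only [hl] using h'

lemma Represents.refl {a : List ℤ} {γ : Disc G} (h : L.Represents a γ) (r : P) :
    L.Represents (d.refl (L.row r) a) (L.discReflection hd r γ) := by
  obtain ⟨l, hl, rfl⟩ := h
  refine ⟨_, ?_, (L.discReflection_coe hd r l).symm⟩
  rw [L.pt_refl hd, ← hl]

lemma Represents.polar {a b : List ℤ} {γ β : Disc G} (h : L.Represents a γ)
    (h' : L.Represents b β) : QuadraticMap.polar (discForm G) γ β =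
      (((d.form a b : ℚ) / (d.denom * d.denom) : ℚ) : AddCircle (1 : ℚ)) := by
  obtain ⟨l, hl, rfl⟩ := h
  obtain ⟨l', hl', rfl⟩ := h'
  rw [polar_discForm_coe, hl, hl', L.form_pt hd]

/-- Adjacency depends only on the value of the bilinear form in `ℚ/ℤ`; hence automorphisms preserve
it. -/
lemma Represents.adjacent {a b a' b' : List ℤ} {γ β γ' β' : Disc G} (ha : L.Represents a γ)
    (hb : L.Represents b β) (ha' : L.Represents a' γ') (hb' : L.Represents b' β')
    (h : QuadraticMap.polar (discForm G) γ β = QuadraticMap.polar (discForm G) γ' β')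
    (hab : d.adjacent a b = true) : d.adjacent a' b' = true := by
  rw [ha.polar hd hb, ha'.polar hd hb', ← sub_eq_zero, ← AddCircle.coe_sub,
    AddCircle.coe_eq_zero_iff] at h
  obtain ⟨m, hm⟩ := h
  have he := hd.denom_ne_zero
  have h1 : d.form a b = d.form a' b' + d.denom * d.denom * m := by
    rw [zsmul_one, ← sub_div, eq_div_iff (mul_ne_zero he he)] at hm
    have : (d.form a b : ℚ) = d.form a' b' + d.denom * d.denom * m := by linarith
    exact_mod_cast this
  rw [SignTable.adjacent, h1, Int.add_mul_emod_self_left] at hab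
  exact hab

/-- The property of a class described by `SignTable.intrinsic`. -/
def _root_.RootTheta.SignTable.IsIntrinsic (d : SignTable) (γ : Disc G) : Prop :=
  discForm G γ = 0 ∧ ∀ k ∈ d.orders, k • γ ≠ 0

omit hd in
lemma isIntrinsic_map {σ : Equiv.Perm (Disc G)} (hσ : σ ∈ orthogonalGroup (discForm G))
    (γ : Disc G) : d.IsIntrinsic (σ γ) ↔ d.IsIntrinsic γ := by
  let φ : Disc G →+ Disc G := AddMonoidHom.mk' σ hσ.1
  have h1 (k : ℕ) : k • σ γ = σ (k • γ) := (map_nsmul φ k γ).symm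
  have h2 : σ 0 = 0 := map_zero φ
  simp only [IsIntrinsic, hσ.2, h1, ne_eq]
  have h3 (β : Disc G) : σ β = 0 ↔ β = 0 := ⟨fun h => σ.injective (h.trans h2.symm), fun h => h ▸ h2⟩
  simp only [h3]

lemma Represents.intrinsic_iff {a : List ℤ} {γ : Disc G} (h : L.Represents a γ) :
    d.intrinsic a = true ↔ d.IsIntrinsic γ := by
  obtain ⟨l, hl, rfl⟩ := h
  have he := hd.denom_ne_zero
  rw [SignTable.intrinsic, Bool.and_eq_true, List.all_eq_true, beq_iff_eq, SignTable.IsIntrinsic,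
    discForm_coe_eq_zero_iff, hl, L.form_pt hd]
  refine and_congr ?_ (forall₂_congr fun k _ => ?_)
  · rw [← Int.dvd_iff_emod_eq_zero]
    refine exists_congr fun m => ?_
    rw [div_eq_iff (mul_ne_zero he he)]
    constructor
    · intro h
      rw [h]
      push_cast
      ring
    · intro h
      have : (d.form a a : ℚ) = 2 * (d.denom * d.denom) * m := by linarith
      exact_mod_cast this
  · have h1 : k • (l : Disc G) = ((k • l : dualLattice G) : Disc G) := rfl
    rw [Bool.not_eq_true', ← Bool.not_eq_true, L.same_iff hd, pt_map, pt_nil, ne_eq, h1,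
      QuotientAddGroup.eq_zero_iff, AddSubgroup.mem_addSubgroupOf, sub_zero, ← hl, AddSubgroup.coe_nsmul, Int.cast_natCast,
      Nat.cast_smul_eq_nsmul]

end SignTable.Realization

end RootTheta

end

noncomputable section

namespace RootTheta

open UpperHalfPlane hiding I
open MatrixGroups Manifold

/-! ### The sign function defined by a table. -/

namespace SignTable.Realization

variable {P F : Type*} [Fintype F] [Fintype P] {G : Matrix P F ℤ} {d : SignTable}
  (L : d.Realization G) (hd : d.IsRootTable)

include hd

include L in
omit [Fintype P] [Fintype F] in
lemma hasUnitRows [DecidableEq F] : HasUnitRows G := by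
  intro f
  refine ⟨L.row.symm ⟨L.col f, (L.col f).2.trans_le hd.dim_le⟩, ?_⟩
  ext f'
  rw [L.apply_eq, Equiv.apply_symm_apply, hd.row_unit _ (L.col f).2 _ (L.col f').2,
    Pi.single_apply]
  simp only [Fin.val_inj, EmbeddingLike.apply_eq_iff_eq]

/-- This is the dual basis expansion, certified on unit vectors by `expand`. For `x ∈ L_ev^∨` the
coefficients are integers. -/
lemma expansion (hs : d.IsSignTable) (x : F → ℚ) :
    (d.basis.map fun t =>
      RootTheta.form G x (fun f => (L.vec t.2.1 f : ℚ)) • L.pt t.2.2).sum = x := by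
  have he := hd.denom_ne_zero
  have h1 (b : List ℤ) : RootTheta.form G x (fun f => (L.vec b f : ℚ)) =
      ∑ f, x f * d.form (unitList (L.col f)) b := by
    have h2 : x = ∑ f, x f • (fun f' => (L.vec (unitList (L.col f)) f' : ℚ)) := by
      classical
      ext g
      rw [Finset.sum_apply, Finset.sum_eq_single g]
      · simp only [Pi.smul_apply, vec, getD_unitList, if_true, smul_eq_mul, Int.cast_one, mul_one]
      · intro f _ hf
        have : ¬ ((L.col g : Fin d.dim) : ℕ) = L.col f := fun h =>
          hf (L.col.injective (Fin.ext h)).symm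
        simp only [Pi.smul_apply, vec, getD_unitList, if_neg this, Int.cast_zero, smul_zero]
      · simp
    conv_lhs => rw [h2]
    rw [form_sum_left]
    simp_rw [form_smul_left, form_intCast, L.form_vec hd]
  rw [sum_map_eq_sum_fin _ _ ((0, [], []) : ℕ × List ℤ × List ℤ)]
  ext g
  have h3 (f : F) : ∑ k : Fin d.basis.length, (d.form (unitList (L.col f))
        (d.basis.getD k (0, [], [])).2.1 : ℚ) * L.vec (d.basis.getD k (0, [], [])).2.2 g =
      if L.col g = L.col f then (d.denom : ℚ) else 0 := by
    have := hs.expand (L.col f) (L.col f).2 (L.col g) (L.col g).2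
    rw [sum_map_eq_sum_fin _ _ ((0, [], []) : ℕ × List ℤ × List ℤ)] at this
    have h4 := congrArg (fun n : ℤ => (n : ℚ)) this
    simp only [Fin.val_inj] at h4
    push_cast at h4
    exact h4
  simp only [Finset.sum_apply, Pi.smul_apply, smul_eq_mul, h1, pt, Finset.sum_mul]
  rw [Finset.sum_comm]
  have h5 (f : F) : ∑ k : Fin d.basis.length, x f * (d.form (unitList (L.col f))
        (d.basis.getD k (0, [], [])).2.1 : ℚ) *
          ((L.vec (d.basis.getD k (0, [], [])).2.2 g : ℚ) / d.denom) =
      x f * (if L.col g = L.col f then (d.denom : ℚ) else 0) / d.denom := by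
    rw [← h3, Finset.mul_sum, Finset.sum_div]
    exact Finset.sum_congr rfl fun k _ => by ring
  simp_rw [h5]
  rw [Finset.sum_eq_single g]
  · rw [if_pos rfl, mul_div_cancel_right₀ _ he]
  · intro f _ hf
    rw [if_neg fun h => hf (L.col.injective h).symm, mul_zero, zero_div]
  · simp

omit hd in
-- Each coefficient may be reduced modulo `t.1`, because `t.1` times the corresponding dual vector
-- is in `L_ev`. So finitely many vectors cover `D`.
lemma exists_mem_box (c : ℕ × List ℤ × List ℤ → ℤ) (l : List (ℕ × List ℤ × List ℤ))
    (hl : ∀ t ∈ l, 0 < t.1 ∧ (t.1 : ℚ) • L.pt t.2.2 ∈ evenLattice G) :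
    ∃ y ∈ box l, (l.map fun t => (c t : ℚ) • L.pt t.2.2).sum - L.pt y ∈ evenLattice G := by
  induction l with
  | nil => exact ⟨[], by simp [box], by simp [L.pt_nil]⟩
  | cons t l ih =>
    obtain ⟨y, hy, hy'⟩ := ih fun s hs => hl s (List.mem_cons_of_mem _ hs)
    obtain ⟨ht, ht'⟩ := hl t List.mem_cons_self
    have ht0 : (t.1 : ℤ) ≠ 0 := by exact_mod_cast ht.ne'
    have hk := Int.emod_nonneg (c t) ht0
    refine ⟨addSmul ((c t % t.1).toNat : ℤ) y t.2.2, ?_, ?_⟩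
    · rw [box, List.mem_flatMap]
      refine ⟨y, hy, List.mem_map.mpr ⟨(c t % t.1).toNat, ?_, rfl⟩⟩
      rw [List.mem_range]
      have := Int.emod_lt_of_pos (c t) (b := (t.1 : ℤ)) (by exact_mod_cast ht)
      omega
    · rw [Int.toNat_of_nonneg hk, List.map_cons, List.sum_cons, pt_addSmul]
      have h1 : (c t : ℚ) = (c t % t.1 : ℤ) + (c t / t.1 : ℤ) * t.1 := by
        exact_mod_cast (Int.emod_add_ediv_mul (c t) t.1).symm
      have h2 : (c t : ℚ) • L.pt t.2.2 + (l.map fun t => (c t : ℚ) • L.pt t.2.2).sum -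
          (L.pt y + ((c t % t.1 : ℤ) : ℚ) • L.pt t.2.2) =
          ((l.map fun t => (c t : ℚ) • L.pt t.2.2).sum - L.pt y) +
            (c t / t.1 : ℤ) • ((t.1 : ℚ) • L.pt t.2.2) := by
        rw [h1, ← Int.cast_smul_eq_zsmul ℚ]
        module
      rw [h2]
      exact (evenLattice G).add_mem hy' ((evenLattice G).zsmul_mem ht' _)

lemma exists_represents (hs : d.IsSignTable) (γ : Disc G) :
    ∃ y ∈ box d.basis, L.Represents y γ := by
  induction γ using QuotientAddGroup.induction_on with | H l => ?_
  have h1 (t) (ht : t ∈ d.basis) :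
      ∃ m : ℤ, RootTheta.form G (l : F → ℚ) (fun f => (L.vec t.2.1 f : ℚ)) = m := by
    refine l.2 _ ⟨_, rfl, ?_⟩
    rw [L.form_vec hd]
    exact Int.even_iff.mpr (hs.basis_even t ht)
  obtain ⟨y, hy, hy'⟩ := L.exists_mem_box
    (fun t => (RootTheta.form G (l : F → ℚ) (fun f => (L.vec t.2.1 f : ℚ))).num) d.basis
    (fun t ht => ⟨hs.basis_pos t ht, by
      have := (L.same_iff hd _ _).mp (hs.basis_order t ht)
      rw [pt_map, pt_nil, sub_zero] at this
      exact_mod_cast this⟩)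
  have h2 : (d.basis.map fun t =>
      ((RootTheta.form G (l : F → ℚ) (fun f => (L.vec t.2.1 f : ℚ))).num : ℚ) •
        L.pt t.2.2).sum = l := by
    conv_rhs => rw [← L.expansion hd hs l]
    refine congrArg List.sum (List.map_congr_left fun t ht => ?_)
    obtain ⟨m, hm⟩ := h1 t ht
    rw [hm, Rat.num_intCast]
  rw [h2] at hy'
  refine ⟨y, hy, ⟨L.pt y, ?_⟩, rfl, ?_⟩
  · have := (dualLattice G).sub_mem l.2 (evenLattice_le_dualLattice hy')
    rwa [sub_sub_cancel] at this
  · rw [eq_comm, disc_eq_iff]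
    exact hy'

omit hd in
open Classical in
/-- The function on the discriminant form that is given by the signs in the table. -/
def signFunction (γ : Disc G) : ℂ :=
  if h : ∃ p ∈ d.points, L.Represents p.1 γ then (h.choose.2 : ℂ) else 0

variable {L} (hs : d.IsSignTable)

include hs

/-- `sign_eq` makes the chosen sign independent of the representative. -/
lemma signFunction_eq {p : List ℤ × ℤ} (hp : p ∈ d.points) {γ : Disc G}
    (h : L.Represents p.1 γ) : L.signFunction γ = p.2 := by
  have h1 : ∃ p ∈ d.points, L.Represents p.1 γ := ⟨p, hp, h⟩
  rw [signFunction, dif_pos h1]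
  have h2 := hs.sign_eq
  simp only [List.all_eq_true, Bool.or_eq_true, Bool.not_eq_true', beq_iff_eq] at h2
  rcases h2 _ h1.choose_spec.1 p hp with h3 | h3
  · rw [h1.choose_spec.2.same hd h] at h3
    exact absurd h3 (by simp)
  · rw [h3]

omit hs hd in
lemma exists_of_signFunction_ne_zero {γ : Disc G} (h : L.signFunction γ ≠ 0) :
    ∃ p ∈ d.points, L.Represents p.1 γ := by
  by_contra h1
  exact h (by rw [signFunction, dif_neg h1])

omit hd in
lemma sign_ne_zero {p : List ℤ × ℤ} (hp : p ∈ d.points) : (p.2 : ℂ) ≠ 0 := by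
  rcases hs.sign p hp with h | h <;> simp [h]

/-- The support is described by `q` and multiples of `γ` alone, so `O(D)` preserves it. -/
lemma signFunction_ne_zero_iff (γ : Disc G) : L.signFunction γ ≠ 0 ↔ d.IsIntrinsic γ := by
  constructor
  · intro h
    obtain ⟨p, hp, h1⟩ := exists_of_signFunction_ne_zero h
    exact (h1.intrinsic_iff hd).mp (List.all_eq_true.mp hs.points_intrinsic p hp)
  · intro h
    obtain ⟨y, hy, h1⟩ := L.exists_represents hd hs γ
    have h2 := List.all_eq_true.mp hs.box_cases y hy
    rw [if_pos ((h1.intrinsic_iff hd).mpr h), List.any_eq_true] at h2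
    obtain ⟨p, hp, h3⟩ := h2
    rw [signFunction_eq hd hs hp (h1.of_same hd h3)]
    exact sign_ne_zero hs hp

lemma exists_represents_of_mem {p : List ℤ × ℤ} (hp : p ∈ d.points) :
    ∃ γ : Disc G, L.Represents p.1 γ :=
  ⟨_, ⟨⟨L.pt p.1, ((L.shadow_iff hd _).mp
    (List.all_eq_true.mp hs.points_shadow p hp)).mem_dualLattice⟩, rfl, rfl⟩⟩

omit hs in
lemma Represents.exists_discReflection {a b : List ℤ} {γ β : Disc G} (ha : L.Represents a γ)
    (hb : L.Represents b β) (h : d.reflected a b = true) : ∃ r, β = L.discReflection hd r γ := by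
  rw [SignTable.reflected, List.any_eq_true] at h
  obtain ⟨i, hi, h⟩ := h
  refine ⟨L.row.symm ⟨i, List.mem_range.mp hi⟩, hb.unique (Represents.of_same hd ?_ h)⟩
  have := ha.refl hd (L.row.symm ⟨i, List.mem_range.mp hi⟩)
  rwa [Equiv.apply_symm_apply] at this

/-- The class of the Weyl vector. -/
def weylVector (L : d.Realization G) : dualLattice G :=
  ⟨L.pt d.weyl, ((L.shadow_iff hd _).mp
    (List.all_eq_true.mp hs.points_shadow (d.weyl, 1) List.mem_cons_self)).mem_dualLattice⟩

lemma represents_weylVector : L.Represents d.weyl (L.weylVector hd hs : Disc G) :=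
  ⟨_, rfl, rfl⟩

lemma signFunction_weylVector : L.signFunction (L.weylVector hd hs : Disc G) = 1 := by
  rw [signFunction_eq hd hs (p := (d.weyl, 1)) List.mem_cons_self (represents_weylVector hd hs)]
  simp

/-- On the support, antisymmetry propagates the value from the Weyl vector along reflections.
Elsewhere `θ` vanishes because the class is not a shadow, or because it is fixed by a reflection and
so `θ = -θ` there. -/
lemma signFunction_unique {θ : Disc G → ℂ}
    (h1 : ∀ t σ (l l' : dualLattice G), IsSignedSymmetry G t σ → (l' : F → ℚ) = t l →
      θ l' = σ * θ l)
    (h2 : ∀ l : dualLattice G, ¬ IsShadow G (l : F → ℚ) → θ l = 0) (γ : Disc G) :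
    θ γ = θ (L.weylVector hd hs : Disc G) * L.signFunction γ := by
  have hθ (r : P) (γ : Disc G) : θ (L.discReflection hd r γ) = -θ γ := by
    induction γ using QuotientAddGroup.induction_on with | H l => ?_
    rw [discReflection_coe, h1 _ _ _ _ (L.isSignedSymmetry_reflection hd r) rfl]
    push_cast
    ring
  have hweyl : ∀ γ, L.Represents d.weyl γ →
      θ γ = θ (L.weylVector hd hs : Disc G) * (1 : ℤ) := by
    intro γ h
    rw [h.unique (represents_weylVector hd hs), Int.cast_one, mul_one]
  have horbit : ∀ p ∈ d.orbit, ∀ γ, L.Represents p.1 γ →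
      θ γ = θ (L.weylVector hd hs : Disc G) * p.2 := by
    refine isChain_induction (S := fun p => p ∈ d.points) ?_ hs.connected_refl ?_
      fun p hp => List.mem_cons_of_mem _ hp
    · intro p p' hp hp' h hq γ hγ
      rw [Bool.and_eq_true, beq_iff_eq] at h
      obtain ⟨β, hβ⟩ := exists_represents_of_mem hd hs (L := L) hp
      obtain ⟨r, rfl⟩ := hβ.exists_discReflection hd hγ h.2
      rw [hθ, hq _ hβ, h.1]
      push_cast
      ring
    · intro p hp
      rw [List.mem_singleton] at hp
      subst hp
      exact ⟨List.mem_cons_self, hweyl⟩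
  have hpoints : ∀ p ∈ d.points, ∀ γ, L.Represents p.1 γ →
      θ γ = θ (L.weylVector hd hs : Disc G) * p.2 := by
    intro p hp
    rcases List.mem_cons.mp hp with rfl | hp
    · exact hweyl
    · exact horbit p hp
  by_cases h0 : L.signFunction γ = 0
  · rw [h0, mul_zero]
    obtain ⟨y, hy, hyγ⟩ := L.exists_represents hd hs γ
    have h3 := List.all_eq_true.mp hs.box_cases y hy
    rw [if_neg (by rw [hyγ.intrinsic_iff hd, ← signFunction_ne_zero_iff (L := L) hd hs, h0]; simp),
      Bool.or_eq_true, Bool.not_eq_true', ← Bool.not_eq_true, L.shadow_iff hd] at h3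
    rcases h3 with h3 | h3
    · obtain ⟨l, hl, rfl⟩ := hyγ
      exact h2 l (by rwa [hl])
    · obtain ⟨r, hr⟩ := hyγ.exists_discReflection hd hyγ h3
      have h4 := hθ r γ
      rw [← hr] at h4
      exact self_eq_neg.mp h4
  · obtain ⟨p, hp, hpγ⟩ := exists_of_signFunction_ne_zero h0
    rw [signFunction_eq hd hs hp hpγ, hpoints p hp γ hpγ]

/-- Both `f` and `f ∘ σ` change sign along every adjacency, since `σ` preserves support and bilinear
form. The support is connected under adjacency, so their ratio is constant there, and it is `±1` at
the Weyl vector. -/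
lemma signFunction_invariant {σ : Equiv.Perm (Disc G)}
    (hσ : σ ∈ orthogonalGroup (discForm G)) :
    (∀ γ, L.signFunction (σ γ) = L.signFunction γ) ∨
      ∀ γ, L.signFunction (σ γ) = -L.signFunction γ := by
  set ρ : Disc G := (L.weylVector hd hs : Disc G) with hρ
  have hne (γ : Disc G) : L.signFunction (σ γ) ≠ 0 ↔ L.signFunction γ ≠ 0 := by
    rw [signFunction_ne_zero_iff hd hs, signFunction_ne_zero_iff hd hs, isIntrinsic_map hσ]
  have hpolar (γ β : Disc G) : QuadraticMap.polar (discForm G) (σ γ) (σ β) =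
      QuadraticMap.polar (discForm G) γ β := by
    rw [QuadraticMap.polar, QuadraticMap.polar, ← hσ.1, hσ.2, hσ.2, hσ.2]
  have hadj := hs.sign_adjacent
  simp only [List.all_eq_true, Bool.or_eq_true, Bool.not_eq_true', beq_iff_eq] at hadj
  have hadj' (p) (hp : p ∈ d.points) (p') (hp' : p' ∈ d.points)
      (h : d.adjacent p.1 p'.1 = true) : p'.2 = -p.2 :=
    (hadj p hp p' hp').resolve_left (by simp [h])
  have hweyl : ∀ γ, L.Represents d.weyl γ →
      L.signFunction (σ γ) = L.signFunction (σ ρ) * (1 : ℤ) := by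
    intro γ h
    rw [h.unique (represents_weylVector hd hs), Int.cast_one, mul_one]
  have horbit : ∀ p ∈ d.orbit, ∀ γ, L.Represents p.1 γ →
      L.signFunction (σ γ) = L.signFunction (σ ρ) * p.2 := by
    refine isChain_induction (S := fun p => p ∈ d.points) ?_ hs.connected_adjacent ?_
      fun p hp => List.mem_cons_of_mem _ hp
    · intro p p' hp hp' h hq γ hγ
      obtain ⟨β, hβ⟩ := exists_represents_of_mem hd hs (L := L) hp
      have e1 := signFunction_eq hd hs hp hβ
      have e2 := signFunction_eq hd hs hp' hγ
      obtain ⟨a, ha, haβ⟩ := exists_of_signFunction_ne_zero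
        ((hne β).mpr (by rw [e1]; exact sign_ne_zero hs hp))
      obtain ⟨b, hb, hbγ⟩ := exists_of_signFunction_ne_zero
        ((hne γ).mpr (by rw [e2]; exact sign_ne_zero hs hp'))
      have h3 := hadj' a ha b hb (Represents.adjacent hd hβ hγ haβ hbγ (hpolar β γ).symm h)
      have h4 := hq β hβ
      rw [signFunction_eq hd hs ha haβ] at h4
      rw [signFunction_eq hd hs hb hbγ, h3, hadj' p hp p' hp' h]
      push_cast
      rw [h4]
      ring
    · intro p hp
      rw [List.mem_singleton] at hp
      subst hp
      exact ⟨List.mem_cons_self, hweyl⟩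
  have hall (γ : Disc G) : L.signFunction (σ γ) = L.signFunction (σ ρ) * L.signFunction γ := by
    by_cases h0 : L.signFunction γ = 0
    · rw [h0, mul_zero]
      exact not_not.mp (mt (hne γ).mp (not_not.mpr h0))
    · obtain ⟨p, hp, hpγ⟩ := exists_of_signFunction_ne_zero h0
      rw [signFunction_eq hd hs hp hpγ]
      rcases List.mem_cons.mp hp with rfl | hp
      · exact hweyl γ hpγ
      · exact horbit p hp γ hpγ
  have h1 : L.signFunction ρ = 1 := signFunction_weylVector hd hs
  obtain ⟨p, hp, hpρ⟩ := exists_of_signFunction_ne_zero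
    ((hne ρ).mpr (by rw [h1]; exact one_ne_zero))
  rcases hs.sign p hp with h2 | h2
  · left
    intro γ
    rw [hall, signFunction_eq hd hs hp hpρ, h2]
    simp
  · right
    intro γ
    rw [hall, signFunction_eq hd hs hp hpρ, h2]
    simp

/-- The reflection in the first root acts by a global sign, which is detected at the Weyl vector. -/
lemma exists_signFunction_reversed : ∃ σ ∈ orthogonalGroup (discForm G),
    ∀ γ, L.signFunction (σ γ) = -L.signFunction γ := by
  let r : P := L.row.symm ⟨0, hd.rows_pos⟩
  have hσ := L.discReflection_mem_orthogonalGroup hd r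
  refine ⟨_, hσ, (signFunction_invariant hd hs hσ).resolve_left fun h => ?_⟩
  have h1 := h (L.weylVector hd hs : Disc G)
  change L.signFunction (L.discReflection hd r (L.weylVector hd hs : Disc G)) = _ at h1
  have h2 := hs.reversed
  rw [List.any_eq_true] at h2
  obtain ⟨p, hp, h2⟩ := h2
  rw [Bool.and_eq_true, beq_iff_eq] at h2
  have h3 := (represents_weylVector hd hs (L := L)).refl hd r
  rw [show ((L.row r : Fin _) : ℕ) = 0 by simp [r]] at h3
  rw [signFunction_weylVector, signFunction_eq hd hs hp (h3.of_same hd h2.2), h2.1] at h1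
  norm_num at h1

lemma isSignFunction (L : d.Realization G) : IsSignFunction G (L.weylVector hd hs) L.signFunction where
  norm_le := by
    have he := hd.denom_pos
    have he' : (0 : ℚ) < d.denom := by exact_mod_cast he
    have h := hs.form_weyl
    change RootTheta.form G (L.pt d.weyl) (L.pt d.weyl) ≤ 2
    rw [L.form_pt hd, div_le_iff₀ (by positivity)]
    exact_mod_cast h
  apply_rho := signFunction_weylVector hd hs
  isotropic γ h := ((signFunction_ne_zero_iff hd hs γ).mp h).1
  unique _ h1 h2 γ := signFunction_unique hd hs h1 h2 γ
  invariant _ hσ := signFunction_invariant hd hs hσ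
  reversed := exists_signFunction_reversed hd hs

/-- The main theorem for a matrix described by a table. -/
theorem main (L : d.Realization G) :
    ∃ W : Representation ℂ SL(2, ℤ) (Disc G →₀ ℂ), IsWeilRepresentation (discForm G) W ∧
      ∃ θ : ℍ → (Disc G →₀ ℂ), IsHolomorphicModularForm (discForm G) W 0 θ ∧
        CorrespondsToThetaBlock G θ ∧
        (∀ θ' : ℍ → (Disc G →₀ ℂ), CorrespondsToThetaBlock G θ' → θ' = θ) ∧
        ∃ χ : orthogonalGroup (discForm G) →* ℂˣ, orderOf χ = 2 ∧
          ∀ (σ : orthogonalGroup (discForm G)) (τ : ℍ),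
            act (σ : Equiv.Perm _) (θ τ) = (χ σ : ℂ) • θ τ := by
  classical
  refine (L.hasUnitRows hd).main ?_ (k := d.dim / 2) ?_ (L.isSignFunction hd hs)
  · rw [L.card_col, L.card_row, hd.dim_add]
  · rw [L.card_col]
    have := hd.dim_even
    omega

end SignTable.Realization

end RootTheta

end

noncomputable section

namespace RootTheta

/-! ### Recovering the positive roots from the Cartan matrix. -/

section Coefficients

variable {ι V W : Type*} [Finite ι] [AddCommGroup V] [Module ℝ V] [AddCommGroup W] [Module ℝ W]
  {R : RootPairing ι ℝ V W} [R.IsCrystallographic] [R.IsReduced] {b : R.Base} {d : SignTable}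
  (s : Fin d.dim ≃ b.support)

/-- The linear combination of the simple roots with coefficients given by a list. -/
def rootComb (a : List ℤ) : V := ∑ k : Fin d.dim, a.getD k 0 • R.root (s k)

omit [Finite ι] [R.IsCrystallographic] [R.IsReduced] in
lemma rootComb_addSmul (c : ℤ) (x y : List ℤ) :
    rootComb s (addSmul c x y) = rootComb s x + c • rootComb s y := by
  simp only [rootComb, getD_addSmul, add_smul, mul_smul, Finset.sum_add_distrib, Finset.smul_sum]

omit [Finite ι] [R.IsCrystallographic] [R.IsReduced] in
lemma rootComb_map (c : ℤ) (x : List ℤ) : rootComb s (x.map (c * ·)) = c • rootComb s x := by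
  simp only [rootComb, getD_map_mul, mul_smul, Finset.smul_sum]

omit [Finite ι] [R.IsCrystallographic] [R.IsReduced] in
lemma repr_of_root_eq {i : ι} {a : List ℤ} (h : R.root i = rootComb s a) (k : Fin d.dim) :
    b.toWeightBasisInt.repr (R.rootSpanMem ℤ i) (s k) = a.getD k 0 := by
  have h1 : R.rootSpanMem ℤ i = ∑ f : b.support, a.getD (s.symm f) 0 • b.toWeightBasisInt f := by
    apply Subtype.ext
    rw [AddSubmonoidClass.coe_finsetSum]
    change R.root i = _
    rw [h, rootComb, ← Equiv.sum_comp s]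
    refine Finset.sum_congr rfl fun k _ => ?_
    rw [Equiv.symm_apply_apply]
    simp
  rw [h1, b.toWeightBasisInt.repr_sum_self]
  simp

omit [Finite ι] [R.IsCrystallographic] [R.IsReduced] in
lemma height_of_root_eq {i : ι} {a : List ℤ} (h : R.root i = rootComb s a) :
    b.height i = ∑ k : Fin d.dim, a.getD k 0 := by
  classical
  let f : ι → ℤ := fun j => if hj : j ∈ b.support then a.getD (s.symm ⟨j, hj⟩) 0 else 0
  have hf (j : b.support) : f j = a.getD (s.symm j) 0 := by simp [f]
  rw [RootPairing.Base.height_eq_sum (f := f)]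
  · rw [← Finset.sum_coe_sort b.support f, ← Equiv.sum_comp s]
    simp [hf]
  · rw [h, rootComb, ← Finset.sum_coe_sort b.support (fun j => f j • R.root j), ← Equiv.sum_comp s]
    simp [hf]

variable (hd : d.IsRootTable)
  (hs : ∀ i j, b.cartanMatrix (s i) (s j) = (d.coroots.getD j []).getD i 0)

include hd hs

omit [Finite ι] [R.IsReduced] in
lemma root_reflectionPerm_eq {i : ι} {a : List ℤ} (ha : a.length ≤ d.dim)
    (h : R.root i = rootComb s a) (j : Fin d.dim) :
    R.root (R.reflectionPerm (s j) i) = rootComb s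
      (addSmul (-dot a (d.coroots.getD j [])) a (d.rows.getD j [])) := by
  have h1 : rootComb s (d.rows.getD j []) = R.root (s j) := by
    rw [rootComb, Finset.sum_eq_single j]
    · rw [hd.row_unit _ j.2 _ j.2, if_pos rfl, one_smul]
    · intro k _ hk
      rw [hd.row_unit _ j.2 _ k.2, if_neg fun h => hk (Fin.ext h), zero_smul]
    · simp
  have h2 : R.pairing i (s j) = (dot a (d.coroots.getD j []) : ℤ) := by
    rw [← RootPairing.root_coroot_eq_pairing, h, rootComb, map_sum, LinearMap.sum_apply,
      dot_eq_sum ha]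
    push_cast
    refine Finset.sum_congr rfl fun k _ => ?_
    rw [map_zsmul, LinearMap.smul_apply, RootPairing.root_coroot_eq_pairing, ← hs, zsmul_eq_mul]
    congr 1
    exact (R.algebraMap_pairingIn ℤ (s k) (s j)).symm
  rw [R.root_reflectionPerm, R.reflection_apply_root, rootComb_addSmul, h1, h, h2, neg_smul,
    ← sub_eq_add_neg, Int.cast_smul_eq_zsmul]

omit [Finite ι] [R.IsReduced] hs in
lemma length_row_le (a : ℕ) : (d.rows.getD a []).length ≤ d.dim := by
  rcases lt_or_ge a d.rows.length with h | h
  · rw [List.getD_eq_getElem _ _ h]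
    exact hd.length_le _ (List.getElem_mem _)
  · rw [List.getD_eq_default _ _ h]
    simp

omit [Finite ι] [R.IsReduced] in
lemma exists_root_eq_row (a : ℕ) (ha : a < d.rows.length) :
    ∃ i, R.root i = rootComb s (d.rows.getD a []) := by
  induction a using Nat.strong_induction_on with | _ a ih => ?_
  rcases lt_or_ge a d.dim with h | h
  · refine ⟨s ⟨a, h⟩, ?_⟩
    rw [rootComb, Finset.sum_eq_single ⟨a, h⟩]
    · rw [hd.row_unit _ h _ h, if_pos rfl, one_smul]
    · intro k _ hk
      rw [hd.row_unit _ h _ k.2, if_neg fun h => hk (Fin.ext h), zero_smul]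
    · simp
  · obtain ⟨a', ha', j, hj, h1⟩ := hd.reachable a ha h
    rw [List.mem_range] at ha' hj
    obtain ⟨i, hi⟩ := ih a' ha' (ha'.trans ha)
    refine ⟨R.reflectionPerm (s ⟨j, hj⟩) i, ?_⟩
    rw [root_reflectionPerm_eq s hd hs (length_row_le hd a') hi, ← h1]
    rfl

omit [Finite ι] [R.IsReduced] hs in
lemma sum_row_pos {a : ℕ} (ha : a < d.rows.length) :
    0 < ∑ k : Fin d.dim, (d.rows.getD a []).getD k 0 := by
  have h := hd.height_pos a ha
  rw [dot_eq_sum (length_row_le hd a)] at h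
  simpa using h

/-- Simple reflections generate the positive roots from the simple ones, and the rows are closed
under these reflections up to sign. Since rows have positive height, a positive root cannot be the
negative of a row. -/
lemma exists_row_of_isPos {i : ι} (hi : b.IsPos i) :
    ∃ a < d.rows.length, R.root i = rootComb s (d.rows.getD a []) := by
  have key : ∃ a < d.rows.length, ∃ ε : ℤ, (ε = 1 ∨ ε = -1) ∧
      R.root i = rootComb s ((d.rows.getD a []).map (ε * ·)) := by
    refine hi.induction_on_reflect (p := fun i => ∃ a < d.rows.length, ∃ ε : ℤ,
      (ε = 1 ∨ ε = -1) ∧ R.root i = rootComb s ((d.rows.getD a []).map (ε * ·))) ?_ ?_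
    · intro i hi
      have h := (s.symm ⟨i, hi⟩).2
      refine ⟨s.symm ⟨i, hi⟩, h.trans_le hd.dim_le, 1, Or.inl rfl, ?_⟩
      rw [rootComb_map, one_smul, rootComb, Finset.sum_eq_single (s.symm ⟨i, hi⟩)]
      · rw [hd.row_unit _ h _ h, if_pos rfl, one_smul, Equiv.apply_symm_apply]
      · intro k _ hk
        rw [hd.row_unit _ h _ k.2, if_neg fun h => hk (Fin.ext h), zero_smul]
      · simp
    · rintro i j ⟨a, ha, ε, hε, h⟩ hj
      obtain ⟨j, rfl⟩ : ∃ k, (s k : ι) = j := ⟨s.symm ⟨j, hj⟩, by simp⟩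
      have hjN := j.2.trans_le hd.dim_le
      obtain ⟨h1, h2⟩ := hd.image_eq j hjN a ha
      have hσ : d.imageSign j a = 1 ∨ d.imageSign j a = -1 := by
        rw [SignTable.imageSign]
        split_ifs <;> simp
      refine ⟨d.imageIdx j a, h1, ε * d.imageSign j a, ?_, ?_⟩
      · rcases hε with rfl | rfl <;> rcases hσ with h | h <;> simp [h]
      · have h3 : dot ((d.rows.getD a []).map (ε * ·)) (d.coroots.getD j []) =
            ε * dot (d.rows.getD a []) (d.coroots.getD j []) := by
          rw [dot_eq_sum (n := d.dim) (by simpa using length_row_le hd a),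
            dot_eq_sum (length_row_le hd a), Finset.mul_sum]
          exact Finset.sum_congr rfl fun k _ => by rw [getD_map_mul, mul_assoc]
        rw [root_reflectionPerm_eq s hd hs (by simpa using length_row_le hd a) h, h2, rootComb_map,
          rootComb_map, SignTable.image, rootComb_addSmul, rootComb_addSmul, rootComb_map, h3]
        rcases hσ with h | h <;> rw [h] <;> module
  obtain ⟨a, ha, ε, hε, h⟩ := key
  refine ⟨a, ha, ?_⟩
  rcases hε with rfl | rfl
  · rwa [rootComb_map, one_smul] at h
  · have h1 := height_of_root_eq s h
    simp only [getD_map_mul, ← Finset.mul_sum] at h1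
    have h2 := sum_row_pos hd ha
    have h3 : 0 < b.height i := hi
    omega

/-- The matrix of coefficients of positive roots is described by the table. -/
theorem nonempty_realization : Nonempty (d.Realization (posRootCoeff b)) := by
  choose φ hφ using fun a : Fin d.rows.length => exists_root_eq_row s hd hs a a.2
  have hpos (a : Fin d.rows.length) : b.IsPos (φ a) := by
    rw [RootPairing.Base.isPos_iff, height_of_root_eq s (hφ a)]
    exact sum_row_pos hd a.2
  let ψ (a : Fin d.rows.length) : PosRoot b := ⟨φ a, hpos a⟩
  have hinj : Function.Injective ψ := by
    intro a a' h
    have h1 : φ a = φ a' := congrArg Subtype.val h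
    refine Fin.ext (hd.row_injective a a.2 a' a'.2 fun k hk => ?_)
    rw [← repr_of_root_eq s (hφ a) ⟨k, hk⟩, ← repr_of_root_eq s (hφ a') ⟨k, hk⟩, h1]
  have hsurj : Function.Surjective ψ := by
    rintro ⟨i, hi⟩
    obtain ⟨a, ha, h⟩ := exists_row_of_isPos s hd hs hi
    refine ⟨⟨a, ha⟩, Subtype.ext (R.root.injective ?_)⟩
    rw [h]
    exact hφ ⟨a, ha⟩
  refine ⟨⟨s.symm, (Equiv.ofBijective ψ ⟨hinj, hsurj⟩).symm, fun r f => ?_⟩⟩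
  obtain ⟨a, rfl⟩ := hsurj r
  obtain ⟨k, rfl⟩ := s.surjective f
  have h1 : (Equiv.ofBijective ψ ⟨hinj, hsurj⟩).symm (ψ a) = a :=
    Equiv.ofBijective_symm_apply_apply ψ ⟨hinj, hsurj⟩ a
  rw [h1, Equiv.symm_apply_apply]
  exact repr_of_root_eq s (hφ a) k

omit hs in
theorem exists_realization {m : Type} {C : Matrix m m ℤ} (hC : HasCartanMatrix b C)
    {n : ℕ} (e : m ≃ Fin n) (hn : n = d.dim)
    (h : ∀ i j, (C i j == (d.coroots.getD (e j) []).getD (e i) 0) = true) :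
    Nonempty (d.Realization (posRootCoeff b)) := by
  subst hn
  obtain ⟨s, hs⟩ := hC
  refine nonempty_realization (e.symm.trans s) hd fun i j => ?_
  rw [Equiv.trans_apply, Equiv.trans_apply, hs, beq_iff_eq.mp (h _ _), Equiv.apply_symm_apply, Equiv.apply_symm_apply]

end Coefficients

end RootTheta

end

noncomputable section

/-! ### The eight tables and their verification. -/

namespace RootTheta

/-- The table for `A₄`. -/
def tableA4 : SignTable where
  dim := 4
  rows :=
    [[1, 0, 0, 0], [0, 1, 0, 0], [0, 0, 1, 0], [0, 0, 0, 1], [1, 1, 0, 0], [0, 1, 1, 0], [0, 0,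
     1, 1], [1, 1, 1, 0], [0, 1, 1, 1], [1, 1, 1, 1]]
  gram :=
    [[4, 3, 2, 1], [3, 6, 4, 2], [2, 4, 6, 3], [1, 2, 3, 4]]
  coroots :=
    [[2, -1, 0, 0], [-1, 2, -1, 0], [0, -1, 2, -1], [0, 0, -1, 2], [1, 1, -1, 0], [-1, 1, 1,
     -1], [0, -1, 1, 1], [1, 0, 1, -1], [-1, 1, 0, 1], [1, 0, 0, 1]]
  denom := 5
  basis :=
    [(1, [1, 0, 0, 0], [0, 0, 0, 5]), (5, [2, -1, 0, 0], [1, 0, 0, -4]), (5, [-1, 2, -1, 0], [0,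
     1, 0, -3]), (5, [0, -1, 2, -1], [0, 0, 1, -2])]
  weyl := [1, 1, 1, 1]
  orbit :=
    [([-1, 2, 1, 1], -1), ([2, -1, 2, 1], -1), ([1, 2, -1, 2], -1), ([1, 1, 2, -1], -1), ([1,
     -2, 3, 1], 1), ([-1, 3, -1, 2], 1), ([-1, 2, 2, -1], 1), ([-2, 1, 2, 1], 1), ([2, 1, -2,
     3], 1), ([2, -1, 3, -1], 1), ([3, -2, 1, 2], 1), ([1, 2, 1, -2], 1), ([-1, -1, 3, 1], -1),
     ([1, -2, 4, -1], -1), ([2, -3, 2, 2], -1), ([-1, 3, 1, -2], -1), ([-2, 3, -2, 3], -1),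
     ([-2, 1, 3, -1], -1), ([3, -1, -1, 3], -1), ([2, 1, 1, -3], -1), ([-1, -1, 4, -1], 1),
     ([-2, -1, 2, 2], 1), ([2, -3, 4, -2], 1)]
  pairings := [20]
  orders := [1]

/-- The table for `A₁ ⊕ B₃`. -/
def tableA1B3 : SignTable where
  dim := 4
  rows :=
    [[1, 0, 0, 0], [0, 1, 0, 0], [0, 0, 1, 0], [0, 0, 0, 1], [0, 1, 1, 0], [0, 0, 1, 2], [0, 0,
     1, 1], [0, 1, 1, 2], [0, 1, 1, 1], [0, 1, 2, 2]]
  gram :=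
    [[1, 0, 0, 0], [0, 5, 5, 5], [0, 5, 10, 10], [0, 5, 10, 15]]
  coroots :=
    [[2, 0, 0, 0], [0, 2, -1, 0], [0, -1, 2, -1], [0, 0, -2, 2], [0, 1, 1, -1], [0, -1, 0, 1],
     [0, -2, 2, 0], [0, 1, -1, 1], [0, 2, 0, 0], [0, 0, 1, 0]]
  denom := 10
  basis :=
    [(1, [-6, 0, -1, 0], [-10, 10, 0, 0]), (5, [5, 1, 0, 0], [-20, 20, 2, 0]), (10, [-10, -4, 2,
     0], [-5, 4, 0, 1]), (10, [5, 2, -2, 1], [0, 0, -2, 2])]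
  weyl := [5, 2, 2, 1]
  orbit :=
    [([5, -2, 4, 1], -1), ([5, 4, -2, 3], -1), ([5, 2, 4, -1], -1), ([-5, -2, 4, 1], 1), ([-5,
     2, 2, 1], -1), ([-5, 4, -2, 3], 1), ([-5, 2, 4, -1], 1), ([5, 2, -4, 5], 1), ([5, -2, 6,
     -1], 1), ([5, -4, 2, 3], 1), ([5, 4, 4, -3], 1), ([5, 6, -4, 3], 1), ([-5, 2, -4, 5], -1),
     ([-5, -2, 6, -1], -1), ([-5, -4, 2, 3], -1), ([-5, 4, 4, -3], -1), ([-5, 6, -4, 3], -1),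
     ([5, -2, -2, 5], -1), ([5, 4, -6, 5], -1), ([5, -4, 8, -3], -1), ([5, 8, -4, 1], -1), ([5,
     -6, 2, 3], -1), ([5, 6, 2, -3], -1), ([-5, -2, -2, 5], 1), ([-5, 4, -6, 5], 1), ([-5, -4,
     8, -3], 1), ([-5, 8, -4, 1], 1), ([-5, -6, 2, 3], 1), ([-5, 6, 2, -3], 1), ([5, -4, -2, 5],
     1), ([5, 4, -8, 5], 1), ([5, -8, 4, 1], 1), ([5, 8, -2, -1], 1), ([5, -6, 8, -3], 1), ([-5,
     -4, -2, 5], -1), ([-5, 4, -8, 5], -1), ([-5, -8, 4, 1], -1), ([-5, 8, -2, -1], -1), ([-5,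
     -6, 8, -3], -1), ([5, -4, -4, 5], -1), ([5, -8, 6, -1], -1), ([5, 2, -8, 5], -1), ([-5, -4,
     -4, 5], 1), ([-5, -8, 6, -1], 1), ([-5, 2, -8, 5], 1), ([5, -2, -6, 5], 1), ([-5, -2, -6,
     5], -1)]
  pairings := [80, 90]
  orders := [2, 5]

/-- The table for `A₁ ⊕ C₃`. -/
def tableA1C3 : SignTable where
  dim := 4
  rows :=
    [[1, 0, 0, 0], [0, 1, 0, 0], [0, 0, 1, 0], [0, 0, 0, 1], [0, 1, 1, 0], [0, 0, 1, 1], [0, 0,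
     2, 1], [0, 1, 1, 1], [0, 2, 2, 1], [0, 1, 2, 1]]
  gram :=
    [[1, 0, 0, 0], [0, 8, 8, 4], [0, 8, 16, 8], [0, 4, 8, 6]]
  coroots :=
    [[2, 0, 0, 0], [0, 2, -1, 0], [0, -1, 2, -2], [0, 0, -1, 2], [0, 1, 1, -2], [0, -1, 0, 2],
     [0, -1, 1, 0], [0, 1, -1, 2], [0, 1, 0, 0], [0, 0, 1, 0]]
  denom := 8
  basis :=
    [(2, [2, 0, 0, 1], [-8, 0, 0, 4]), (4, [-6, 0, 0, -2], [-4, 2, 0, 0]), (8, [4, 0, 1, 0], [0,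
     3, 0, -2]), (8, [0, -1, 2, -2], [0, -2, 1, 0])]
  weyl := [4, 1, 1, 2]
  orbit :=
    [([4, -1, 2, 2], -1), ([4, 2, -1, 4], -1), ([4, 1, -2, 6], 1), ([4, 1, 3, -2], -1), ([-4, 2,
     -1, 4], 1), ([-4, 1, 1, 2], -1), ([-4, -1, 2, 2], 1), ([-4, 1, 3, -2], 1), ([4, -1, 4, -2],
     1), ([4, -2, 1, 4], 1), ([4, 2, 3, -4], 1), ([4, 4, -3, 4], 1), ([-4, 1, -2, 6], -1), ([-4,
     -1, 4, -2], -1), ([-4, -2, 1, 4], -1), ([-4, 2, 3, -4], -1), ([-4, 4, -3, 4], -1), ([4, -1,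
     -1, 6], -1), ([4, 1, 4, -6], -1), ([4, 3, -4, 6], -1), ([4, -2, 5, -4], -1), ([4, 5, -3,
     2], -1), ([4, -4, 1, 4], -1), ([-4, -1, -1, 6], 1), ([-4, 1, 4, -6], 1), ([-4, 3, -4, 6],
     1), ([-4, -2, 5, -4], 1), ([-4, 5, -3, 2], 1), ([-4, -4, 1, 4], 1), ([4, -1, 5, -6], 1),
     ([4, 5, -4, 2], 1), ([4, -3, -1, 6], 1), ([4, 3, 2, -6], 1), ([4, 3, -5, 6], 1), ([-4, -1,
     5, -6], -1), ([-4, 5, -4, 2], -1), ([-4, -3, -1, 6], -1), ([-4, 3, 2, -6], -1), ([-4, 3,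
     -5, 6], -1), ([4, 4, -5, 4], -1), ([4, -5, 1, 2], -1), ([4, 5, -2, -2], -1), ([-4, 4, -5,
     4], 1), ([-4, -5, 1, 2], 1), ([-4, 5, -2, -2], 1), ([4, -4, -1, 4], 1), ([-4, -4, -1, 4],
     -1)]
  pairings := [56]
  orders := [4]

/-- The table for `B₂ ⊕ G₂`. -/
def tableB2G2 : SignTable where
  dim := 4
  rows :=
    [[1, 0, 0, 0], [0, 1, 0, 0], [0, 0, 1, 0], [0, 0, 0, 1], [1, 2, 0, 0], [1, 1, 0, 0], [0, 0,
     1, 3], [0, 0, 1, 1], [0, 0, 2, 3], [0, 0, 1, 2]]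
  gram :=
    [[3, 3, 0, 0], [3, 6, 0, 0], [0, 0, 8, 12], [0, 0, 12, 24]]
  coroots :=
    [[2, -1, 0, 0], [-2, 2, 0, 0], [0, 0, 2, -1], [0, 0, -3, 2], [0, 1, 0, 0], [2, 0, 0, 0], [0,
     0, -1, 1], [0, 0, 3, -1], [0, 0, 1, 0], [0, 0, 0, 1]]
  denom := 12
  basis :=
    [(2, [2, 0, 1, 0], [0, -6, 6, 0]), (6, [2, -1, 0, 0], [4, -4, 0, 0]), (12, [-8, 0, -3, 0],
     [0, -2, 0, 1]), (12, [4, 0, 0, 1], [0, 0, -3, 2])]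
  weyl := [4, 2, 3, 1]
  orbit :=
    [([4, 2, 6, -1], -1), ([4, 2, -9, 4], 1), ([-4, 6, 3, 1], -1), ([8, -2, 3, 1], -1), ([8, -6,
     3, 1], 1), ([4, 2, -3, 4], -1), ([-4, 6, -3, 4], 1), ([-4, 6, 6, -1], 1), ([-8, 6, 3, 1],
     1), ([8, -2, -3, 4], 1), ([8, -2, 6, -1], 1), ([4, 2, 9, -4], 1), ([4, 2, -6, 5], 1), ([-8,
     2, 3, 1], -1), ([8, -6, -3, 4], -1), ([8, -6, 6, -1], -1), ([-4, 6, 9, -4], -1), ([-4, 6,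
     -6, 5], -1), ([4, -6, 3, 1], -1), ([-8, 6, -3, 4], -1), ([-8, 6, 6, -1], -1), ([8, -2, 9,
     -4], -1), ([8, -2, -6, 5], -1), ([4, 2, -9, 5], -1), ([4, 2, 9, -5], -1), ([-4, -2, 3, 1],
     1), ([-8, 2, -3, 4], 1), ([-8, 2, 6, -1], 1), ([8, -6, 9, -4], 1), ([8, -6, -6, 5], 1),
     ([-4, 6, -9, 5], 1), ([-4, 6, 9, -5], 1), ([4, -6, -3, 4], 1), ([4, -6, 6, -1], 1), ([-8,
     6, 9, -4], 1), ([-8, 6, -6, 5], 1), ([8, -2, -9, 5], 1), ([8, -2, 9, -5], 1), ([4, 2, 6,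
     -5], 1), ([-4, -2, -3, 4], -1), ([-4, -2, 6, -1], -1), ([-8, 2, 9, -4], -1), ([-8, 2, -6,
     5], -1), ([8, -6, -9, 5], -1), ([8, -6, 9, -5], -1), ([-4, 6, 6, -5], -1), ([-4, 6, -9, 4],
     -1), ([4, -6, 9, -4], -1), ([4, -6, -6, 5], -1), ([-8, 6, -9, 5], -1), ([-8, 6, 9, -5],
     -1), ([8, -2, 6, -5], -1), ([8, -2, -9, 4], -1), ([4, 2, -6, 1], -1), ([4, 2, 3, -4], -1),
     ([-4, -2, 9, -4], 1), ([-4, -2, -6, 5], 1), ([-8, 2, -9, 5], 1), ([-8, 2, 9, -5], 1), ([8,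
     -6, 6, -5], 1), ([8, -6, -9, 4], 1), ([-4, 6, -6, 1], 1), ([-4, 6, 3, -4], 1), ([4, -6, -9,
     5], 1), ([4, -6, 9, -5], 1), ([-8, 6, 6, -5], 1), ([-8, 6, -9, 4], 1), ([8, -2, -6, 1], 1),
     ([8, -2, 3, -4], 1), ([4, 2, -3, -1], 1), ([-4, -2, -9, 5], -1), ([-4, -2, 9, -5], -1),
     ([-8, 2, 6, -5], -1), ([-8, 2, -9, 4], -1), ([8, -6, -6, 1], -1), ([8, -6, 3, -4], -1),
     ([-4, 6, -3, -1], -1), ([4, -6, 6, -5], -1), ([4, -6, -9, 4], -1), ([-8, 6, -6, 1], -1),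
     ([-8, 6, 3, -4], -1), ([8, -2, -3, -1], -1), ([-4, -2, 6, -5], 1), ([-4, -2, -9, 4], 1),
     ([-8, 2, -6, 1], 1), ([-8, 2, 3, -4], 1), ([8, -6, -3, -1], 1), ([4, -6, -6, 1], 1), ([4,
     -6, 3, -4], 1), ([-8, 6, -3, -1], 1), ([-4, -2, -6, 1], -1), ([-4, -2, 3, -4], -1), ([-8,
     2, -3, -1], -1), ([4, -6, -3, -1], -1), ([-4, -2, -3, -1], 1)]
  pairings := [132, 12]
  orders := [4, 6]

/-- The table for `3A₂`. -/
def table3A2 : SignTable where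
  dim := 6
  rows :=
    [[1, 0, 0, 0, 0, 0], [0, 1, 0, 0, 0, 0], [0, 0, 1, 0, 0, 0], [0, 0, 0, 1, 0, 0], [0, 0, 0,
     0, 1, 0], [0, 0, 0, 0, 0, 1], [1, 1, 0, 0, 0, 0], [0, 0, 1, 1, 0, 0], [0, 0, 0, 0, 1, 1]]
  gram :=
    [[2, 1, 0, 0, 0, 0], [1, 2, 0, 0, 0, 0], [0, 0, 2, 1, 0, 0], [0, 0, 1, 2, 0, 0], [0, 0, 0,
     0, 2, 1], [0, 0, 0, 0, 1, 2]]
  coroots :=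
    [[2, -1, 0, 0, 0, 0], [-1, 2, 0, 0, 0, 0], [0, 0, 2, -1, 0, 0], [0, 0, -1, 2, 0, 0], [0, 0,
     0, 0, 2, -1], [0, 0, 0, 0, -1, 2], [1, 1, 0, 0, 0, 0], [0, 0, 1, 1, 0, 0], [0, 0, 0, 0, 1,
     1]]
  denom := 3
  basis :=
    [(1, [1, 0, 0, 0, 0, 0], [0, 3, 0, 0, 0, 0]), (1, [0, 0, 1, 0, 0, 0], [0, 0, 0, 3, 0, 0]),
     (1, [0, 0, 0, 0, 1, 0], [0, 0, 0, 0, 0, 3]), (3, [0, 0, 2, -1, 0, 0], [0, 0, 1, -2, 0, 0]),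
     (3, [2, -1, 0, 0, 0, 0], [1, -2, 0, 0, 0, 0]), (3, [0, 0, 0, 0, 2, -1], [0, 0, 0, 0, 1,
     -2])]
  weyl := [1, 1, 1, 1, 1, 1]
  orbit :=
    [([-1, 2, 1, 1, 1, 1], -1), ([1, 1, -1, 2, 1, 1], -1), ([1, 1, 1, 1, -1, 2], -1), ([-1, 2,
     -1, 2, 1, 1], 1), ([-1, 2, 1, 1, -1, 2], 1), ([1, 1, -1, 2, -1, 2], 1), ([-1, 2, -1, 2, -1,
     2], -1)]
  pairings := [6]
  orders := [1]

/-- The table for `3A₁ ⊕ A₃`. -/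
def table3A1A3 : SignTable where
  dim := 6
  rows :=
    [[1, 0, 0, 0, 0, 0], [0, 1, 0, 0, 0, 0], [0, 0, 1, 0, 0, 0], [0, 0, 0, 1, 0, 0], [0, 0, 0,
     0, 1, 0], [0, 0, 0, 0, 0, 1], [0, 0, 0, 1, 1, 0], [0, 0, 0, 0, 1, 1], [0, 0, 0, 1, 1, 1]]
  gram :=
    [[1, 0, 0, 0, 0, 0], [0, 1, 0, 0, 0, 0], [0, 0, 1, 0, 0, 0], [0, 0, 0, 3, 2, 1], [0, 0, 0,
     2, 4, 2], [0, 0, 0, 1, 2, 3]]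
  coroots :=
    [[2, 0, 0, 0, 0, 0], [0, 2, 0, 0, 0, 0], [0, 0, 2, 0, 0, 0], [0, 0, 0, 2, -1, 0], [0, 0, 0,
     -1, 2, -1], [0, 0, 0, 0, -1, 2], [0, 0, 0, 1, 1, -1], [0, 0, 0, -1, 1, 1], [0, 0, 0, 1, 0,
     1]]
  denom := 4
  basis :=
    [(1, [-1, 1, 0, 0, 0, 0], [-4, 0, 4, 0, 0, 0]), (1, [-1, 2, -1, 0, 0, 0], [0, 0, -4, 4, 0,
     0]), (2, [0, 2, 0, 0, 0, 0], [2, 2, 2, -6, 0, 0]), (2, [3, 3, 3, 1, 0, 0], [0, 0, 0, 0, 2,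
     0]), (4, [-4, -4, -4, -2, 1, 0], [0, 0, 0, -1, 1, 1]), (4, [2, 2, 2, 1, -1, 1], [0, 0, 0,
     0, -1, 2])]
  weyl := [2, 2, 2, 1, 1, 1]
  orbit :=
    [([2, 2, 2, -1, 2, 1], -1), ([2, 2, 2, 2, -1, 2], -1), ([2, 2, 2, 1, 2, -1], -1), ([-2, 2,
     2, -1, 2, 1], 1), ([-2, 2, 2, 1, 1, 1], -1), ([-2, 2, 2, 2, -1, 2], 1), ([-2, 2, 2, 1, 2,
     -1], 1), ([2, 2, 2, -1, 3, -1], 1), ([2, 2, 2, -2, 1, 2], 1), ([-2, 2, 2, -1, 3, -1], -1),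
     ([-2, 2, 2, -2, 1, 2], -1)]
  pairings := [12]
  orders := [2]

/-- The table for `2A₁ ⊕ A₂ ⊕ B₂`. -/
def table2A1A2B2 : SignTable where
  dim := 6
  rows :=
    [[1, 0, 0, 0, 0, 0], [0, 1, 0, 0, 0, 0], [0, 0, 1, 0, 0, 0], [0, 0, 0, 1, 0, 0], [0, 0, 0,
     0, 1, 0], [0, 0, 0, 0, 0, 1], [0, 0, 1, 1, 0, 0], [0, 0, 0, 0, 1, 2], [0, 0, 0, 0, 1, 1]]
  gram :=
    [[1, 0, 0, 0, 0, 0], [0, 1, 0, 0, 0, 0], [0, 0, 2, 1, 0, 0], [0, 0, 1, 2, 0, 0], [0, 0, 0,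
     0, 3, 3], [0, 0, 0, 0, 3, 6]]
  coroots :=
    [[2, 0, 0, 0, 0, 0], [0, 2, 0, 0, 0, 0], [0, 0, 2, -1, 0, 0], [0, 0, -1, 2, 0, 0], [0, 0, 0,
     0, 2, -1], [0, 0, 0, 0, -2, 2], [0, 0, 1, 1, 0, 0], [0, 0, 0, 0, 0, 1], [0, 0, 0, 0, 2, 0]]
  denom := 6
  basis :=
    [(1, [-1, 1, 0, 0, 0, 0], [-6, 0, 0, 0, 6, 0]), (1, [0, 0, 1, 0, 0, 0], [0, 0, 0, 6, 0, 0]),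
     (1, [3, 4, 0, 0, 1, 0], [6, 6, 0, 0, -12, 0]), (3, [0, 0, 2, -1, 0, 0], [0, 0, 2, -4, 0,
     0]), (6, [6, 6, 0, 0, 2, 0], [-3, -3, 0, 0, 6, 1]), (6, [3, 3, 0, 0, 2, -1], [0, 0, 0, 0,
     2, -2])]
  weyl := [3, 3, 2, 2, 2, 1]
  orbit :=
    [([3, 3, -2, 4, 2, 1], -1), ([3, 3, 2, 2, -2, 3], -1), ([3, 3, 2, 2, 4, -1], -1), ([-3, 3,
     -2, 4, 2, 1], 1), ([-3, 3, 2, 2, 2, 1], -1), ([-3, 3, 2, 2, -2, 3], 1), ([-3, 3, 2, 2, 4,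
     -1], 1), ([3, 3, -2, 4, -2, 3], 1), ([3, 3, -2, 4, 4, -1], 1), ([3, 3, 2, 2, -4, 3], 1),
     ([-3, 3, -2, 4, -2, 3], -1), ([-3, 3, -2, 4, 4, -1], -1), ([-3, 3, 2, 2, -4, 3], -1), ([3,
     3, -2, 4, -4, 3], -1), ([-3, 3, -2, 4, -4, 3], 1)]
  pairings := [24, 30]
  orders := [2, 3]

/-- The table for `8A₁`. -/
def table8A1 : SignTable where
  dim := 8
  rows :=
    [[1, 0, 0, 0, 0, 0, 0, 0], [0, 1, 0, 0, 0, 0, 0, 0], [0, 0, 1, 0, 0, 0, 0, 0], [0, 0, 0, 1,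
     0, 0, 0, 0], [0, 0, 0, 0, 1, 0, 0, 0], [0, 0, 0, 0, 0, 1, 0, 0], [0, 0, 0, 0, 0, 0, 1, 0],
     [0, 0, 0, 0, 0, 0, 0, 1]]
  gram :=
    [[1, 0, 0, 0, 0, 0, 0, 0], [0, 1, 0, 0, 0, 0, 0, 0], [0, 0, 1, 0, 0, 0, 0, 0], [0, 0, 0, 1,
     0, 0, 0, 0], [0, 0, 0, 0, 1, 0, 0, 0], [0, 0, 0, 0, 0, 1, 0, 0], [0, 0, 0, 0, 0, 0, 1, 0],
     [0, 0, 0, 0, 0, 0, 0, 1]]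
  coroots :=
    [[2, 0, 0, 0, 0, 0, 0, 0], [0, 2, 0, 0, 0, 0, 0, 0], [0, 0, 2, 0, 0, 0, 0, 0], [0, 0, 0, 2,
     0, 0, 0, 0], [0, 0, 0, 0, 2, 0, 0, 0], [0, 0, 0, 0, 0, 2, 0, 0], [0, 0, 0, 0, 0, 0, 2, 0],
     [0, 0, 0, 0, 0, 0, 0, 2]]
  denom := 2
  basis :=
    [(1, [-1, 1, 0, 0, 0, 0, 0, 0], [-2, 0, 2, 0, 0, 0, 0, 0]), (1, [-1, 2, -1, 0, 0, 0, 0, 0],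
     [0, 0, -2, 2, 0, 0, 0, 0]), (1, [-1, 3, -1, -1, 0, 0, 0, 0], [0, 0, 0, -2, 2, 0, 0, 0]),
     (1, [-1, 4, -1, -1, -1, 0, 0, 0], [0, 0, 0, 0, -2, 2, 0, 0]), (1, [-1, 5, -1, -1, -1, -1,
     0, 0], [0, 0, 0, 0, 0, -2, 2, 0]), (1, [-1, 6, -1, -1, -1, -1, -1, 0], [0, 0, 0, 0, 0, 0,
     -2, 2]), (2, [0, 2, 0, 0, 0, 0, 0, 0], [1, 1, 1, 1, 1, 1, 1, -7]), (2, [1, 1, 1, 1, 1, 1,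
     1, 1], [0, 0, 0, 0, 0, 0, 0, 2])]
  weyl := [1, 1, 1, 1, 1, 1, 1, 1]
  -- Here `L_ev` is the lattice `D₈`. The support consists of its two spinor classes, which are the
  -- nonzero isotropic ones and have inner product `1/2` modulo `1`.
  orbit :=
    [([-1, 1, 1, 1, 1, 1, 1, 1], -1)]
  pairings := [2]
  orders := [1]

lemma isRootTable_A4 : tableA4.IsRootTable := by
  constructor <;> decide +kernel

lemma isSignTable_A4 : tableA4.IsSignTable := by
  constructor <;> decide +kernel

lemma isRootTable_A1B3 : tableA1B3.IsRootTable := by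
  constructor <;> decide +kernel

lemma isSignTable_A1B3 : tableA1B3.IsSignTable := by
  constructor <;> decide +kernel

lemma isRootTable_A1C3 : tableA1C3.IsRootTable := by
  constructor <;> decide +kernel

lemma isSignTable_A1C3 : tableA1C3.IsSignTable := by
  constructor <;> decide +kernel

lemma isRootTable_B2G2 : tableB2G2.IsRootTable := by
  constructor <;> decide +kernel

lemma isSignTable_B2G2 : tableB2G2.IsSignTable := by
  constructor <;> decide +kernel

lemma isRootTable_3A2 : table3A2.IsRootTable := by
  constructor <;> decide +kernel

lemma isSignTable_3A2 : table3A2.IsSignTable := by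
  constructor <;> decide +kernel

lemma isRootTable_3A1A3 : table3A1A3.IsRootTable := by
  constructor <;> decide +kernel

lemma isSignTable_3A1A3 : table3A1A3.IsSignTable := by
  constructor <;> decide +kernel

lemma isRootTable_2A1A2B2 : table2A1A2B2.IsRootTable := by
  constructor <;> decide +kernel

lemma isSignTable_2A1A2B2 : table2A1A2B2.IsSignTable := by
  constructor <;> decide +kernel

lemma isRootTable_8A1 : table8A1.IsRootTable := by
  constructor <;> decide +kernel

lemma isSignTable_8A1 : table8A1.IsSignTable := by
  constructor <;> decide +kernel

end RootTheta

end

/-- In each case it only remains to number the simple roots so that the Cartan matrix agrees with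
the coroots of the table. -/
theorem lemma6p2 {ι V W : Type*} [Finite ι] [AddCommGroup V] [Module ℝ V]
    [AddCommGroup W] [Module ℝ W] (R : RootPairing ι ℝ V W) [R.IsRootSystem]
    [R.IsCrystallographic] [R.IsReduced] (b : R.Base) (hR : RootTheta.IsOneOfTheEight b) :
    ∃ ρ : Representation ℂ (Matrix.SpecialLinearGroup (Fin 2) ℤ)
        (RootTheta.Disc (RootTheta.posRootCoeff b) →₀ ℂ),
      RootTheta.IsWeilRepresentation (RootTheta.discForm (RootTheta.posRootCoeff b)) ρ ∧
      ∃ θ : UpperHalfPlane → (RootTheta.Disc (RootTheta.posRootCoeff b) →₀ ℂ),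
        RootTheta.IsHolomorphicModularForm
          (RootTheta.discForm (RootTheta.posRootCoeff b)) ρ 0 θ ∧
        RootTheta.CorrespondsToThetaBlock (RootTheta.posRootCoeff b) θ ∧
        (∀ θ' : UpperHalfPlane → (RootTheta.Disc (RootTheta.posRootCoeff b) →₀ ℂ),
          RootTheta.CorrespondsToThetaBlock (RootTheta.posRootCoeff b) θ' → θ' = θ) ∧
        ∃ χ : RootTheta.orthogonalGroup
            (RootTheta.discForm (RootTheta.posRootCoeff b)) →* ℂˣ,
          orderOf χ = 2 ∧
          ∀ (σ : RootTheta.orthogonalGroup (RootTheta.discForm (RootTheta.posRootCoeff b)))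
            (τ : UpperHalfPlane),
            RootTheta.act (σ : Equiv.Perm _) (θ τ) = (χ σ : ℂ) • θ τ := by
  rcases hR with h | h | h | h | h | h | h | h
  · obtain ⟨L⟩ := RootTheta.exists_realization RootTheta.isRootTable_A4 h (Equiv.refl (Fin 4))
      rfl (by decide +kernel)
    exact L.main RootTheta.isRootTable_A4 RootTheta.isSignTable_A4
  · obtain ⟨L⟩ := RootTheta.exists_realization RootTheta.isRootTable_A1B3 h
      (finSumFinEquiv : Fin 1 ⊕ Fin 3 ≃ Fin 4)
      rfl (by decide +kernel)
    exact L.main RootTheta.isRootTable_A1B3 RootTheta.isSignTable_A1B3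
  · obtain ⟨L⟩ := RootTheta.exists_realization RootTheta.isRootTable_A1C3 h
      (finSumFinEquiv : Fin 1 ⊕ Fin 3 ≃ Fin 4)
      rfl (by decide +kernel)
    exact L.main RootTheta.isRootTable_A1C3 RootTheta.isSignTable_A1C3
  · obtain ⟨L⟩ := RootTheta.exists_realization RootTheta.isRootTable_B2G2 h
      (finSumFinEquiv : Fin 2 ⊕ Fin 2 ≃ Fin 4)
      rfl (by decide +kernel)
    exact L.main RootTheta.isRootTable_B2G2 RootTheta.isSignTable_B2G2
  · obtain ⟨L⟩ := RootTheta.exists_realization RootTheta.isRootTable_3A2 h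
      -- Swapping the factors puts the index of the copy first, so that each copy of the root system
      -- occupies consecutive numbers, as in the table.
      ((Equiv.prodComm _ _).trans finProdFinEquiv : Fin 2 × Fin 3 ≃ Fin 6)
      rfl (by decide +kernel)
    exact L.main RootTheta.isRootTable_3A2 RootTheta.isSignTable_3A2
  · obtain ⟨L⟩ := RootTheta.exists_realization RootTheta.isRootTable_3A1A3 h
      ((Equiv.sumCongr ((Equiv.prodComm _ _).trans finProdFinEquiv) (Equiv.refl _)).trans
        finSumFinEquiv : (Fin 1 × Fin 3) ⊕ Fin 3 ≃ Fin 6)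
      rfl (by decide +kernel)
    exact L.main RootTheta.isRootTable_3A1A3 RootTheta.isSignTable_3A1A3
  · obtain ⟨L⟩ := RootTheta.exists_realization RootTheta.isRootTable_2A1A2B2 h
      ((Equiv.sumCongr ((Equiv.prodComm _ _).trans finProdFinEquiv) finSumFinEquiv).trans
        finSumFinEquiv : (Fin 1 × Fin 2) ⊕ (Fin 2 ⊕ Fin 2) ≃ Fin 6)
      rfl (by decide +kernel)
    exact L.main RootTheta.isRootTable_2A1A2B2 RootTheta.isSignTable_2A1A2B2
  · obtain ⟨L⟩ := RootTheta.exists_realization RootTheta.isRootTable_8A1 h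
      ((Equiv.prodComm _ _).trans finProdFinEquiv : Fin 1 × Fin 8 ≃ Fin 8)
      rfl (by decide +kernel)
    exact L.main RootTheta.isRootTable_8A1 RootTheta.isSignTable_8A1
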